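/- Let $\mathbb{R}^4_1$ be $\mathbb{R}^4$ with $\langle x,y\rangle=-x_1y_1+x_2y_2+x_3y_3+x_4y_4$, and let $\mathbb{S}^3_1=\{x:\langle x,x\rangle=1\}$. Let $\psi:M\to\mathbb{S}^3_1\subset\mathbb{R}^4_1$ be a smooth immersion of a connected surface whose induced metric is non-degenerate (Riemannian or Lorentzian), oriented by a smooth unit normal field $N$ tangent to $\mathbb{S}^3_1$, with $\langle N,N\rangle=\varepsilon=\pm1$. Let $SX=-dN(X)$ be the shape operator, $H=\frac{\varepsilon}{2}\operatorname{tr}S$ the mean curvature, $K$ the Gaussian curvature of the induced metric, $P_1=-2\varepsilon H I+S$, and $L_1f=\operatorname{tr}(P_1\circ\nabla^2f)$, where $\nabla^2 f(X)=\nabla_X\nabla f$. Suppose that $\psi$ is of $L_1$-2-type: $\psi=a+\psi_1+\psi_2$ with $a\in\mathbb{R}^4_1$ constant and $\psi_1,\psi_2:M\to\mathbb{R}^4_1$ smooth non-constant maps such that $L_1\psi_1=\lambda_1\psi_1$, $L_1\psi_2=\lambda_2\psi_2$ (componentwise) for real numbers $\lambda_1\neq\lambda_2$. Then at least one of the following holds.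 (1) Up to a linear isometry of $\mathbb{R}^4_1$, $\psi(M)$ is an open subset of $\mathbb{S}^1_1(\sqrt{1-r^2})\times\mathbb{S}^1(r)=\{-x_1^2+x_2^2=1-r^2,\ x_3^2+x_4^2=r^2\}$ for some $0<r<1$, or of $\mathbb{H}^1(\sqrt{r^2-1})\times\mathbb{S}^1(r)=\{-x_1^2+x_2^2=-(r^2-1),\ x_3^2+x_4^2=r^2\}$ for some $r>1$. (2) $M$ is (locally) a $B$-scroll over a null curve: $M$ is not totally umbilical, and there is a constant $a_0\neq0$ such that every point of $M$ has a neighbourhood which, after a change of parameters, is an open part of a surface $(s,u)\mapsto\gamma(s)+uB(s)$, where $\gamma:I\to\mathbb{S}^3_1$ is a null curve on an open interval with vector fields $A=\gamma',B,C$ along it, tangent to $\mathbb{S}^3_1$, satisfying $\langle A,A\rangle=\langle B,B\rangle=\langle A,C\rangle=\langle B,C\rangle=0$, $\langle A,B\rangle=-1$, $\langle C,C\rangle=1$ and $C'=-a_0A-\kappa B$ for a function $\kappa$ on $I$; near a non-umbilical point $\kappa$ can be taken without zeros. (3) $H$ is non-constant, $K$ is non-constant, and no real constant is a principal curvature (a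 real eigenvalue of $S$) at every point of $M$. -/

import Mathlib

open scoped Manifold ContDiff

noncomputable section

namespace DeSitterSurface

/-- The coordinate plane on which surfaces are modelled. -/
abbrev E2 : Type := EuclideanSpace ℝ (Fin 2)

/-- The underlying vector space of the Lorentz-Minkowski space of dimension four. -/
abbrev R41 : Type := Fin 4 → ℝ

/-- The Lorentzian scalar product of index one. -/
def lorentz (x y : R41) : ℝ := -(x 0 * y 0) + x 1 * y 1 + x 2 * y 2 + x 3 * y 3

/-- The unit De Sitter space. -/
def deSitter : Set R41 := {x | lorentz x x = 1}

/-! ### Linear algebra of a pair of vectors spanning a non-degenerate plane -/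

/-- Gram matrix of a pair of vectors. -/
def gram (E : Fin 2 → R41) : Matrix (Fin 2) (Fin 2) ℝ :=
  Matrix.of fun i j => lorentz (E i) (E j)

/-- The vector `X` of the plane spanned by `E 0, E 1` with `⟨X, E i⟩ = w i`. -/
def raise (E : Fin 2 → R41) (w : Fin 2 → ℝ) : R41 :=
  ∑ i, ((gram E)⁻¹.mulVec w) i • E i

/-- Orthogonal projection onto the plane spanned by `E 0, E 1`. -/
def tangentPart (E : Fin 2 → R41) (v : R41) : R41 :=
  raise E fun i => lorentz v (E i)

/-! ### Immersed surfaces -/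

section Surface

variable {M : Type*} [TopologicalSpace M] [ChartedSpace E2 M]

/-- The `i`-th vector of the standard basis of the tangent space at any point
(the coordinate basis of the preferred chart at that point). -/
def basisVec (i : Fin 2) : E2 := EuclideanSpace.single i 1

/-- Derivative of an `R41`-valued function along the `i`-th basis vector of `T_pM`. -/
def partialVec (F : M → R41) (p : M) (i : Fin 2) : R41 :=
  mfderiv (𝓡 2) 𝓘(ℝ, R41) F p (basisVec i)

/-- Derivative of a real-valued function along the `i`-th basis vector of `T_pM`. -/
def partialReal (f : M → ℝ) (p : M) (i : Fin 2) : ℝ :=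
  mfderiv (𝓡 2) 𝓘(ℝ, ℝ) f p (basisVec i)

/-- `ψ` is a smooth immersion of the surface `M` into the De Sitter space whose induced metric is
non-degenerate, oriented by the smooth unit normal field `N` (tangent to the De Sitter space),
with `⟨N, N⟩ = ε = ±1`. -/
structure IsOrientedSurface (ψ N : M → R41) (ε : ℝ) : Prop where
  smooth : ContMDiff (𝓡 2) 𝓘(ℝ, R41) ∞ ψ
  mem_deSitter : ∀ p, ψ p ∈ deSitter
  immersion : ∀ p, Function.Injective (mfderiv (𝓡 2) 𝓘(ℝ, R41) ψ p)
  nondegenerate : ∀ p, (gram (partialVec ψ p)).det ≠ 0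
  smooth_normal : ContMDiff (𝓡 2) 𝓘(ℝ, R41) ∞ N
  sign : ε = 1 ∨ ε = -1
  unit_normal : ∀ p, lorentz (N p) (N p) = ε
  normal_tangent_deSitter : ∀ p, lorentz (N p) (ψ p) = 0
  normal : ∀ p i, lorentz (N p) (partialVec ψ p i) = 0

/-- Matrix of the shape operator `S X = -dN(X)` of `T_pM` in the standard basis. -/
def shape (ψ N : M → R41) (p : M) : Matrix (Fin 2) (Fin 2) ℝ :=
  (gram (partialVec ψ p))⁻¹ *
    Matrix.of fun i j => -lorentz (partialVec ψ p i) (partialVec N p j)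

/-- Mean curvature `H = (ε / 2) tr S`. -/
def meanCurvature (ψ N : M → R41) (ε : ℝ) (p : M) : ℝ := ε / 2 * (shape ψ N p).trace

/-- `κ` is a principal curvature at `p`: `S X = κ X` for some non-zero `X` in `T_pM`. -/
def IsPrincipalCurvatureAt (ψ N : M → R41) (p : M) (κ : ℝ) : Prop :=
  ∃ X : Fin 2 → ℝ, X ≠ 0 ∧ (shape ψ N p).mulVec X = κ • X

/-- `p` is umbilical: the shape operator at `p` is a multiple of the identity. -/
def IsUmbilicAt (ψ N : M → R41) (p : M) : Prop :=
  ∃ κ : ℝ, shape ψ N p = κ • (1 : Matrix (Fin 2) (Fin 2) ℝ)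

/-- The Newton transformation `P₁ = -2 ε H I + S`. -/
def newton (ψ N : M → R41) (ε : ℝ) (p : M) : Matrix (Fin 2) (Fin 2) ℝ :=
  (-2 * ε * meanCurvature ψ N ε p) • (1 : Matrix (Fin 2) (Fin 2) ℝ) + shape ψ N p

/-- Gradient of `f` for the induced metric, as a vector of `R41` tangent to the surface. -/
def grad (ψ : M → R41) (f : M → ℝ) (p : M) : R41 :=
  raise (partialVec ψ p) (partialReal f p)

/-- Matrix of the operator `X ↦ ∇_X (∇f)` of `T_pM`. The Levi-Civita connection of the induced
metric is the tangential part of the ambient derivative, so that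
`⟨E i, ∇_(E j) ∇f⟩ = ⟨E i, D_(E j) ∇f⟩`. -/
def hessian (ψ : M → R41) (f : M → ℝ) (p : M) : Matrix (Fin 2) (Fin 2) ℝ :=
  (gram (partialVec ψ p))⁻¹ *
    Matrix.of fun i j => lorentz (partialVec ψ p i) (partialVec (grad ψ f) p j)

/-- The Cheng-Yau operator `L₁ f = tr (P₁ ∘ ∇² f)`. -/
def chengYau (ψ N : M → R41) (ε : ℝ) (f : M → ℝ) (p : M) : ℝ :=
  (newton ψ N ε p * hessian ψ f p).trace

/-- `F` is an `R41`-valued eigenfunction of `L₁` (componentwise), smooth and non-constant. -/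
structure IsVectorEigenfunction (ψ N : M → R41) (ε : ℝ) (F : M → R41) (μ : ℝ) : Prop where
  smooth : ContMDiff (𝓡 2) 𝓘(ℝ, R41) ∞ F
  nonconstant : ¬ ∃ v : R41, ∀ p, F p = v
  eigen : ∀ k p, chengYau ψ N ε (fun q => F q k) p = μ * F p k

/-- The surface is of `L₁`-2-type. -/
def IsL1TwoType (ψ N : M → R41) (ε : ℝ) : Prop :=
  ∃ (a : R41) (ψ₁ ψ₂ : M → R41) (μ₁ μ₂ : ℝ), μ₁ ≠ μ₂ ∧
    IsVectorEigenfunction ψ N ε ψ₁ μ₁ ∧ IsVectorEigenfunction ψ N ε ψ₂ μ₂ ∧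
    ∀ p, ψ p = a + ψ₁ p + ψ₂ p

end Surface

/-! ### Gaussian curvature -/

section Gauss

/-- Coordinate vector fields of a parametrization `Ψ`. -/
def coordField (Ψ : E2 → R41) (x : E2) (i : Fin 2) : R41 := fderiv ℝ Ψ x (basisVec i)

/-- Levi-Civita covariant derivative `∇_(∂ i) V` of a vector field `V` tangent to the surface
parametrized by `Ψ`: the tangential part of the ambient derivative. -/
def covDeriv (Ψ : E2 → R41) (i : Fin 2) (V : E2 → R41) (x : E2) : R41 :=
  tangentPart (coordField Ψ x) (fderiv ℝ V x (basisVec i))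

/-- `R(∂₀, ∂₁) ∂₁ = ∇_(∂₀) ∇_(∂₁) ∂₁ - ∇_(∂₁) ∇_(∂₀) ∂₁` (coordinate fields commute). -/
def curvField (Ψ : E2 → R41) (x : E2) : R41 :=
  covDeriv Ψ 0 (covDeriv Ψ 1 fun y => coordField Ψ y 1) x -
    covDeriv Ψ 1 (covDeriv Ψ 0 fun y => coordField Ψ y 1) x

/-- Gaussian curvature `⟨R(∂₀, ∂₁) ∂₁, ∂₀⟩ / (g₀₀ g₁₁ - g₀₁²)` of a parametrized surface. -/
def gaussCurvatureParam (Ψ : E2 → R41) (x : E2) : ℝ :=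
  lorentz (curvField Ψ x) (coordField Ψ x 0) / (gram (coordField Ψ x)).det

/-- Gaussian curvature of the induced metric at `p`, computed in the preferred chart at `p`. -/
def gaussCurvature {M : Type*} [TopologicalSpace M] [ChartedSpace E2 M]
    (ψ : M → R41) (p : M) : ℝ :=
  gaussCurvatureParam (ψ ∘ (extChartAt (𝓡 2) p).symm) (extChartAt (𝓡 2) p p)

end Gauss

/-! ### Standard products -/

/-- `S¹₁(ρ) × S¹(r)`. -/
def productS11S1 (ρ r : ℝ) : Set R41 :=
  {x | -(x 0) ^ 2 + (x 1) ^ 2 = ρ ^ 2 ∧ (x 2) ^ 2 + (x 3) ^ 2 = r ^ 2}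

/-- `H¹(ρ) × S¹(r)`. -/
def productH1S1 (ρ r : ℝ) : Set R41 :=
  {x | -(x 0) ^ 2 + (x 1) ^ 2 = -ρ ^ 2 ∧ (x 2) ^ 2 + (x 3) ^ 2 = r ^ 2}

/-- Up to a linear isometry of the Lorentz-Minkowski space (a congruence of the De Sitter space),
the image of `ψ` is a relatively open subset of `P`. -/
def IsOpenPortionOf {M : Type*} (ψ : M → R41) (P : Set R41) : Prop :=
  ∃ A : R41 ≃ₗ[ℝ] R41, (∀ x y, lorentz (A x) (A y) = lorentz x y) ∧
    ∃ U : Set R41, IsOpen U ∧ Set.range (fun p => A (ψ p)) = U ∩ P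

/-- The image is an open part of `S¹₁(√(1-r²)) × S¹(r)` with `0 < r < 1`, or of
`H¹(√(r²-1)) × S¹(r)` with `r > 1`. -/
def IsOpenPortionOfStandardProduct {M : Type*} (ψ : M → R41) : Prop :=
  (∃ r : ℝ, 0 < r ∧ r < 1 ∧ IsOpenPortionOf ψ (productS11S1 (Real.sqrt (1 - r ^ 2)) r)) ∨
  (∃ r : ℝ, 1 < r ∧ IsOpenPortionOf ψ (productH1S1 (Real.sqrt (r ^ 2 - 1)) r))

/-! ### B-scrolls -/

/-- On the open interval `I`, `γ` is a smooth null curve in the De Sitter space with Cartan frame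
`A = γ', B, C`, pseudo-orthonormal and tangent to the De Sitter space, such that
`C' = -a₀ A - κ B`. -/
structure IsCartanFramedNullCurve (I : Set ℝ) (γ A B C : ℝ → R41) (a₀ : ℝ) (κ : ℝ → ℝ) :
    Prop where
  isOpen : IsOpen I
  ordConnected : I.OrdConnected
  smooth_curve : ContDiffOn ℝ ∞ γ I
  smooth_A : ContDiffOn ℝ ∞ A I
  smooth_B : ContDiffOn ℝ ∞ B I
  smooth_C : ContDiffOn ℝ ∞ C I
  mem_deSitter : ∀ s ∈ I, γ s ∈ deSitter
  tangent_A : ∀ s ∈ I, lorentz (γ s) (A s) = 0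
  tangent_B : ∀ s ∈ I, lorentz (γ s) (B s) = 0
  tangent_C : ∀ s ∈ I, lorentz (γ s) (C s) = 0
  AA : ∀ s ∈ I, lorentz (A s) (A s) = 0
  BB : ∀ s ∈ I, lorentz (B s) (B s) = 0
  AB : ∀ s ∈ I, lorentz (A s) (B s) = -1
  AC : ∀ s ∈ I, lorentz (A s) (C s) = 0
  BC : ∀ s ∈ I, lorentz (B s) (C s) = 0
  CC : ∀ s ∈ I, lorentz (C s) (C s) = 1
  deriv_curve : ∀ s ∈ I, HasDerivAt γ (A s) s
  deriv_C : ∀ s ∈ I, HasDerivAt C (-a₀ • A s - κ s • B s) s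

/-- The ruled surface `(s, u) ↦ γ s + u B s`. -/
def scroll (γ B : ℝ → R41) (x : ℝ × ℝ) : R41 := γ x.1 + x.2 • B x.1

/-- The surface is a B-scroll: for some constant `a₀ ≠ 0`, every point has a neighbourhood which,
after a change of parameters, is an open part of the scroll of a null curve with Cartan frame and
constant `a₀`. The function `κ` of the null curve has no zero if the point is not umbilical, and
the surface is not totally umbilical. (The change of parameters `e` is automatically
smooth, since both sides are immersions.) -/
def IsBScroll {M : Type*} [TopologicalSpace M] [ChartedSpace E2 M] (ψ N : M → R41) : Prop :=
  (∃ p, ¬ IsUmbilicAt ψ N p) ∧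
  ∃ a₀ : ℝ, a₀ ≠ 0 ∧ ∀ p : M,
    ∃ (I : Set ℝ) (γ A B C : ℝ → R41) (κ : ℝ → ℝ) (e : OpenPartialHomeomorph M (ℝ × ℝ)),
      IsCartanFramedNullCurve I γ A B C a₀ κ ∧
      (¬ IsUmbilicAt ψ N p → ∀ s ∈ I, κ s ≠ 0) ∧
      p ∈ e.source ∧ e.target ⊆ I ×ˢ Set.univ ∧ ∀ q ∈ e.source, ψ q = scroll γ B (e q)

end DeSitterSurface

end

/-!
Let `h = tr S` and `D = det S`, so that `H = ε h / 2` and, by the Gauss equation, `K = 1 + ε D`. In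
coordinates `L₁ψ = -2 ε D N + h ψ`, and the decomposition of `ψ` into eigenfunctions amounts to
`L₁(L₁ψ) = (μ₁ + μ₂) L₁ψ - μ₁ μ₂ (ψ - a)`. Its components along `N`, along `ψ` and tangent to the
surface are three equations for `h`, `D` and the functions `⟨a, N⟩` and `⟨a, ψ⟩`
(`IsCoordTwoType.normal_equation`, `position_equation`, `tangent_equation`).

If clause (3) fails then `h` is constant, or `D` is constant, or `D = c (h - c)` for a constant
principal curvature `c`. Differentiating the scalar equations and eliminating `a` with the
tangential one shows in each case that a non-zero polynomial in the remaining function annihilates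
its differential, so that `h` and `D` are both constant (`IsOrientedSurface.isoparametric`). The surface
is not totally umbilical and `D ≠ 0`, since `L₁ψ` would otherwise be an affine function of `ψ`
(`IsOrientedSurface.not_affine`).

If `h² ≠ 4D`, the Codazzi equation makes the shape operator parallel, and then the surface is flat:
`D = -ε` (`IsParamSurface.detS_eq_of_isoparametric`). It follows that the principal curvatures `k`,
`l` are real. The covariant Hessian of each focal map `N + kψ`, `N + lψ` is a multiple of the map,
so that a scalar product `⟨v, N + kψ⟩` vanishes as soon as its 1-jet vanishes at a point. Therefore
the two focal maps take values in orthogonal planes (`IsOrientedSurface.lorentz_focal`), which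
identifies `ψ` with an open part of a standard product.

If `h² = 4D`, the metric is Lorentzian, because the surface is not umbilical. In a null frame `A`,
`B` the second fundamental form `b` satisfies `b(A, A) b(B, B) = 0`. By the Codazzi equation
`b(B, B)` satisfies a linear ordinary differential equation along the integral curves of `A`, and vice versa.
Since integral curves of the two families through nearby points meet, one of the two functions, say
`b(B, B)`, vanishes near any given point (`IsNullFrame.eventually_eq_zero_or`). The integral curves
of `B` are then straight lines, and the surface is the scroll with these rulings over an integral
curve of `A`, along which `A`, `B`, `N` is a Cartan frame (`IsNullFrame.exists_scroll`).
-/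

open scoped Manifold ContDiff

noncomputable section

namespace DeSitterSurface

/-! ### Lorentzian algebra -/

lemma lorentz_comm (x y : R41) : lorentz x y = lorentz y x := by
  simp only [lorentz]; ring

@[simp] lemma lorentz_add_left (x y z : R41) :
    lorentz (x + y) z = lorentz x z + lorentz y z := by
  simp only [lorentz, Pi.add_apply]; ring

@[simp] lemma lorentz_add_right (x y z : R41) :
    lorentz x (y + z) = lorentz x y + lorentz x z := by
  simp only [lorentz, Pi.add_apply]; ring

@[simp] lemma lorentz_sub_left (x y z : R41) :
    lorentz (x - y) z = lorentz x z - lorentz y z := by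
  simp only [lorentz, Pi.sub_apply]; ring

@[simp] lemma lorentz_sub_right (x y z : R41) :
    lorentz x (y - z) = lorentz x y - lorentz x z := by
  simp only [lorentz, Pi.sub_apply]; ring

@[simp] lemma lorentz_smul_left (c : ℝ) (x y : R41) :
    lorentz (c • x) y = c * lorentz x y := by
  simp only [lorentz, Pi.smul_apply, smul_eq_mul]; ring

@[simp] lemma lorentz_smul_right (c : ℝ) (x y : R41) :
    lorentz x (c • y) = c * lorentz x y := by
  simp only [lorentz, Pi.smul_apply, smul_eq_mul]; ring

@[simp] lemma lorentz_neg_right (x y : R41) : lorentz x (-y) = -lorentz x y := by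
  simp only [lorentz, Pi.neg_apply]; ring

@[simp] lemma lorentz_zero_left (y : R41) : lorentz 0 y = 0 := by
  simp [lorentz]

@[simp] lemma lorentz_zero_right (y : R41) : lorentz y 0 = 0 := by
  simp [lorentz]

/-! ### Partial derivatives on the coordinate plane -/

section Calculus

variable {G : Type*} [NormedAddCommGroup G] [NormedSpace ℝ G]

/-- Partial derivative along the `i`-th coordinate of the plane. -/
def pd (i : Fin 2) (F : E2 → G) (x : E2) : G := fderiv ℝ F x (basisVec i)

variable {U : Set E2} {x : E2}

lemma pd_congr {F F' : E2 → G} (h : F =ᶠ[nhds x] F') (i : Fin 2) : pd i F x = pd i F' x := by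
  simp only [pd, h.fderiv_eq]

lemma pd_congr_on (hU : IsOpen U) (hx : x ∈ U) {F F' : E2 → G} (h : ∀ y ∈ U, F y = F' y)
    (i : Fin 2) : pd i F x = pd i F' x :=
  pd_congr (Filter.eventuallyEq_of_mem (hU.mem_nhds hx) h) i

@[simp] lemma pd_const (i : Fin 2) (c : G) : pd i (fun _ : E2 => c) x = 0 := by
  simp [pd]

lemma pd_eq_zero_of_const_on (hU : IsOpen U) (hx : x ∈ U) {F : E2 → G} {c : G}
    (h : ∀ y ∈ U, F y = c) (i : Fin 2) : pd i F x = 0 := by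
  rw [pd_congr_on hU hx (F' := fun _ => c) h, pd_const]

lemma pd_add {F F' : E2 → G} (hF : DifferentiableAt ℝ F x) (hF' : DifferentiableAt ℝ F' x)
    (i : Fin 2) : pd i (fun y => F y + F' y) x = pd i F x + pd i F' x := by
  simp only [pd]; rw [fderiv_fun_add hF hF']; rfl

lemma pd_sub {F F' : E2 → G} (hF : DifferentiableAt ℝ F x) (hF' : DifferentiableAt ℝ F' x)
    (i : Fin 2) : pd i (fun y => F y - F' y) x = pd i F x - pd i F' x := by
  simp only [pd]; rw [fderiv_fun_sub hF hF']; rfl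

lemma pd_neg {F : E2 → G} (i : Fin 2) : pd i (fun y => -F y) x = -pd i F x := by
  simp only [pd]; rw [fderiv_fun_neg]; rfl

lemma pd_smul {f : E2 → ℝ} {F : E2 → G} (hf : DifferentiableAt ℝ f x)
    (hF : DifferentiableAt ℝ F x) (i : Fin 2) :
    pd i (fun y => f y • F y) x = pd i f x • F x + f x • pd i F x := by
  simp only [pd]; rw [fderiv_fun_smul hf hF]; simp [add_comm]

lemma pd_const_smul {F : E2 → G} (hF : DifferentiableAt ℝ F x) (c : ℝ) (i : Fin 2) :
    pd i (fun y => c • F y) x = c • pd i F x := by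
  simp only [pd]; rw [fderiv_fun_const_smul hF]; rfl

lemma pd_mul {f g : E2 → ℝ} (hf : DifferentiableAt ℝ f x) (hg : DifferentiableAt ℝ g x)
    (i : Fin 2) : pd i (fun y => f y * g y) x = pd i f x * g x + f x * pd i g x :=
  pd_smul hf hg i

lemma pd_const_mul {f : E2 → ℝ} (hf : DifferentiableAt ℝ f x) (c : ℝ) (i : Fin 2) :
    pd i (fun y => c * f y) x = c * pd i f x :=
  pd_const_smul hf c i

lemma pd_sq {f : E2 → ℝ} (hf : DifferentiableAt ℝ f x) (i : Fin 2) :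
    pd i (fun y => f y ^ 2) x = 2 * f x * pd i f x := by
  simp only [sq]; rw [pd_mul hf hf]; ring

lemma pd_apply {F : E2 → R41} (hF : DifferentiableAt ℝ F x) (k : Fin 4) (i : Fin 2) :
    pd i (fun y => F y k) x = pd i F x k := by
  simp only [pd]
  rw [show (fun y => F y k) = (ContinuousLinearMap.proj (R := ℝ) (φ := fun _ : Fin 4 => ℝ) k) ∘ F
    from rfl, fderiv_comp x (ContinuousLinearMap.differentiableAt _) hF,
    ContinuousLinearMap.fderiv]
  rfl

lemma differentiableAt_coord {F : E2 → R41} (hF : DifferentiableAt ℝ F x) (k : Fin 4) :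
    DifferentiableAt ℝ (fun y => F y k) x := by
  fun_prop

lemma differentiableAt_lorentz {F F' : E2 → R41} (hF : DifferentiableAt ℝ F x)
    (hF' : DifferentiableAt ℝ F' x) : DifferentiableAt ℝ (fun y => lorentz (F y) (F' y)) x := by
  simp only [lorentz]; fun_prop

lemma pd_lorentz {F F' : E2 → R41} (hF : DifferentiableAt ℝ F x)
    (hF' : DifferentiableAt ℝ F' x) (i : Fin 2) :
    pd i (fun y => lorentz (F y) (F' y)) x =
      lorentz (pd i F x) (F' x) + lorentz (F x) (pd i F' x) := by
  have h := differentiableAt_coord hF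
  have h' := differentiableAt_coord hF'
  have hm : ∀ k, DifferentiableAt ℝ (fun y => F y k * F' y k) x := fun k => (h k).mul (h' k)
  simp only [lorentz]
  rw [pd_add (((hm 0).fun_neg.fun_add (hm 1)).fun_add (hm 2)) (hm 3),
    pd_add ((hm 0).fun_neg.fun_add (hm 1)) (hm 2), pd_add (hm 0).fun_neg (hm 1), pd_neg]
  simp only [pd_mul (h _) (h' _), pd_apply hF, pd_apply hF']
  ring

/-- Smoothness on a set of the coordinate plane. -/
abbrev Smooth (U : Set E2) (F : E2 → G) : Prop := ContDiffOn ℝ ∞ F U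

lemma Smooth.diffAt {F : E2 → G} (hF : Smooth U F) (hU : IsOpen U) (hx : x ∈ U) :
    DifferentiableAt ℝ F x :=
  (hF.contDiffAt (hU.mem_nhds hx)).differentiableAt (by simp)

lemma Smooth.pd {F : E2 → G} (hF : Smooth U F) (hU : IsOpen U) (i : Fin 2) :
    Smooth U (pd i F) := by
  have h : ContDiffOn ℝ ∞ (fderiv ℝ F) U := hF.fderiv_of_isOpen hU (by simp)
  exact h.clm_apply contDiffOn_const

lemma Smooth.lorentz {F F' : E2 → R41} (hF : Smooth U F) (hF' : Smooth U F') :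
    Smooth U (fun y => lorentz (F y) (F' y)) := by
  have h : ∀ k, ContDiffOn ℝ ∞ (fun y => F y k) U := fun k => (contDiffOn_pi.1 hF) k
  have h' : ∀ k, ContDiffOn ℝ ∞ (fun y => F' y k) U := fun k => (contDiffOn_pi.1 hF') k
  simp only [DeSitterSurface.lorentz]
  exact ((((h 0).mul (h' 0)).neg.add ((h 1).mul (h' 1))).add ((h 2).mul (h' 2))).add
    ((h 3).mul (h' 3))

lemma pd_comm {F : E2 → G} (hF : Smooth U F) (hU : IsOpen U) (hx : x ∈ U) (i j : Fin 2) :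
    pd i (pd j F) x = pd j (pd i F) x := by
  have hc : ContDiffAt ℝ ∞ F x := hF.contDiffAt (hU.mem_nhds hx)
  have hd : DifferentiableAt ℝ (fderiv ℝ F) x :=
    (hc.fderiv_right (m := 1) (WithTop.coe_le_coe.2 (le_top : (1 + 1 : ℕ∞) ≤ ⊤))).differentiableAt (by simp)
  have key : ∀ k l : Fin 2, pd k (pd l F) x = fderiv ℝ (fderiv ℝ F) x (basisVec k) (basisVec l) := by
    intro k l
    rw [pd, show pd l F = fun y => (fderiv ℝ F y) (basisVec l) from rfl,
      fderiv_clm_apply hd (differentiableAt_const _)]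
    simp
  rw [key, key]
  exact (hc.isSymmSndFDerivAt (by
    simpa using (WithTop.coe_le_coe.2 le_top : ((2 : ℕ∞) : WithTop ℕ∞) ≤ ∞))) _ _

end Calculus

/-! ### Frames adapted to a surface -/

/-- The vectors `e₀, e₁` span a non-degenerate plane, with orthonormal normal vectors `n`
(of square `ε = ±1`) and `q` (of square `1`): the pointwise data of a surface in De Sitter space,
with `q` the position vector. -/
structure IsAdaptedFrame (e₀ e₁ n q : R41) (ε : ℝ) : Prop where
  sign : ε = 1 ∨ ε = -1
  nn : lorentz n n = ε
  qq : lorentz q q = 1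
  nq : lorentz n q = 0
  n₀ : lorentz n e₀ = 0
  n₁ : lorentz n e₁ = 0
  q₀ : lorentz q e₀ = 0
  q₁ : lorentz q e₁ = 0
  det_ne : lorentz e₀ e₀ * lorentz e₁ e₁ - lorentz e₀ e₁ ^ 2 ≠ 0

namespace IsAdaptedFrame

variable {e₀ e₁ n q : R41} {ε : ℝ}

lemma sign_sq (h : IsAdaptedFrame e₀ e₁ n q ε) : ε * ε = 1 := by
  rcases h.sign with h | h <;> rw [h] <;> norm_num

lemma sign_ne (h : IsAdaptedFrame e₀ e₁ n q ε) : ε ≠ 0 := by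
  rcases h.sign with h | h <;> rw [h] <;> norm_num

/-- The Gram determinant of the frame is `-d²`, where `d` is the determinant of its coordinates. -/
lemma gram_det_mul_sign (h : IsAdaptedFrame e₀ e₁ n q ε) :
    (lorentz e₀ e₀ * lorentz e₁ e₁ - lorentz e₀ e₁ ^ 2) * ε =
      -(Matrix.of ![e₀, e₁, n, q]).det ^ 2 := by
  set m : Matrix (Fin 4) (Fin 4) ℝ := Matrix.of ![e₀, e₁, n, q] with hm
  set η : Matrix (Fin 4) (Fin 4) ℝ := Matrix.diagonal ![-1, 1, 1, 1] with hη
  have hG : m * η * m.transpose = !![lorentz e₀ e₀, lorentz e₀ e₁, 0, 0;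
      lorentz e₀ e₁, lorentz e₁ e₁, 0, 0; 0, 0, ε, 0; 0, 0, 0, 1] := by
    have hrow : ∀ i j, (m * η * m.transpose) i j = lorentz (m i) (m j) := by
      intro i j
      rw [Matrix.mul_apply]
      simp [hη, Matrix.mul_diagonal, Fin.sum_univ_four, lorentz]
    ext i j
    rw [hrow]
    have := h.nn
    have := h.qq
    have := h.nq
    have := h.n₀
    have := h.n₁
    have := h.q₀
    have := h.q₁
    fin_cases i <;> fin_cases j <;> simp [hm] <;>
      first | assumption | (rw [lorentz_comm]; assumption) | skip
    exacts [rfl, rfl, lorentz_comm _ _, rfl]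
  have hd : (m * η * m.transpose).det = -m.det ^ 2 := by
    rw [Matrix.det_mul, Matrix.det_mul, Matrix.det_transpose, hη, Matrix.det_diagonal]
    simp [Fin.prod_univ_four]; ring
  rw [← hd, hG]
  simp [Matrix.det_succ_row_zero, Fin.sum_univ_succ]
  simp [Fin.succAbove]
  ring

/-- The induced metric is Riemannian exactly when the normal vector is timelike. -/
lemma det_mul_sign_neg (h : IsAdaptedFrame e₀ e₁ n q ε) :
    (lorentz e₀ e₀ * lorentz e₁ e₁ - lorentz e₀ e₁ ^ 2) * ε < 0 := by
  have h1 := h.gram_det_mul_sign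
  have h2 : (lorentz e₀ e₀ * lorentz e₁ e₁ - lorentz e₀ e₁ ^ 2) * ε ≠ 0 :=
    mul_ne_zero h.det_ne h.sign_ne
  have h3 : (lorentz e₀ e₀ * lorentz e₁ e₁ - lorentz e₀ e₁ ^ 2) * ε ≤ 0 := by
    rw [h1]; nlinarith [sq_nonneg (Matrix.of ![e₀, e₁, n, q]).det]
  exact lt_of_le_of_ne h3 h2

lemma eq_zero (h : IsAdaptedFrame e₀ e₁ n q ε) {v : R41} (h₀ : lorentz v e₀ = 0)
    (h₁ : lorentz v e₁ = 0) (hn : lorentz v n = 0) (hq : lorentz v q = 0) : v = 0 := by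
  have hdet : (Matrix.of ![e₀, e₁, n, q]).det ≠ 0 := by
    intro h0
    have := h.det_mul_sign_neg
    rw [h.gram_det_mul_sign, h0] at this
    norm_num at this
  have hv : (Matrix.of ![e₀, e₁, n, q]).mulVec ![-v 0, v 1, v 2, v 3] = 0 := by
    ext i
    simp only [lorentz] at h₀ h₁ hn hq
    fin_cases i <;> simp [Matrix.mulVec, dotProduct, Fin.sum_univ_four] <;> linarith
  have h0 := Matrix.eq_zero_of_mulVec_eq_zero hdet hv
  ext i
  have := congrFun h0 i
  fin_cases i <;> simpa using this

lemma ext (h : IsAdaptedFrame e₀ e₁ n q ε) {v w : R41} (h₀ : lorentz v e₀ = lorentz w e₀)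
    (h₁ : lorentz v e₁ = lorentz w e₁) (hn : lorentz v n = lorentz w n)
    (hq : lorentz v q = lorentz w q) : v = w := by
  rw [← sub_eq_zero]
  apply h.eq_zero <;> rw [lorentz_sub_left, sub_eq_zero] <;> assumption

/-- The expansion of a vector in an adapted frame: the tangential part is found by inverting the
Gram matrix. -/
lemma expansion (h : IsAdaptedFrame e₀ e₁ n q ε) (v : R41) :
    v = ((lorentz e₁ e₁ * lorentz v e₀ - lorentz e₀ e₁ * lorentz v e₁) /
          (lorentz e₀ e₀ * lorentz e₁ e₁ - lorentz e₀ e₁ ^ 2)) • e₀ +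
        ((lorentz e₀ e₀ * lorentz v e₁ - lorentz e₀ e₁ * lorentz v e₀) /
          (lorentz e₀ e₀ * lorentz e₁ e₁ - lorentz e₀ e₁ ^ 2)) • e₁ +
        (ε * lorentz v n) • n + lorentz v q • q := by
  have hW := h.det_ne
  have e10 := lorentz_comm e₁ e₀
  have n0 := h.n₀
  have n1 := h.n₁
  have q0 := h.q₀
  have q1 := h.q₁
  have nq := h.nq
  have n0' := (lorentz_comm e₀ n).trans n0
  have n1' := (lorentz_comm e₁ n).trans n1
  have q0' := (lorentz_comm e₀ q).trans q0
  have q1' := (lorentz_comm e₁ q).trans q1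
  have qn := (lorentz_comm q n).trans nq
  apply h.ext <;>
    simp only [lorentz_add_left, lorentz_smul_left, n0, n1, q0, q1, nq, qn, n0', n1', q0', q1',
      h.nn, h.qq, e10]
  · obtain ⟨W, hWd⟩ : ∃ W, W = lorentz e₀ e₀ * lorentz e₁ e₁ - lorentz e₀ e₁ ^ 2 := ⟨_, rfl⟩
    rw [← hWd] at hW ⊢
    field_simp
    rw [hWd]; ring
  · obtain ⟨W, hWd⟩ : ∃ W, W = lorentz e₀ e₀ * lorentz e₁ e₁ - lorentz e₀ e₁ ^ 2 := ⟨_, rfl⟩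
    rw [← hWd] at hW ⊢
    field_simp
    rw [hWd]; ring
  · linear_combination (-lorentz v n) * h.sign_sq
  · ring

/-- The scalar product of two vectors through their components in an adapted frame. -/
lemma lorentz_eq (h : IsAdaptedFrame e₀ e₁ n q ε) (v w : R41) :
    lorentz v w = (lorentz e₁ e₁ * (lorentz v e₀ * lorentz w e₀)
        - lorentz e₀ e₁ * (lorentz v e₀ * lorentz w e₁ + lorentz v e₁ * lorentz w e₀)
        + lorentz e₀ e₀ * (lorentz v e₁ * lorentz w e₁)) /
          (lorentz e₀ e₀ * lorentz e₁ e₁ - lorentz e₀ e₁ ^ 2)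
        + ε * (lorentz v n * lorentz w n) + lorentz v q * lorentz w q := by
  have hW := h.det_ne
  conv_lhs => rw [h.expansion v]
  simp only [lorentz_add_left, lorentz_smul_left, lorentz_comm e₀ w, lorentz_comm e₁ w,
    lorentz_comm n w, lorentz_comm q w]
  field_simp
  ring

end IsAdaptedFrame

/-! ### Parametrized surfaces -/

/-- A parametrization `Ψ` on the open set `U` of the plane, of a surface in De Sitter space with
non-degenerate induced metric and unit normal field `ν` with `⟨ν, ν⟩ = ε`. -/
structure IsParamSurface (U : Set E2) (Ψ ν : E2 → R41) (ε : ℝ) : Prop where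
  isOpen : IsOpen U
  smooth : Smooth U Ψ
  smooth_normal : Smooth U ν
  frame : ∀ x ∈ U, IsAdaptedFrame (pd 0 Ψ x) (pd 1 Ψ x) (ν x) (Ψ x) ε

/-- Coefficients of the first fundamental form. -/
def fff (Ψ : E2 → R41) (i j : Fin 2) (x : E2) : ℝ := lorentz (pd i Ψ x) (pd j Ψ x)

/-- Coefficients `-⟨∂ᵢΨ, ∂ⱼν⟩` of the second fundamental form. -/
def sff (Ψ ν : E2 → R41) (i j : Fin 2) (x : E2) : ℝ := -lorentz (pd i Ψ x) (pd j ν x)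

/-- Determinant of the first fundamental form. -/
def gdet (Ψ : E2 → R41) (x : E2) : ℝ := fff Ψ 0 0 x * fff Ψ 1 1 x - fff Ψ 0 1 x ^ 2

/-- Trace of the shape operator. -/
def trS (Ψ ν : E2 → R41) (x : E2) : ℝ :=
  (fff Ψ 1 1 x * sff Ψ ν 0 0 x - 2 * (fff Ψ 0 1 x * sff Ψ ν 0 1 x)
    + fff Ψ 0 0 x * sff Ψ ν 1 1 x) / gdet Ψ x

/-- Determinant of the shape operator. -/
def detS (Ψ ν : E2 → R41) (x : E2) : ℝ :=
  (sff Ψ ν 0 0 x * sff Ψ ν 1 1 x - sff Ψ ν 0 1 x ^ 2) / gdet Ψ x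

/-- Christoffel symbols of the first kind, `⟨∂ᵢ∂ⱼΨ, ∂ₖΨ⟩`. -/
def chr (Ψ : E2 → R41) (i j k : Fin 2) (x : E2) : ℝ := lorentz (pd i (pd j Ψ) x) (pd k Ψ x)

/-- The covariant derivative of the second fundamental form, written without Christoffel symbols
as `⟨∂ᵢ∂ⱼΨ, ∂ₖν⟩ - ⟨∂ᵢ∂ⱼν, ∂ₖΨ⟩`. -/
def dsff (Ψ ν : E2 → R41) (i j k : Fin 2) (x : E2) : ℝ :=
  lorentz (pd i (pd j Ψ) x) (pd k ν x) - lorentz (pd i (pd j ν) x) (pd k Ψ x)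

namespace IsParamSurface

variable {U : Set E2} {Ψ ν : E2 → R41} {ε : ℝ} {x : E2}

lemma sign (S : IsParamSurface U Ψ ν ε) (hx : x ∈ U) : ε = 1 ∨ ε = -1 := (S.frame x hx).sign

lemma smooth_pd (S : IsParamSurface U Ψ ν ε) (i : Fin 2) : Smooth U (pd i Ψ) :=
  S.smooth.pd S.isOpen i

lemma smooth_pd_normal (S : IsParamSurface U Ψ ν ε) (i : Fin 2) : Smooth U (pd i ν) :=
  S.smooth_normal.pd S.isOpen i

lemma smooth_pd₂ (S : IsParamSurface U Ψ ν ε) (i j : Fin 2) : Smooth U (pd i (pd j Ψ)) :=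
  (S.smooth_pd j).pd S.isOpen i

lemma smooth_pd₂_normal (S : IsParamSurface U Ψ ν ε) (i j : Fin 2) : Smooth U (pd i (pd j ν)) :=
  (S.smooth_pd_normal j).pd S.isOpen i

lemma smooth_fff (S : IsParamSurface U Ψ ν ε) (i j : Fin 2) : Smooth U (fff Ψ i j) :=
  (S.smooth_pd i).lorentz (S.smooth_pd j)

lemma smooth_sff (S : IsParamSurface U Ψ ν ε) (i j : Fin 2) : Smooth U (sff Ψ ν i j) :=
  ((S.smooth_pd i).lorentz (S.smooth_pd_normal j)).neg

lemma smooth_gdet (S : IsParamSurface U Ψ ν ε) : Smooth U (gdet Ψ) :=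
  ((S.smooth_fff 0 0).mul (S.smooth_fff 1 1)).sub ((S.smooth_fff 0 1).pow 2)

lemma gdet_ne (S : IsParamSurface U Ψ ν ε) (hx : x ∈ U) : gdet Ψ x ≠ 0 := (S.frame x hx).det_ne

lemma smooth_trS (S : IsParamSurface U Ψ ν ε) : Smooth U (trS Ψ ν) :=
  ContDiffOn.div ((((S.smooth_fff 1 1).mul (S.smooth_sff 0 0)).sub
    (contDiffOn_const.mul ((S.smooth_fff 0 1).mul (S.smooth_sff 0 1)))).add
      ((S.smooth_fff 0 0).mul (S.smooth_sff 1 1))) S.smooth_gdet fun _ hx => S.gdet_ne hx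

lemma smooth_detS (S : IsParamSurface U Ψ ν ε) : Smooth U (detS Ψ ν) :=
  ContDiffOn.div (((S.smooth_sff 0 0).mul (S.smooth_sff 1 1)).sub
    ((S.smooth_sff 0 1).pow 2)) S.smooth_gdet fun _ hx => S.gdet_ne hx

lemma smooth_chr (S : IsParamSurface U Ψ ν ε) (i j k : Fin 2) : Smooth U (chr Ψ i j k) :=
  (S.smooth_pd₂ i j).lorentz (S.smooth_pd k)

lemma chr_comm (S : IsParamSurface U Ψ ν ε) (hx : x ∈ U) (i j k : Fin 2) :
    chr Ψ i j k x = chr Ψ j i k x := by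
  simp only [chr, pd_comm S.smooth S.isOpen hx i j]

lemma normal_pd (S : IsParamSurface U Ψ ν ε) (hx : x ∈ U) (i : Fin 2) :
    lorentz (ν x) (pd i Ψ x) = 0 := by
  fin_cases i
  · exact (S.frame x hx).n₀
  · exact (S.frame x hx).n₁

lemma position_pd (S : IsParamSurface U Ψ ν ε) (hx : x ∈ U) (i : Fin 2) :
    lorentz (Ψ x) (pd i Ψ x) = 0 := by
  fin_cases i
  · exact (S.frame x hx).q₀
  · exact (S.frame x hx).q₁

lemma normal_pd_normal (S : IsParamSurface U Ψ ν ε) (hx : x ∈ U) (i : Fin 2) :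
    lorentz (ν x) (pd i ν x) = 0 := by
  have hd := S.smooth_normal.diffAt S.isOpen hx
  have h := pd_eq_zero_of_const_on S.isOpen hx (F := fun y => lorentz (ν y) (ν y))
    (fun y hy => (S.frame y hy).nn) i
  rw [pd_lorentz hd hd, lorentz_comm (pd i ν x)] at h
  linarith

lemma position_pd_normal (S : IsParamSurface U Ψ ν ε) (hx : x ∈ U) (i : Fin 2) :
    lorentz (Ψ x) (pd i ν x) = 0 := by
  have h := pd_eq_zero_of_const_on S.isOpen hx (F := fun y => lorentz (ν y) (Ψ y))
    (fun y hy => (S.frame y hy).nq) i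
  rw [pd_lorentz (S.smooth_normal.diffAt S.isOpen hx) (S.smooth.diffAt S.isOpen hx),
    S.normal_pd hx, lorentz_comm] at h
  linarith

lemma normal_pd₂ (S : IsParamSurface U Ψ ν ε) (hx : x ∈ U) (i j : Fin 2) :
    lorentz (pd i (pd j Ψ) x) (ν x) = sff Ψ ν j i x := by
  have h := pd_eq_zero_of_const_on S.isOpen hx (F := fun y => lorentz (ν y) (pd j Ψ y))
    (fun y hy => S.normal_pd hy j) i
  rw [pd_lorentz (S.smooth_normal.diffAt S.isOpen hx) ((S.smooth_pd j).diffAt S.isOpen hx)] at h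
  rw [lorentz_comm, sff, lorentz_comm (pd j Ψ x)]
  linarith

lemma sff_comm (S : IsParamSurface U Ψ ν ε) (hx : x ∈ U) (i j : Fin 2) :
    sff Ψ ν i j x = sff Ψ ν j i x := by
  rw [← S.normal_pd₂ hx, ← S.normal_pd₂ hx, pd_comm S.smooth S.isOpen hx]

lemma fff_comm (Ψ : E2 → R41) (i j : Fin 2) : fff Ψ i j x = fff Ψ j i x := lorentz_comm _ _

lemma position_pd₂ (S : IsParamSurface U Ψ ν ε) (hx : x ∈ U) (i j : Fin 2) :
    lorentz (pd i (pd j Ψ) x) (Ψ x) = -fff Ψ i j x := by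
  have h := pd_eq_zero_of_const_on S.isOpen hx (F := fun y => lorentz (Ψ y) (pd j Ψ y))
    (fun y hy => S.position_pd hy j) i
  rw [pd_lorentz (S.smooth.diffAt S.isOpen hx) ((S.smooth_pd j).diffAt S.isOpen hx)] at h
  rw [lorentz_comm, fff]
  linarith

lemma normal_pd₂_normal (S : IsParamSurface U Ψ ν ε) (hx : x ∈ U) (i j : Fin 2) :
    lorentz (pd i (pd j ν) x) (ν x) = -lorentz (pd i ν x) (pd j ν x) := by
  have h := pd_eq_zero_of_const_on S.isOpen hx (F := fun y => lorentz (ν y) (pd j ν y))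
    (fun y hy => S.normal_pd_normal hy j) i
  rw [pd_lorentz (S.smooth_normal.diffAt S.isOpen hx)
    ((S.smooth_pd_normal j).diffAt S.isOpen hx)] at h
  rw [lorentz_comm]
  linarith

lemma position_pd₂_normal (S : IsParamSurface U Ψ ν ε) (hx : x ∈ U) (i j : Fin 2) :
    lorentz (pd i (pd j ν) x) (Ψ x) = sff Ψ ν i j x := by
  have h := pd_eq_zero_of_const_on S.isOpen hx (F := fun y => lorentz (Ψ y) (pd j ν y))
    (fun y hy => S.position_pd_normal hy j) i
  rw [pd_lorentz (S.smooth.diffAt S.isOpen hx) ((S.smooth_pd_normal j).diffAt S.isOpen hx)] at h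
  rw [lorentz_comm, sff]
  linarith

lemma pd_sff (S : IsParamSurface U Ψ ν ε) (hx : x ∈ U) (l i j : Fin 2) :
    pd l (sff Ψ ν i j) x =
      -lorentz (pd l (pd i Ψ) x) (pd j ν x) - lorentz (pd l (pd j ν) x) (pd i Ψ x) := by
  rw [show sff Ψ ν i j = fun y => -lorentz (pd i Ψ y) (pd j ν y) from rfl, pd_neg,
    pd_lorentz ((S.smooth_pd i).diffAt S.isOpen hx) ((S.smooth_pd_normal j).diffAt S.isOpen hx),
    lorentz_comm (pd i Ψ x)]
  ring

lemma pd_sff_eq (S : IsParamSurface U Ψ ν ε) (hx : x ∈ U) (l i j : Fin 2) :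
    pd l (sff Ψ ν i j) x = dsff Ψ ν l i j x
      - lorentz (pd l (pd i Ψ) x) (pd j ν x) - lorentz (pd l (pd j Ψ) x) (pd i ν x) := by
  rw [pd_congr_on S.isOpen hx (fun y hy => S.sff_comm hy i j), S.pd_sff hx, dsff]
  ring

lemma dsff_comm_left (S : IsParamSurface U Ψ ν ε) (hx : x ∈ U) (i j k : Fin 2) :
    dsff Ψ ν i j k x = dsff Ψ ν j i k x := by
  simp only [dsff, pd_comm S.smooth S.isOpen hx i j, pd_comm S.smooth_normal S.isOpen hx i j]

/-- The Codazzi equation. -/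
lemma dsff_comm_right (S : IsParamSurface U Ψ ν ε) (hx : x ∈ U) (i j k : Fin 2) :
    dsff Ψ ν i j k x = dsff Ψ ν i k j x := by
  have h1 := S.pd_sff_eq hx i j k
  have h2 := S.pd_sff_eq hx i k j
  rw [pd_congr_on S.isOpen hx (fun y hy => S.sff_comm hy k j)] at h2
  linarith

lemma pd_fff (S : IsParamSurface U Ψ ν ε) (hx : x ∈ U) (l i j : Fin 2) :
    pd l (fff Ψ i j) x = chr Ψ l i j x + chr Ψ l j i x := by
  rw [show fff Ψ i j = fun y => lorentz (pd i Ψ y) (pd j Ψ y) from rfl,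
    pd_lorentz ((S.smooth_pd i).diffAt S.isOpen hx) ((S.smooth_pd j).diffAt S.isOpen hx),
    lorentz_comm (pd i Ψ x), chr, chr]

/-- The Weingarten equation: `∂ₖν` is tangent, so that its pairing with an arbitrary vector `v` is
expressed by the two fundamental forms and the tangential part of `v`. -/
lemma lorentz_pd_normal (S : IsParamSurface U Ψ ν ε) (hx : x ∈ U) (v : R41) (k : Fin 2) :
    lorentz v (pd k ν x) =
      -((fff Ψ 1 1 x * sff Ψ ν 0 k x - fff Ψ 0 1 x * sff Ψ ν 1 k x) * lorentz v (pd 0 Ψ x)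
        + (fff Ψ 0 0 x * sff Ψ ν 1 k x - fff Ψ 0 1 x * sff Ψ ν 0 k x) * lorentz v (pd 1 Ψ x))
        / gdet Ψ x := by
  have hW := S.gdet_ne hx
  rw [(S.frame x hx).lorentz_eq v (pd k ν x), lorentz_comm (pd k ν x) (ν x),
    S.normal_pd_normal hx, lorentz_comm (pd k ν x) (Ψ x), S.position_pd_normal hx,
    lorentz_comm (pd k ν x) (pd 0 Ψ x), lorentz_comm (pd k ν x) (pd 1 Ψ x)]
  simp only [sff, fff, gdet] at *
  field_simp
  ring

lemma pd_gdet (S : IsParamSurface U Ψ ν ε) (hx : x ∈ U) (l : Fin 2) :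
    pd l (gdet Ψ) x = 2 * (fff Ψ 1 1 x * chr Ψ l 0 0 x
      - fff Ψ 0 1 x * (chr Ψ l 0 1 x + chr Ψ l 1 0 x) + fff Ψ 0 0 x * chr Ψ l 1 1 x) := by
  have h := fun i j => (S.smooth_fff i j).diffAt S.isOpen hx
  rw [show gdet Ψ = fun y => fff Ψ 0 0 y * fff Ψ 1 1 y - fff Ψ 0 1 y ^ 2 from rfl,
    pd_sub ((h 0 0).fun_mul (h 1 1)) ((h 0 1).fun_pow 2), pd_mul (h 0 0) (h 1 1), pd_sq (h 0 1)]
  simp only [S.pd_fff hx]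
  ring

/-- Jacobi's formula for the derivative of `det S`. The Christoffel symbols cancel, which leaves the
covariant derivative of the second fundamental form. -/
lemma gdet_mul_pd_detS (S : IsParamSurface U Ψ ν ε) (hx : x ∈ U) (l : Fin 2) :
    gdet Ψ x * pd l (detS Ψ ν) x = sff Ψ ν 1 1 x * dsff Ψ ν l 0 0 x
      - 2 * (sff Ψ ν 0 1 x * dsff Ψ ν l 0 1 x) + sff Ψ ν 0 0 x * dsff Ψ ν l 1 1 x := by
  have hW := S.gdet_ne hx
  have hb := fun i j => (S.smooth_sff i j).diffAt S.isOpen hx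
  have h1 : pd l (fun y => gdet Ψ y * detS Ψ ν y) x =
      pd l (fun y => sff Ψ ν 0 0 y * sff Ψ ν 1 1 y - sff Ψ ν 0 1 y ^ 2) x :=
    pd_congr_on S.isOpen hx (fun y hy => by
      simp only [detS]; rw [mul_div_cancel₀ _ (S.gdet_ne hy)]) l
  rw [pd_mul (S.smooth_gdet.diffAt S.isOpen hx) (S.smooth_detS.diffAt S.isOpen hx), S.pd_gdet hx,
    pd_sub ((hb 0 0).fun_mul (hb 1 1)) ((hb 0 1).fun_pow 2), pd_mul (hb 0 0) (hb 1 1), pd_sq (hb 0 1),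
    S.pd_sff_eq hx, S.pd_sff_eq hx, S.pd_sff_eq hx] at h1
  simp only [S.lorentz_pd_normal hx, ← chr.eq_def] at h1
  rw [S.sff_comm hx 1 0] at h1
  have h2 : detS Ψ ν x = (sff Ψ ν 0 0 x * sff Ψ ν 1 1 x - sff Ψ ν 0 1 x ^ 2) / gdet Ψ x := rfl
  rw [h2] at h1
  rw [← sub_eq_zero] at h1 ⊢
  rw [← h1]
  field_simp
  ring

/-- The derivative of `tr S` is the metric trace of the covariant derivative of the second
fundamental form. -/
lemma gdet_mul_pd_trS (S : IsParamSurface U Ψ ν ε) (hx : x ∈ U) (l : Fin 2) :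
    gdet Ψ x * pd l (trS Ψ ν) x = fff Ψ 1 1 x * dsff Ψ ν l 0 0 x
      - 2 * (fff Ψ 0 1 x * dsff Ψ ν l 0 1 x) + fff Ψ 0 0 x * dsff Ψ ν l 1 1 x := by
  have hW := S.gdet_ne hx
  have hb := fun i j => (S.smooth_sff i j).diffAt S.isOpen hx
  have hg := fun i j => (S.smooth_fff i j).diffAt S.isOpen hx
  have h1 : pd l (fun y => gdet Ψ y * trS Ψ ν y) x =
      pd l (fun y => fff Ψ 1 1 y * sff Ψ ν 0 0 y - 2 * (fff Ψ 0 1 y * sff Ψ ν 0 1 y)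
        + fff Ψ 0 0 y * sff Ψ ν 1 1 y) x :=
    pd_congr_on S.isOpen hx (fun y hy => by
      simp only [trS]; rw [mul_div_cancel₀ _ (S.gdet_ne hy)]) l
  rw [pd_mul (S.smooth_gdet.diffAt S.isOpen hx) (S.smooth_trS.diffAt S.isOpen hx), S.pd_gdet hx,
    pd_add (((hg 1 1).fun_mul (hb 0 0)).fun_sub (((hg 0 1).fun_mul (hb 0 1)).const_mul 2))
      ((hg 0 0).fun_mul (hb 1 1)),
    pd_sub ((hg 1 1).fun_mul (hb 0 0)) (((hg 0 1).fun_mul (hb 0 1)).const_mul 2),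
    pd_const_mul ((hg 0 1).fun_mul (hb 0 1)), pd_mul (hg 1 1) (hb 0 0), pd_mul (hg 0 1) (hb 0 1),
    pd_mul (hg 0 0) (hb 1 1),
    S.pd_sff_eq hx, S.pd_sff_eq hx, S.pd_sff_eq hx, S.pd_fff hx, S.pd_fff hx, S.pd_fff hx] at h1
  simp only [S.lorentz_pd_normal hx, ← chr.eq_def] at h1
  rw [S.sff_comm hx 1 0] at h1
  have h2 : trS Ψ ν x = (fff Ψ 1 1 x * sff Ψ ν 0 0 x - 2 * (fff Ψ 0 1 x * sff Ψ ν 0 1 x)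
    + fff Ψ 0 0 x * sff Ψ ν 1 1 x) / gdet Ψ x := rfl
  rw [h2] at h1
  have h3 : gdet Ψ x = fff Ψ 0 0 x * fff Ψ 1 1 x - fff Ψ 0 1 x ^ 2 := rfl
  rw [← sub_eq_zero] at h1 ⊢
  rw [← h1]
  field_simp
  rw [h3]
  ring

end IsParamSurface

/-! ### The Cheng-Yau operator in coordinates -/

section Operator

variable {G : Type*} [NormedAddCommGroup G] [NormedSpace ℝ G]

/-- Coefficients `∂ᵢ∂ⱼF - Γᵏᵢⱼ ∂ₖF` of the covariant Hessian. -/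
def covHess (Ψ : E2 → R41) (i j : Fin 2) (F : E2 → G) (x : E2) : G :=
  pd i (pd j F) x
    - ((fff Ψ 1 1 x * chr Ψ i j 0 x - fff Ψ 0 1 x * chr Ψ i j 1 x) / gdet Ψ x) • pd 0 F x
    - ((fff Ψ 0 0 x * chr Ψ i j 1 x - fff Ψ 0 1 x * chr Ψ i j 0 x) / gdet Ψ x) • pd 1 F x

/-- The Cheng-Yau operator in coordinates. In the plane `P₁ = S - (tr S) I` is minus the adjugate
of `S`, whence `P₁ g⁻¹ = -adj(b) / det g` for the first and second fundamental forms `g` and `b`. -/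
def coordL1 (Ψ ν : E2 → R41) (F : E2 → G) (x : E2) : G :=
  (-1 / gdet Ψ x) • (sff Ψ ν 1 1 x • covHess Ψ 0 0 F x
    - (2 * sff Ψ ν 0 1 x) • covHess Ψ 0 1 F x + sff Ψ ν 0 0 x • covHess Ψ 1 1 F x)

variable {U : Set E2} {Ψ ν : E2 → R41} {ε : ℝ} {x : E2}

lemma pd_pd_congr_on (hU : IsOpen U) (hx : x ∈ U) {F F' : E2 → G} (h : ∀ y ∈ U, F y = F' y)
    (i j : Fin 2) : pd i (pd j F) x = pd i (pd j F') x :=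
  pd_congr_on hU hx (fun _ hy => pd_congr_on hU hy h j) i

lemma coordL1_congr_on (hU : IsOpen U) (hx : x ∈ U) {F F' : E2 → G} (h : ∀ y ∈ U, F y = F' y) :
    coordL1 Ψ ν F x = coordL1 Ψ ν F' x := by
  simp only [coordL1, covHess, pd_pd_congr_on hU hx h, pd_congr_on hU hx h]

lemma covHess_add (hU : IsOpen U) (hx : x ∈ U) {F F' : E2 → G} (hF : Smooth U F)
    (hF' : Smooth U F') (i j : Fin 2) :
    covHess Ψ i j (fun y => F y + F' y) x = covHess Ψ i j F x + covHess Ψ i j F' x := by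
  have h2 : pd i (pd j fun y => F y + F' y) x = pd i (pd j F) x + pd i (pd j F') x := by
    rw [pd_congr_on hU hx (F' := fun y => pd j F y + pd j F' y)
      (fun y hy => pd_add (hF.diffAt hU hy) (hF'.diffAt hU hy) j),
      pd_add ((hF.pd hU j).diffAt hU hx) ((hF'.pd hU j).diffAt hU hx)]
  simp only [covHess, h2, pd_add (hF.diffAt hU hx) (hF'.diffAt hU hx), smul_add]
  abel

lemma covHess_const_smul (hU : IsOpen U) (hx : x ∈ U) {F : E2 → G} (hF : Smooth U F) (c : ℝ)
    (i j : Fin 2) : covHess Ψ i j (fun y => c • F y) x = c • covHess Ψ i j F x := by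
  have h2 : pd i (pd j fun y => c • F y) x = c • pd i (pd j F) x := by
    rw [pd_congr_on hU hx (F' := fun y => c • pd j F y)
      (fun y hy => pd_const_smul (hF.diffAt hU hy) c j),
      pd_const_smul ((hF.pd hU j).diffAt hU hx)]
  simp only [covHess, h2, pd_const_smul (hF.diffAt hU hx), smul_sub, smul_comm c]

lemma covHess_const (c : G) (i j : Fin 2) : covHess Ψ i j (fun _ => c) x = 0 := by
  have h : pd j (fun _ : E2 => c) = fun _ => 0 := by
    funext y; exact pd_const j c
  simp [covHess, h]

lemma covHess_smul (hU : IsOpen U) (hx : x ∈ U) {f : E2 → ℝ} {F : E2 → G} (hf : Smooth U f)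
    (hF : Smooth U F) (i j : Fin 2) :
    covHess Ψ i j (fun y => f y • F y) x = covHess Ψ i j f x • F x + f x • covHess Ψ i j F x
      + (pd i f x • pd j F x + pd j f x • pd i F x) := by
  have h2 : pd i (pd j fun y => f y • F y) x = pd i (pd j f) x • F x + f x • pd i (pd j F) x
      + (pd i f x • pd j F x + pd j f x • pd i F x) := by
    rw [pd_congr_on hU hx (F' := fun y => pd j f y • F y + f y • pd j F y)
      (fun y hy => pd_smul (hf.diffAt hU hy) (hF.diffAt hU hy) j),
      pd_add (((hf.pd hU j).diffAt hU hx).fun_smul (hF.diffAt hU hx))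
        ((hf.diffAt hU hx).fun_smul ((hF.pd hU j).diffAt hU hx)),
      pd_smul ((hf.pd hU j).diffAt hU hx) (hF.diffAt hU hx),
      pd_smul (hf.diffAt hU hx) ((hF.pd hU j).diffAt hU hx)]
    abel
  simp only [covHess, h2, pd_smul (hf.diffAt hU hx) (hF.diffAt hU hx), smul_eq_mul]
  module

lemma coordL1_add (hU : IsOpen U) (hx : x ∈ U) {F F' : E2 → G} (hF : Smooth U F)
    (hF' : Smooth U F') :
    coordL1 Ψ ν (fun y => F y + F' y) x = coordL1 Ψ ν F x + coordL1 Ψ ν F' x := by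
  simp only [coordL1, covHess_add hU hx hF hF']
  module

lemma coordL1_const_smul (hU : IsOpen U) (hx : x ∈ U) {F : E2 → G} (hF : Smooth U F) (c : ℝ) :
    coordL1 Ψ ν (fun y => c • F y) x = c • coordL1 Ψ ν F x := by
  simp only [coordL1, covHess_const_smul hU hx hF]
  module

lemma coordL1_const (c : G) : coordL1 Ψ ν (fun _ => c) x = 0 := by
  simp [coordL1, covHess_const]

lemma coordL1_smul (hU : IsOpen U) (hx : x ∈ U) {f : E2 → ℝ} {F : E2 → G} (hf : Smooth U f)
    (hF : Smooth U F) :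
    coordL1 Ψ ν (fun y => f y • F y) x = coordL1 Ψ ν f x • F x + f x • coordL1 Ψ ν F x
      + (-2 / gdet Ψ x) • (sff Ψ ν 1 1 x • pd 0 f x • pd 0 F x
        - sff Ψ ν 0 1 x • (pd 0 f x • pd 1 F x + pd 1 f x • pd 0 F x)
        + sff Ψ ν 0 0 x • pd 1 f x • pd 1 F x) := by
  simp only [coordL1, covHess_smul hU hx hf hF, smul_eq_mul]
  module

lemma coordL1_apply (hU : IsOpen U) (hx : x ∈ U) {F : E2 → R41} (hF : Smooth U F) (k : Fin 4) :
    coordL1 Ψ ν (fun y => F y k) x = coordL1 Ψ ν F x k := by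
  have h2 : ∀ i j, pd i (pd j fun y => F y k) x = pd i (pd j F) x k := fun i j => by
    rw [pd_congr_on hU hx (F' := fun y => pd j F y k)
      (fun y hy => pd_apply (hF.diffAt hU hy) k j), pd_apply ((hF.pd hU j).diffAt hU hx)]
  simp only [coordL1, covHess, h2, pd_apply (hF.diffAt hU hx), Pi.smul_apply, Pi.add_apply,
    Pi.sub_apply]

end Operator

namespace IsParamSurface

variable {U : Set E2} {Ψ ν : E2 → R41} {ε : ℝ} {x : E2}

lemma covHess_position (S : IsParamSurface U Ψ ν ε) (hx : x ∈ U) (i j : Fin 2) :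
    covHess Ψ i j Ψ x = (ε * sff Ψ ν i j x) • ν x - fff Ψ i j x • Ψ x := by
  have h := (S.frame x hx).expansion (pd i (pd j Ψ) x)
  rw [S.normal_pd₂ hx, S.position_pd₂ hx, S.sff_comm hx j i] at h
  simp only [covHess]
  rw [h]
  simp only [chr, fff, gdet]
  module

/-- `L₁Ψ = -2ε (det S) ν + (tr S) Ψ`. -/
lemma coordL1_position (S : IsParamSurface U Ψ ν ε) (hx : x ∈ U) :
    coordL1 Ψ ν Ψ x = (-2 * ε * detS Ψ ν x) • ν x + trS Ψ ν x • Ψ x := by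
  have hW := S.gdet_ne hx
  simp only [coordL1, S.covHess_position hx, detS, trS]
  match_scalars <;> field_simp <;> ring

lemma lorentz_covHess_normal_pd (S : IsParamSurface U Ψ ν ε) (hx : x ∈ U) (i j k : Fin 2) :
    lorentz (covHess Ψ i j ν x) (pd k Ψ x) = -dsff Ψ ν i j k x := by
  have hW := S.gdet_ne hx
  have hc : ∀ l, lorentz (pd l ν x) (pd k Ψ x) = -sff Ψ ν k l x := fun l => by
    rw [sff, neg_neg, lorentz_comm]
  simp only [covHess, dsff, lorentz_sub_left, lorentz_smul_left, hc]
  rw [S.lorentz_pd_normal hx, ← chr, ← chr, S.sff_comm hx k 0, S.sff_comm hx k 1]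
  field_simp
  ring

/-- The third fundamental form through the first two, by the Cayley-Hamilton theorem. -/
lemma lorentz_pd_normal_pd_normal (S : IsParamSurface U Ψ ν ε) (hx : x ∈ U) (i j : Fin 2) :
    lorentz (pd i ν x) (pd j ν x) =
      trS Ψ ν x * sff Ψ ν i j x - detS Ψ ν x * fff Ψ i j x := by
  have hW := S.gdet_ne hx
  have hc : ∀ k l, lorentz (pd l ν x) (pd k Ψ x) = -sff Ψ ν k l x := fun k l => by
    rw [sff, neg_neg, lorentz_comm]
  rw [S.lorentz_pd_normal hx, hc, hc, trS, detS]
  have h10 := S.sff_comm hx 1 0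
  have g10 := fff_comm Ψ 1 0 (x := x)
  have hWd : gdet Ψ x = fff Ψ 0 0 x * fff Ψ 1 1 x - fff Ψ 0 1 x ^ 2 := rfl
  field_simp
  fin_cases i <;> fin_cases j <;> simp only [Fin.zero_eta, Fin.mk_one, h10, g10] <;> ring

lemma lorentz_covHess_normal_normal (S : IsParamSurface U Ψ ν ε) (hx : x ∈ U) (i j : Fin 2) :
    lorentz (covHess Ψ i j ν x) (ν x) =
      detS Ψ ν x * fff Ψ i j x - trS Ψ ν x * sff Ψ ν i j x := by
  have h : ∀ l, lorentz (pd l ν x) (ν x) = 0 := fun l => by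
    rw [lorentz_comm, S.normal_pd_normal hx]
  simp only [covHess, lorentz_sub_left, lorentz_smul_left, h, S.normal_pd₂_normal hx,
    S.lorentz_pd_normal_pd_normal hx]
  ring

lemma lorentz_covHess_normal_position (S : IsParamSurface U Ψ ν ε) (hx : x ∈ U) (i j : Fin 2) :
    lorentz (covHess Ψ i j ν x) (Ψ x) = sff Ψ ν i j x := by
  have h : ∀ l, lorentz (pd l ν x) (Ψ x) = 0 := fun l => by
    rw [lorentz_comm, S.position_pd_normal hx]
  simp only [covHess, lorentz_sub_left, lorentz_smul_left, h, S.position_pd₂_normal hx]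
  ring

/-- The tangential part of `L₁ν` is the gradient of `det S`. -/
lemma lorentz_coordL1_normal_pd (S : IsParamSurface U Ψ ν ε) (hx : x ∈ U) (k : Fin 2) :
    lorentz (coordL1 Ψ ν ν x) (pd k Ψ x) = pd k (detS Ψ ν) x := by
  have hW := S.gdet_ne hx
  have h := S.gdet_mul_pd_detS hx k
  have hsym : ∀ i j, dsff Ψ ν k i j x = dsff Ψ ν i j k x := fun i j => by
    rw [S.dsff_comm_left hx, S.dsff_comm_right hx]
  simp only [hsym] at h
  simp only [coordL1, lorentz_smul_left, lorentz_add_left, lorentz_sub_left,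
    S.lorentz_covHess_normal_pd hx]
  field_simp
  linarith

lemma lorentz_coordL1_normal_normal (S : IsParamSurface U Ψ ν ε) (hx : x ∈ U) :
    lorentz (coordL1 Ψ ν ν x) (ν x) = trS Ψ ν x * detS Ψ ν x := by
  have hW := S.gdet_ne hx
  simp only [coordL1, lorentz_smul_left, lorentz_add_left, lorentz_sub_left,
    S.lorentz_covHess_normal_normal hx]
  have h1 : trS Ψ ν x * gdet Ψ x = fff Ψ 1 1 x * sff Ψ ν 0 0 x
    - 2 * (fff Ψ 0 1 x * sff Ψ ν 0 1 x) + fff Ψ 0 0 x * sff Ψ ν 1 1 x := by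
    rw [trS]; field_simp
  have h2 : detS Ψ ν x * gdet Ψ x = sff Ψ ν 0 0 x * sff Ψ ν 1 1 x - sff Ψ ν 0 1 x ^ 2 := by
    rw [detS]; field_simp
  field_simp
  linear_combination (detS Ψ ν x) * h1 - 2 * trS Ψ ν x * h2

lemma lorentz_coordL1_normal_position (S : IsParamSurface U Ψ ν ε) (hx : x ∈ U) :
    lorentz (coordL1 Ψ ν ν x) (Ψ x) = -2 * detS Ψ ν x := by
  have hW := S.gdet_ne hx
  simp only [coordL1, lorentz_smul_left, lorentz_add_left, lorentz_sub_left,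
    S.lorentz_covHess_normal_position hx, detS]
  field_simp
  ring

end IsParamSurface

/-! ### The equations of a surface of `L₁`-2-type -/

/-- In coordinates: `Ψ = a + Φ₁ + Φ₂` with `L₁Φᵢ = μᵢΦᵢ`. -/
structure IsCoordTwoType (U : Set E2) (Ψ ν Φ₁ Φ₂ : E2 → R41) (a : R41) (μ₁ μ₂ : ℝ) : Prop where
  smooth₁ : Smooth U Φ₁
  smooth₂ : Smooth U Φ₂
  decomp : ∀ x ∈ U, Ψ x = a + Φ₁ x + Φ₂ x
  eigen₁ : ∀ x ∈ U, coordL1 Ψ ν Φ₁ x = μ₁ • Φ₁ x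
  eigen₂ : ∀ x ∈ U, coordL1 Ψ ν Φ₂ x = μ₂ • Φ₂ x

namespace IsCoordTwoType

variable {U : Set E2} {Ψ ν Φ₁ Φ₂ : E2 → R41} {ε : ℝ} {x : E2} {a : R41} {μ₁ μ₂ : ℝ}

lemma coordL1_position (T : IsCoordTwoType U Ψ ν Φ₁ Φ₂ a μ₁ μ₂) (hU : IsOpen U) (hx : x ∈ U) :
    coordL1 Ψ ν Ψ x = μ₁ • Φ₁ x + μ₂ • Φ₂ x := by
  rw [coordL1_congr_on hU hx T.decomp,
    coordL1_add hU hx (contDiffOn_const.add T.smooth₁) T.smooth₂,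
    coordL1_add hU hx contDiffOn_const T.smooth₁, coordL1_const, T.eigen₁ x hx, T.eigen₂ x hx,
    zero_add]

/-- Consequences of `L₁Ψ = αΨ + β`; the second is the image of the first under `L₁`. -/
lemma affine_relations (T : IsCoordTwoType U Ψ ν Φ₁ Φ₂ a μ₁ μ₂) {α : ℝ} {β : R41}
    (h : ∀ y ∈ U, coordL1 Ψ ν Ψ y = α • Ψ y + β) (hU : IsOpen U) (hx : x ∈ U) :
    (μ₁ - α) • Φ₁ x + (μ₂ - α) • Φ₂ x = α • a + β ∧
      ((μ₁ - α) * μ₁) • Φ₁ x + ((μ₂ - α) * μ₂) • Φ₂ x = 0 := by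
  have h1 : ∀ y ∈ U, (μ₁ - α) • Φ₁ y + (μ₂ - α) • Φ₂ y = α • a + β := fun y hy => by
    have h2 := h y hy
    rw [T.coordL1_position hU hy, T.decomp y hy] at h2
    linear_combination (norm := module) h2
  refine ⟨h1 x hx, ?_⟩
  have h2 := coordL1_congr_on (Ψ := Ψ) (ν := ν) hU hx h1
  rw [coordL1_const, coordL1_add hU hx (T.smooth₁.const_smul _) (T.smooth₂.const_smul _),
    coordL1_const_smul hU hx T.smooth₁, coordL1_const_smul hU hx T.smooth₂, T.eigen₁ x hx,
    T.eigen₂ x hx, smul_smul, smul_smul] at h2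
  exact h2

/-- Eliminating `Φ₁` and `Φ₂` from `Ψ`, `L₁Ψ` and `L₁(L₁Ψ)` gives
`L₁(L₁Ψ) = (μ₁ + μ₂) L₁Ψ - μ₁ μ₂ (Ψ - a)`. -/
lemma vector_equation (T : IsCoordTwoType U Ψ ν Φ₁ Φ₂ a μ₁ μ₂) (S : IsParamSurface U Ψ ν ε)
    (hx : x ∈ U) :
    coordL1 Ψ ν (fun y => (-2 * ε) • detS Ψ ν y • ν y + trS Ψ ν y • Ψ y) x =
      (μ₁ + μ₂) • ((-2 * ε * detS Ψ ν x) • ν x + trS Ψ ν x • Ψ x)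
        - (μ₁ * μ₂) • (Ψ x - a) := by
  have hU := S.isOpen
  have h2 : ∀ y ∈ U, (-2 * ε) • detS Ψ ν y • ν y + trS Ψ ν y • Ψ y = μ₁ • Φ₁ y + μ₂ • Φ₂ y :=
    fun y hy => by rw [← T.coordL1_position hU hy, S.coordL1_position hy, smul_smul]
  rw [coordL1_congr_on hU hx h2, coordL1_add hU hx (T.smooth₁.const_smul μ₁)
    (T.smooth₂.const_smul μ₂), coordL1_const_smul hU hx T.smooth₁,
    coordL1_const_smul hU hx T.smooth₂, T.eigen₁ x hx, T.eigen₂ x hx]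
  rw [← smul_smul (-2 * ε), h2 x hx, T.decomp x hx]
  module

/-- The equation of `L₁`-2-type with `L₁(L₁Ψ)` expanded by the product rule. Its components in the
frame `∂₀Ψ, ∂₁Ψ, ν, Ψ` are the scalar equations below. -/
lemma vector_equation_expanded (T : IsCoordTwoType U Ψ ν Φ₁ Φ₂ a μ₁ μ₂) (S : IsParamSurface U Ψ ν ε)
    (hx : x ∈ U) :
    (-2 * ε) • (coordL1 Ψ ν (detS Ψ ν) x • ν x + detS Ψ ν x • coordL1 Ψ ν ν x
      + (-2 / gdet Ψ x) • (sff Ψ ν 1 1 x • pd 0 (detS Ψ ν) x • pd 0 ν x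
        - sff Ψ ν 0 1 x • (pd 0 (detS Ψ ν) x • pd 1 ν x + pd 1 (detS Ψ ν) x • pd 0 ν x)
        + sff Ψ ν 0 0 x • pd 1 (detS Ψ ν) x • pd 1 ν x))
      + (coordL1 Ψ ν (trS Ψ ν) x • Ψ x
        + trS Ψ ν x • ((-2 * ε * detS Ψ ν x) • ν x + trS Ψ ν x • Ψ x)
      + (-2 / gdet Ψ x) • (sff Ψ ν 1 1 x • pd 0 (trS Ψ ν) x • pd 0 Ψ x
        - sff Ψ ν 0 1 x • (pd 0 (trS Ψ ν) x • pd 1 Ψ x + pd 1 (trS Ψ ν) x • pd 0 Ψ x)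
        + sff Ψ ν 0 0 x • pd 1 (trS Ψ ν) x • pd 1 Ψ x)) =
      (μ₁ + μ₂) • ((-2 * ε * detS Ψ ν x) • ν x + trS Ψ ν x • Ψ x)
        - (μ₁ * μ₂) • (Ψ x - a) := by
  have hU := S.isOpen
  have h1 : Smooth U (fun y => detS Ψ ν y • ν y) := S.smooth_detS.smul S.smooth_normal
  have h2 : Smooth U (fun y => (-2 * ε) • detS Ψ ν y • ν y) := h1.const_smul _
  have h3 : Smooth U (fun y => trS Ψ ν y • Ψ y) := S.smooth_trS.smul S.smooth
  rw [← T.vector_equation S hx, coordL1_add hU hx h2 h3, coordL1_const_smul hU hx h1,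
    coordL1_smul hU hx S.smooth_detS S.smooth_normal, coordL1_smul hU hx S.smooth_trS S.smooth,
    S.coordL1_position hx]

/-- The normal component of the equation of `L₁`-2-type. -/
lemma normal_equation (T : IsCoordTwoType U Ψ ν Φ₁ Φ₂ a μ₁ μ₂) (S : IsParamSurface U Ψ ν ε)
    (hx : x ∈ U) :
    -2 * trS Ψ ν x * detS Ψ ν x ^ 2 - 2 * ε * coordL1 Ψ ν (detS Ψ ν) x
      - 2 * ε * trS Ψ ν x * detS Ψ ν x + 2 * ε * (μ₁ + μ₂) * detS Ψ ν x =
      ε * (μ₁ * μ₂) * lorentz a (ν x) := by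
  have h := congrArg (fun v => lorentz v (ν x)) (T.vector_equation_expanded S hx)
  have hf := S.frame x hx
  have h1 : ∀ i, lorentz (pd i ν x) (ν x) = 0 := fun i => by
    rw [lorentz_comm, S.normal_pd_normal hx]
  have h2 : ∀ i, lorentz (pd i Ψ x) (ν x) = 0 := fun i => by
    rw [lorentz_comm, S.normal_pd hx]
  simp only [lorentz_add_left, lorentz_sub_left, lorentz_smul_left, hf.nn, h1, h2,
    lorentz_comm (Ψ x) (ν x), hf.nq, S.lorentz_coordL1_normal_normal hx] at h
  have he := hf.sign_sq
  linear_combination ε * h + (2 * trS Ψ ν x * detS Ψ ν x ^ 2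
    + 2 * ε * coordL1 Ψ ν (detS Ψ ν) x + 2 * ε * trS Ψ ν x * detS Ψ ν x
    - 2 * ε * (μ₁ + μ₂) * detS Ψ ν x) * he

/-- The component of the equation of `L₁`-2-type along the position vector. -/
lemma position_equation (T : IsCoordTwoType U Ψ ν Φ₁ Φ₂ a μ₁ μ₂) (S : IsParamSurface U Ψ ν ε)
    (hx : x ∈ U) :
    4 * ε * detS Ψ ν x ^ 2 + trS Ψ ν x ^ 2 + coordL1 Ψ ν (trS Ψ ν) x
      - (μ₁ + μ₂) * trS Ψ ν x + μ₁ * μ₂ * (1 - lorentz a (Ψ x)) = 0 := by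
  have h := congrArg (fun v => lorentz v (Ψ x)) (T.vector_equation_expanded S hx)
  have hf := S.frame x hx
  have h1 : ∀ i, lorentz (pd i ν x) (Ψ x) = 0 := fun i => by
    rw [lorentz_comm, S.position_pd_normal hx]
  have h2 : ∀ i, lorentz (pd i Ψ x) (Ψ x) = 0 := fun i => by
    rw [lorentz_comm, S.position_pd hx]
  simp only [lorentz_add_left, lorentz_sub_left, lorentz_smul_left, hf.qq, h1, h2,
    hf.nq, S.lorentz_coordL1_normal_position hx] at h
  linear_combination h

/-- The tangential component of the equation of `L₁`-2-type. -/
lemma tangent_equation (T : IsCoordTwoType U Ψ ν Φ₁ Φ₂ a μ₁ μ₂) (S : IsParamSurface U Ψ ν ε)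
    (hx : x ∈ U) (k : Fin 2) :
    μ₁ * μ₂ * lorentz a (pd k Ψ x) = -6 * ε * detS Ψ ν x * pd k (detS Ψ ν) x
      - 2 / gdet Ψ x *
        ((sff Ψ ν 1 1 x * pd 0 (trS Ψ ν) x - sff Ψ ν 0 1 x * pd 1 (trS Ψ ν) x) * fff Ψ 0 k x
        + (sff Ψ ν 0 0 x * pd 1 (trS Ψ ν) x - sff Ψ ν 0 1 x * pd 0 (trS Ψ ν) x) * fff Ψ 1 k x) := by
  have h := congrArg (fun v => lorentz v (pd k Ψ x)) (T.vector_equation_expanded S hx)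
  have hf := S.frame x hx
  have hW := S.gdet_ne hx
  have h1 : ∀ i, lorentz (pd i ν x) (pd k Ψ x) = -sff Ψ ν i k x := fun i => by
    rw [S.sff_comm hx i k, sff, neg_neg, lorentz_comm]
  have h2 : ∀ i, lorentz (pd i Ψ x) (pd k Ψ x) = fff Ψ i k x := fun i => rfl
  have h3 : detS Ψ ν x * gdet Ψ x = sff Ψ ν 0 0 x * sff Ψ ν 1 1 x - sff Ψ ν 0 1 x ^ 2 := by
    rw [detS]; field_simp
  simp only [lorentz_add_left, lorentz_sub_left, lorentz_smul_left, S.normal_pd hx,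
    S.position_pd hx, h1, h2, S.lorentz_coordL1_normal_pd hx] at h
  have h4 : sff Ψ ν 1 1 x * (pd 0 (detS Ψ ν) x * -sff Ψ ν 0 k x)
      - sff Ψ ν 0 1 x * (pd 0 (detS Ψ ν) x * -sff Ψ ν 1 k x
        + pd 1 (detS Ψ ν) x * -sff Ψ ν 0 k x)
      + sff Ψ ν 0 0 x * (pd 1 (detS Ψ ν) x * -sff Ψ ν 1 k x) =
      -detS Ψ ν x * gdet Ψ x * pd k (detS Ψ ν) x := by
    rw [neg_mul, neg_mul, h3]
    have h10 := S.sff_comm hx 1 0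
    fin_cases k <;> simp only [Fin.zero_eta, Fin.mk_one, h10] <;> ring
  rw [h4] at h
  field_simp at h ⊢
  linear_combination -h

end IsCoordTwoType

/-! ### Covectors and the shape operator -/

/-- The transpose of the shape operator applied to the covector `v`. -/
def covShape (Ψ ν : E2 → R41) (x : E2) (v : Fin 2 → ℝ) (k : Fin 2) : ℝ :=
  ((fff Ψ 1 1 x * sff Ψ ν 0 k x - fff Ψ 0 1 x * sff Ψ ν 1 k x) * v 0
    + (fff Ψ 0 0 x * sff Ψ ν 1 k x - fff Ψ 0 1 x * sff Ψ ν 0 k x) * v 1) / gdet Ψ x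

lemma covShape_add_smul (Ψ ν : E2 → R41) (x : E2) (v w : Fin 2 → ℝ) (p q : ℝ) (k : Fin 2) :
    covShape Ψ ν x (fun i => p * v i + q * w i) k =
      p * covShape Ψ ν x v k + q * covShape Ψ ν x w k := by
  simp only [covShape]; ring

namespace IsParamSurface

variable {U : Set E2} {Ψ ν : E2 → R41} {ε : ℝ} {x : E2}

/-- The Cayley-Hamilton theorem for the shape operator. -/
lemma covShape_covShape (S : IsParamSurface U Ψ ν ε) (hx : x ∈ U) (v : Fin 2 → ℝ) (k : Fin 2) :
    covShape Ψ ν x (covShape Ψ ν x v) k =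
      trS Ψ ν x * covShape Ψ ν x v k - detS Ψ ν x * v k := by
  have hW := S.gdet_ne hx
  have h10 := S.sff_comm hx 1 0
  have hWd : gdet Ψ x = fff Ψ 0 0 x * fff Ψ 1 1 x - fff Ψ 0 1 x ^ 2 := rfl
  fin_cases k <;> simp only [covShape, trS, detS, Fin.zero_eta, Fin.mk_one, h10] <;>
    field_simp <;> rw [hWd] <;> ring

/-- If `(p S + q) v = 0` then the characteristic polynomial of `-q / p`, cleared of denominators,
annihilates `v`. -/
lemma charpoly_mul_eq_zero (S : IsParamSurface U Ψ ν ε) (hx : x ∈ U) {v : Fin 2 → ℝ} {p q : ℝ}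
    (h : ∀ k, p * covShape Ψ ν x v k + q * v k = 0) (k : Fin 2) :
    (q ^ 2 + p * q * trS Ψ ν x + p ^ 2 * detS Ψ ν x) * v k = 0 := by
  have h0 : covShape Ψ ν x (fun k => p * covShape Ψ ν x v k + q * v k) k = 0 := by
    rw [funext h, covShape]; simp
  rw [covShape_add_smul, S.covShape_covShape hx] at h0
  linear_combination (q + p * trS Ψ ν x) * h k - p * h0

lemma pd_lorentz_position (S : IsParamSurface U Ψ ν ε) (hx : x ∈ U) (a : R41) (k : Fin 2) :
    pd k (fun y => lorentz a (Ψ y)) x = lorentz a (pd k Ψ x) := by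
  rw [pd_lorentz (differentiableAt_const a) (S.smooth.diffAt S.isOpen hx)]; simp

lemma pd_lorentz_normal (S : IsParamSurface U Ψ ν ε) (hx : x ∈ U) (a : R41) (k : Fin 2) :
    pd k (fun y => lorentz a (ν y)) x =
      -covShape Ψ ν x (fun i => lorentz a (pd i Ψ x)) k := by
  rw [pd_lorentz (differentiableAt_const a) (S.smooth_normal.diffAt S.isOpen hx),
    S.lorentz_pd_normal hx, covShape]
  simp; ring

lemma diffAt_lorentz_position (S : IsParamSurface U Ψ ν ε) (hx : x ∈ U) (a : R41) :
    DifferentiableAt ℝ (fun y => lorentz a (Ψ y)) x :=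
  differentiableAt_lorentz (differentiableAt_const a) (S.smooth.diffAt S.isOpen hx)

lemma diffAt_lorentz_normal (S : IsParamSurface U Ψ ν ε) (hx : x ∈ U) (a : R41) :
    DifferentiableAt ℝ (fun y => lorentz a (ν y)) x :=
  differentiableAt_lorentz (differentiableAt_const a) (S.smooth_normal.diffAt S.isOpen hx)

end IsParamSurface

/-! ### Rigidity of the equations of `L₁`-2-type -/

namespace IsCoordTwoType

variable {U : Set E2} {Ψ ν Φ₁ Φ₂ : E2 → R41} {ε : ℝ} {x : E2} {a : R41} {μ₁ μ₂ : ℝ}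

/-- The tangential equation as an identity of covectors:
`μ₁ μ₂ ⟨a, ∂Ψ⟩ = -6 ε (det S) d(det S) + 2 (S - tr S) d(tr S)`. -/
lemma tangent_equation_covShape (T : IsCoordTwoType U Ψ ν Φ₁ Φ₂ a μ₁ μ₂)
    (S : IsParamSurface U Ψ ν ε)
    (hx : x ∈ U) (k : Fin 2) :
    μ₁ * μ₂ * lorentz a (pd k Ψ x) = -6 * ε * detS Ψ ν x * pd k (detS Ψ ν) x
      + 2 * (covShape Ψ ν x (fun i => pd i (trS Ψ ν) x) k - trS Ψ ν x * pd k (trS Ψ ν) x) := by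
  rw [T.tangent_equation S hx k]
  have hW := S.gdet_ne hx
  have h10 := S.sff_comm hx 1 0
  have g10 := IsParamSurface.fff_comm Ψ 1 0 (x := x)
  fin_cases k <;> simp only [covShape, trS, Fin.zero_eta, Fin.mk_one, h10, g10] <;>
    field_simp <;> ring

/-- When `tr S` is constant, the derivative of the position equation, compared with the tangential
equation, gives `14 (det S) d(det S) = 0`. -/
lemma detS_mul_pd_detS_eq_zero (T : IsCoordTwoType U Ψ ν Φ₁ Φ₂ a μ₁ μ₂)
    (S : IsParamSurface U Ψ ν ε) {c : ℝ} (hc : ∀ y ∈ U, trS Ψ ν y = c) (hx : x ∈ U) (k : Fin 2) :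
    detS Ψ ν x * pd k (detS Ψ ν) x = 0 := by
  have hU := S.isOpen
  have hv : ∀ y ∈ U, ∀ i, pd i (trS Ψ ν) y = 0 := fun y hy i =>
    pd_eq_zero_of_const_on hU hy hc i
  have hL : ∀ y ∈ U, coordL1 Ψ ν (trS Ψ ν) y = 0 := fun y hy => by
    rw [coordL1_congr_on hU hy (F' := fun _ => c) hc, coordL1_const]
  have hD := S.smooth_detS.diffAt hU hx
  have hpos : pd k (fun y => 4 * ε * detS Ψ ν y ^ 2 - μ₁ * μ₂ * lorentz a (Ψ y)) x = 0 :=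
    pd_eq_zero_of_const_on hU hx (c := -c ^ 2 + (μ₁ + μ₂) * c - μ₁ * μ₂) (fun y hy => by
      have h := T.position_equation S hy
      rw [hL y hy, hc y hy] at h
      linear_combination h) k
  rw [pd_sub ((hD.fun_pow 2).const_mul _) ((S.diffAt_lorentz_position hx a).const_mul _),
    pd_const_mul (hD.fun_pow 2), pd_sq hD, pd_const_mul (S.diffAt_lorentz_position hx a),
    S.pd_lorentz_position hx] at hpos
  have ht := T.tangent_equation_covShape S hx k
  simp only [hv x hx] at ht
  have h0 : covShape Ψ ν x (fun _ => (0 : ℝ)) k = 0 := by simp [covShape]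
  rw [h0] at ht
  have he := (S.frame x hx).sign_sq
  linear_combination (ε / 14) * (hpos + ht) - (detS Ψ ν x * pd k (detS Ψ ν) x) * he

/-- The divergence of the tangential equation when `det S` is constant. It rests on
`div P₁ = 0`. -/
lemma two_mul_coordL1_trS (T : IsCoordTwoType U Ψ ν Φ₁ Φ₂ a μ₁ μ₂)
    (S : IsParamSurface U Ψ ν ε) {d : ℝ} (hd : ∀ y ∈ U, detS Ψ ν y = d) (hx : x ∈ U) :
    2 * coordL1 Ψ ν (trS Ψ ν) x =
      μ₁ * μ₂ * (ε * trS Ψ ν x * lorentz a (ν x) - 2 * lorentz a (Ψ x)) := by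
  have hU := S.isOpen
  have hW := S.gdet_ne hx
  have hb := fun i j => (S.smooth_sff i j).diffAt hU hx
  have hg := fun i j => (S.smooth_fff i j).diffAt hU hx
  have hh := fun i => (S.smooth_trS.pd hU i).diffAt hU hx
  have hw := S.smooth_gdet.diffAt hU hx
  have htan : ∀ y ∈ U, ∀ k, μ₁ * μ₂ * (gdet Ψ y * lorentz a (pd k Ψ y)) = -2 *
        ((sff Ψ ν 1 1 y * pd 0 (trS Ψ ν) y - sff Ψ ν 0 1 y * pd 1 (trS Ψ ν) y) * fff Ψ 0 k y
        + (sff Ψ ν 0 0 y * pd 1 (trS Ψ ν) y - sff Ψ ν 0 1 y * pd 0 (trS Ψ ν) y) * fff Ψ 1 k y) := by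
    intro y hy k
    have h := T.tangent_equation S hy k
    rw [pd_eq_zero_of_const_on hU hy hd k] at h
    have hW' := S.gdet_ne hy
    field_simp at h ⊢
    linear_combination h
  have hder : ∀ l k, μ₁ * μ₂ * (pd l (gdet Ψ) x * lorentz a (pd k Ψ x)
      + gdet Ψ x * lorentz a (pd l (pd k Ψ) x)) = -2 *
      ((pd l (sff Ψ ν 1 1) x * pd 0 (trS Ψ ν) x + sff Ψ ν 1 1 x * pd l (pd 0 (trS Ψ ν)) x
        - pd l (sff Ψ ν 0 1) x * pd 1 (trS Ψ ν) x - sff Ψ ν 0 1 x * pd l (pd 1 (trS Ψ ν)) x)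
          * fff Ψ 0 k x
      + (sff Ψ ν 1 1 x * pd 0 (trS Ψ ν) x - sff Ψ ν 0 1 x * pd 1 (trS Ψ ν) x) * pd l (fff Ψ 0 k) x
      + (pd l (sff Ψ ν 0 0) x * pd 1 (trS Ψ ν) x + sff Ψ ν 0 0 x * pd l (pd 1 (trS Ψ ν)) x
        - pd l (sff Ψ ν 0 1) x * pd 0 (trS Ψ ν) x - sff Ψ ν 0 1 x * pd l (pd 0 (trS Ψ ν)) x)
          * fff Ψ 1 k x
      + (sff Ψ ν 0 0 x * pd 1 (trS Ψ ν) x - sff Ψ ν 0 1 x * pd 0 (trS Ψ ν) x)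
          * pd l (fff Ψ 1 k) x) := by
    intro l k
    have hΨ := (S.smooth_pd k).diffAt hU hx
    have ha := differentiableAt_lorentz (differentiableAt_const a) hΨ
    have h := pd_congr_on hU hx (fun y hy => htan y hy k) l
    rw [pd_const_mul (hw.fun_mul ha), pd_mul hw ha, pd_lorentz (differentiableAt_const a) hΨ,
      pd_const_mul (((((hb 1 1).fun_mul (hh 0)).fun_sub ((hb 0 1).fun_mul (hh 1))).fun_mul
        (hg 0 k)).fun_add ((((hb 0 0).fun_mul (hh 1)).fun_sub
          ((hb 0 1).fun_mul (hh 0))).fun_mul (hg 1 k))),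
      pd_add ((((hb 1 1).fun_mul (hh 0)).fun_sub ((hb 0 1).fun_mul (hh 1))).fun_mul (hg 0 k))
        ((((hb 0 0).fun_mul (hh 1)).fun_sub ((hb 0 1).fun_mul (hh 0))).fun_mul (hg 1 k)),
      pd_mul (((hb 1 1).fun_mul (hh 0)).fun_sub ((hb 0 1).fun_mul (hh 1))) (hg 0 k),
      pd_mul (((hb 0 0).fun_mul (hh 1)).fun_sub ((hb 0 1).fun_mul (hh 0))) (hg 1 k),
      pd_sub ((hb 1 1).fun_mul (hh 0)) ((hb 0 1).fun_mul (hh 1)),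
      pd_sub ((hb 0 0).fun_mul (hh 1)) ((hb 0 1).fun_mul (hh 0)),
      pd_mul (hb 1 1) (hh 0), pd_mul (hb 0 1) (hh 1), pd_mul (hb 0 0) (hh 1),
      pd_mul (hb 0 1) (hh 0), pd_const, lorentz_zero_left, zero_add] at h
    linear_combination h
  have h00 := hder 0 0
  have h01 := hder 0 1
  have h10 := hder 1 0
  have h11 := hder 1 1
  have t0 := htan x hx 0
  have t1 := htan x hx 1
  have hexp : ∀ l k, lorentz a (pd l (pd k Ψ) x) =
      (fff Ψ 1 1 x * (lorentz a (pd 0 Ψ x) * chr Ψ l k 0 x)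
        - fff Ψ 0 1 x * (lorentz a (pd 0 Ψ x) * chr Ψ l k 1 x
          + lorentz a (pd 1 Ψ x) * chr Ψ l k 0 x)
        + fff Ψ 0 0 x * (lorentz a (pd 1 Ψ x) * chr Ψ l k 1 x)) / gdet Ψ x
      + ε * (lorentz a (ν x) * sff Ψ ν k l x) - lorentz a (Ψ x) * fff Ψ l k x := by
    intro l k
    rw [(S.frame x hx).lorentz_eq a (pd l (pd k Ψ) x), S.normal_pd₂ hx, S.position_pd₂ hx]
    simp only [chr, fff, gdet]
    ring
  have hchr := S.chr_comm hx 1 0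
  have hs10 := S.sff_comm hx 1 0
  have hf10 := IsParamSurface.fff_comm Ψ 1 0 (x := x)
  have hhc := pd_comm S.smooth_trS hU hx 1 0
  have hdl : ∀ i j k, dsff Ψ ν i j k x = dsff Ψ ν j i k x := S.dsff_comm_left hx
  have hdr : ∀ i j k, dsff Ψ ν i j k x = dsff Ψ ν i k j x := S.dsff_comm_right hx
  have e1 : dsff Ψ ν 0 1 1 x = dsff Ψ ν 1 0 1 x := hdl _ _ _
  have e2 : dsff Ψ ν 0 0 1 x = dsff Ψ ν 1 0 0 x := (hdr _ _ _).trans (hdl _ _ _)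
  rw [hexp] at h00 h01 h10 h11
  simp only [S.pd_gdet hx, S.pd_fff hx, S.pd_sff_eq hx, S.lorentz_pd_normal hx, ← chr.eq_def,
    hchr, hs10, hf10, hhc, e1, e2] at h00 h01 h10 h11 t0 t1
  have hWd : gdet Ψ x = fff Ψ 0 0 x * fff Ψ 1 1 x - fff Ψ 0 1 x ^ 2 := rfl
  have htr : trS Ψ ν x = (fff Ψ 1 1 x * sff Ψ ν 0 0 x - 2 * (fff Ψ 0 1 x * sff Ψ ν 0 1 x)
    + fff Ψ 0 0 x * sff Ψ ν 1 1 x) / gdet Ψ x := rfl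
  simp only [coordL1, covHess, smul_eq_mul]
  rw [htr]
  clear htr hexp hder htan hhc hchr hs10 hf10 e1 e2 hdl hdr hb hg hh hw
  generalize gdet Ψ x = W at *
  generalize pd 0 (trS Ψ ν) x = v₀ at *
  generalize pd 1 (trS Ψ ν) x = v₁ at *
  generalize pd 0 (pd 0 (trS Ψ ν)) x = v₀₀ at *
  generalize pd 0 (pd 1 (trS Ψ ν)) x = v₀₁ at *
  generalize pd 1 (pd 1 (trS Ψ ν)) x = v₁₁ at *
  generalize fff Ψ 0 0 x = g₀₀ at *
  generalize fff Ψ 0 1 x = g₀₁ at *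
  generalize fff Ψ 1 1 x = g₁₁ at *
  generalize sff Ψ ν 0 0 x = b₀₀ at *
  generalize sff Ψ ν 0 1 x = b₀₁ at *
  generalize sff Ψ ν 1 1 x = b₁₁ at *
  generalize lorentz a (pd 0 Ψ x) = a₀ at *
  generalize lorentz a (pd 1 Ψ x) = a₁ at *
  generalize lorentz a (ν x) = α at *
  generalize lorentz a (Ψ x) = β at *
  generalize chr Ψ 0 0 0 x = c₀₀₀ at *
  generalize chr Ψ 0 0 1 x = c₀₀₁ at *
  generalize chr Ψ 0 1 0 x = c₀₁₀ at *
  generalize chr Ψ 0 1 1 x = c₀₁₁ at *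
  generalize chr Ψ 1 1 0 x = c₁₁₀ at *
  generalize chr Ψ 1 1 1 x = c₁₁₁ at *
  generalize dsff Ψ ν 0 0 0 x = d₀₀₀ at *
  generalize dsff Ψ ν 1 0 0 x = d₁₀₀ at *
  generalize dsff Ψ ν 1 0 1 x = d₁₀₁ at *
  generalize dsff Ψ ν 1 1 1 x = d₁₁₁ at *
  -- the traced derivative of the tangential equation, with `a₀` and `a₁` eliminated
  linear_combination (norm := skip) (-1 / W ^ 2) * ((g₁₁ * h00 - g₀₁ * (h01 + h10) + g₀₀ * h11)
    - (1 / W) * (g₁₁ * (2 * (g₁₁ * c₀₀₀ - g₀₁ * (c₀₀₁ + c₀₁₀) + g₀₀ * c₀₁₁))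
        - g₀₁ * (2 * (g₁₁ * c₀₁₀ - g₀₁ * (c₀₁₁ + c₁₁₀) + g₀₀ * c₁₁₁))
        + g₁₁ * (g₁₁ * c₀₀₀ - g₀₁ * c₀₀₁) - 2 * g₀₁ * (g₁₁ * c₀₁₀ - g₀₁ * c₀₁₁)
        + g₀₀ * (g₁₁ * c₁₁₀ - g₀₁ * c₁₁₁)) * t0
    - (1 / W) * (-g₀₁ * (2 * (g₁₁ * c₀₀₀ - g₀₁ * (c₀₀₁ + c₀₁₀) + g₀₀ * c₀₁₁))
        + g₀₀ * (2 * (g₁₁ * c₀₁₀ - g₀₁ * (c₀₁₁ + c₁₁₀) + g₀₀ * c₁₁₁))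
        + g₁₁ * (g₀₀ * c₀₀₁ - g₀₁ * c₀₀₀) - 2 * g₀₁ * (g₀₀ * c₀₁₁ - g₀₁ * c₀₁₀)
        + g₀₀ * (g₀₀ * c₁₁₁ - g₀₁ * c₁₁₀)) * t1)
  field_simp
  rw [hWd]
  ring

/-- The shape operator applied to a tangential equation of the form
`μ₁ μ₂ ⟨a, ∂Ψ⟩ = (2 S - w) d(tr S)`, reduced by the Cayley-Hamilton theorem. -/
lemma covShape_tangent_equation (S : IsParamSurface U Ψ ν ε) (hx : x ∈ U)
    {w : ℝ} (hw : ∀ k, μ₁ * μ₂ * lorentz a (pd k Ψ x) =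
      2 * covShape Ψ ν x (fun i => pd i (trS Ψ ν) x) k - w * pd k (trS Ψ ν) x) (k : Fin 2) :
    μ₁ * μ₂ * covShape Ψ ν x (fun i => lorentz a (pd i Ψ x)) k =
      (2 * trS Ψ ν x - w) * covShape Ψ ν x (fun i => pd i (trS Ψ ν) x) k
        - 2 * detS Ψ ν x * pd k (trS Ψ ν) x := by
  have h1 : μ₁ * μ₂ * covShape Ψ ν x (fun i => lorentz a (pd i Ψ x)) k =
      covShape Ψ ν x (fun i => μ₁ * μ₂ * lorentz a (pd i Ψ x)) k := by
    simp only [covShape]; ring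
  have h2 := covShape_add_smul Ψ ν x (covShape Ψ ν x (fun i => pd i (trS Ψ ν) x))
    (fun i => pd i (trS Ψ ν) x) 2 (-w) k
  simp only [neg_mul, ← sub_eq_add_neg] at h2
  rw [h1, funext hw, h2, S.covShape_covShape hx]
  ring

section DetConstant

variable {d : ℝ}

lemma tangent_equation_of_detS_const (T : IsCoordTwoType U Ψ ν Φ₁ Φ₂ a μ₁ μ₂)
    (S : IsParamSurface U Ψ ν ε) (hd : ∀ y ∈ U, detS Ψ ν y = d) (hx : x ∈ U) (k : Fin 2) :
    μ₁ * μ₂ * lorentz a (pd k Ψ x) =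
      2 * covShape Ψ ν x (fun i => pd i (trS Ψ ν) x) k - 2 * trS Ψ ν x * pd k (trS Ψ ν) x := by
  rw [T.tangent_equation_covShape S hx k, pd_eq_zero_of_const_on S.isOpen hx hd k]
  ring

lemma normal_equation_of_detS_const (T : IsCoordTwoType U Ψ ν Φ₁ Φ₂ a μ₁ μ₂)
    (S : IsParamSurface U Ψ ν ε) (hd : ∀ y ∈ U, detS Ψ ν y = d) (hx : x ∈ U) :
    ε * (μ₁ * μ₂) * lorentz a (ν x) =
      -2 * d * (d + ε) * trS Ψ ν x + 2 * ε * (μ₁ + μ₂) * d := by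
  have h := T.normal_equation S hx
  rw [coordL1_congr_on S.isOpen hx (F' := fun _ => d) hd, coordL1_const, hd x hx] at h
  linear_combination -h

/-- When `det S = d` is constant, the derivative of the normal equation annihilates `d(tr S)` unless
`d = 0` or `d = -2ε`. -/
lemma mul_pd_trS_eq_zero_of_detS_const (T : IsCoordTwoType U Ψ ν Φ₁ Φ₂ a μ₁ μ₂)
    (S : IsParamSurface U Ψ ν ε) (hd : ∀ y ∈ U, detS Ψ ν y = d) (hx : x ∈ U) (k : Fin 2) :
    d * (d + 2 * ε) * pd k (trS Ψ ν) x = 0 := by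
  have hU := S.isOpen
  have hh := S.smooth_trS.diffAt hU hx
  have h := pd_congr_on hU hx (fun y hy => T.normal_equation_of_detS_const S hd hy) k
  rw [pd_const_mul (S.diffAt_lorentz_normal hx a), S.pd_lorentz_normal hx,
    pd_add (hh.const_mul _) (differentiableAt_const _), pd_const_mul hh, pd_const] at h
  have h1 := covShape_tangent_equation S hx
    (fun k => T.tangent_equation_of_detS_const S hd hx k) k
  rw [hd x hx] at h1
  linear_combination (1 / 2) * h + (ε / 2) * h1

/-- When `det S = d` is constant, eliminating `L₁(tr S)` and `⟨a, ν⟩` expresses `⟨a, Ψ⟩` by `tr S`.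
The derivative of this relation says that `4 S - w` annihilates `d(tr S)` for an affine function `w`
of `tr S`, hence so does the characteristic polynomial. Its leading coefficient is non-zero for the
two values `d = 0` and `d = -2ε` left open by `mul_pd_trS_eq_zero_of_detS_const`. -/
lemma quadratic_mul_pd_trS_eq_zero_of_detS_const (T : IsCoordTwoType U Ψ ν Φ₁ Φ₂ a μ₁ μ₂)
    (S : IsParamSurface U Ψ ν ε) (hd : ∀ y ∈ U, detS Ψ ν y = d) (hx : x ∈ U) (k : Fin 2) :
    ((-(6 - 2 * d ^ 2 - 2 * ε * d) * trS Ψ ν x - (μ₁ + μ₂) * (ε * d - 1)) ^ 2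
      + 4 * (-(6 - 2 * d ^ 2 - 2 * ε * d) * trS Ψ ν x - (μ₁ + μ₂) * (ε * d - 1)) * trS Ψ ν x
      + 4 ^ 2 * d) * pd k (trS Ψ ν) x = 0 := by
  have hU := S.isOpen
  have hh := S.smooth_trS.diffAt hU hx
  have hβ : ∀ y ∈ U, 2 * (μ₁ * μ₂) * lorentz a (Ψ y) = (1 - d ^ 2 - ε * d) * trS Ψ ν y ^ 2
      + (μ₁ + μ₂) * (ε * d - 1) * trS Ψ ν y + (4 * ε * d ^ 2 + μ₁ * μ₂) := fun y hy => by
    have h1 := T.two_mul_coordL1_trS S hd hy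
    have h2 := T.normal_equation_of_detS_const S hd hy
    have h3 := T.position_equation S hy
    rw [hd y hy] at h3
    linear_combination -h3 + (1 / 2) * h1 + (1 / 2) * trS Ψ ν y * h2
  rw [← hd x hx]
  refine S.charpoly_mul_eq_zero hx (v := fun i => pd i (trS Ψ ν) x) (fun i => ?_) k
  have h := pd_congr_on hU hx hβ i
  rw [pd_const_mul (S.diffAt_lorentz_position hx a), S.pd_lorentz_position hx,
    pd_add (((hh.fun_pow 2).const_mul _).fun_add (hh.const_mul _)) (differentiableAt_const _),
    pd_add ((hh.fun_pow 2).const_mul _) (hh.const_mul _), pd_const_mul (hh.fun_pow 2),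
    pd_const_mul hh, pd_const, pd_sq hh] at h
  have h1 := T.tangent_equation_of_detS_const S hd hx i
  rw [hd x hx]
  linear_combination h - 2 * h1

end DetConstant

/-- When `c` is a principal curvature everywhere, that is `det S = c (tr S - c)`, a fixed polynomial
in `tr S` of degree four, not zero if `c ≠ 0`, annihilates `d(tr S)`. The two factors come from the
characteristic polynomial of `S`, which splits over the principal curvatures `c` and `tr S - c`. -/
lemma quartic_mul_pd_trS_eq_zero (T : IsCoordTwoType U Ψ ν Φ₁ Φ₂ a μ₁ μ₂)
    (S : IsParamSurface U Ψ ν ε) {c : ℝ} (hc : ∀ y ∈ U, detS Ψ ν y = c * (trS Ψ ν y - c))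
    (hx : x ∈ U) (k : Fin 2) :
    (6 * c ^ 2 * (trS Ψ ν x - c) ^ 2 - (18 * c ^ 3 + 2 * ε * c) * (trS Ψ ν x - c)
        - 2 * ε * c ^ 2) *
      (12 * c ^ 2 * (trS Ψ ν x - c) ^ 2 + (-24 * c ^ 3 + 2 * ε * c) * (trS Ψ ν x - c)
        - 6 * ε * c ^ 2) * pd k (trS Ψ ν) x = 0 := by
  have hU := S.isOpen
  have hh := S.smooth_trS.diffAt hU hx
  have he := (S.frame x hx).sign_sq
  have hLD : ∀ y ∈ U, coordL1 Ψ ν (detS Ψ ν) y = c * coordL1 Ψ ν (trS Ψ ν) y := fun y hy => by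
    rw [coordL1_congr_on hU hy (F' := fun y => c • trS Ψ ν y + (-c ^ 2))
      (fun z hz => by rw [hc z hz, smul_eq_mul]; ring),
      coordL1_add hU hy (S.smooth_trS.const_smul c) contDiffOn_const,
      coordL1_const_smul hU hy S.smooth_trS, coordL1_const, add_zero, smul_eq_mul]
  have hv : ∀ i, pd i (detS Ψ ν) x = c * pd i (trS Ψ ν) x := fun i => by
    rw [pd_congr_on hU hx hc, pd_const_mul (hh.fun_sub (differentiableAt_const _)),
      pd_sub hh (differentiableAt_const _), pd_const, sub_zero]
  -- `L₁(tr S)` is eliminated between the normal and the position equations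
  have hq : ∀ y ∈ U, ε * (μ₁ * μ₂) * lorentz a (ν y) + 2 * ε * c * (μ₁ * μ₂) * lorentz a (Ψ y) =
      -2 * c ^ 2 * trS Ψ ν y * (trS Ψ ν y - c) ^ 2 + 8 * c ^ 3 * (trS Ψ ν y - c) ^ 2
        + 2 * ε * c ^ 2 * trS Ψ ν y
        + (2 * ε * c * (μ₁ * μ₂) - 2 * ε * c ^ 2 * (μ₁ + μ₂)) := fun y hy => by
    have h1 := T.normal_equation S hy
    have h2 := T.position_equation S hy
    rw [hLD y hy, hc y hy] at h1
    rw [hc y hy] at h2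
    have he' := (S.frame y hy).sign_sq
    linear_combination -h1 - 2 * ε * c * h2 + 8 * c ^ 3 * (trS Ψ ν y - c) ^ 2 * he'
  have ht : ∀ i, μ₁ * μ₂ * lorentz a (pd i Ψ x) =
      2 * covShape Ψ ν x (fun i => pd i (trS Ψ ν) x) i
        - (6 * ε * c ^ 2 * (trS Ψ ν x - c) + 2 * trS Ψ ν x) * pd i (trS Ψ ν) x := fun i => by
    rw [T.tangent_equation_covShape S hx i, hv, hc x hx]; ring
  have hlin : ∀ i, (6 * c ^ 2 * (trS Ψ ν x - c) + 4 * ε * c) *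
        covShape Ψ ν x (fun i => pd i (trS Ψ ν) x) i
      + (6 * c ^ 2 * (trS Ψ ν x - c) ^ 2 - (24 * c ^ 3 + 2 * ε * c) * (trS Ψ ν x - c)
        - 6 * ε * c ^ 2) * pd i (trS Ψ ν) x = 0 := fun i => by
    have h := pd_congr_on hU hx hq i
    have hs := hh.fun_sub (differentiableAt_const c)
    rw [pd_add ((S.diffAt_lorentz_normal hx a).const_mul _)
        ((S.diffAt_lorentz_position hx a).const_mul _),
      pd_const_mul (S.diffAt_lorentz_normal hx a), S.pd_lorentz_normal hx,
      pd_const_mul (S.diffAt_lorentz_position hx a), S.pd_lorentz_position hx,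
      pd_add ((((hh.const_mul _).fun_mul (hs.fun_pow 2)).fun_add
        ((hs.fun_pow 2).const_mul _)).fun_add (hh.const_mul _)) (differentiableAt_const _),
      pd_add (((hh.const_mul _).fun_mul (hs.fun_pow 2)).fun_add ((hs.fun_pow 2).const_mul _))
        (hh.const_mul _),
      pd_add ((hh.const_mul _).fun_mul (hs.fun_pow 2)) ((hs.fun_pow 2).const_mul _),
      pd_mul (hh.const_mul _) (hs.fun_pow 2), pd_const_mul hh, pd_const_mul hh,
      pd_const_mul (hs.fun_pow 2), pd_sq hs, pd_sub hh (differentiableAt_const c), pd_const,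
      pd_const] at h
    have h1 := covShape_tangent_equation S hx ht i
    rw [hc x hx] at h1
    have h2 := ht i
    linear_combination (norm := skip) h + ε * h1 - 2 * ε * c * h2
    ring_nf
    simp only [show ε ^ 2 = 1 by rw [sq, he]]
    ring
  have h := S.charpoly_mul_eq_zero hx (v := fun i => pd i (trS Ψ ν) x) hlin k
  rw [hc x hx] at h
  linear_combination h

end IsCoordTwoType

/-! ### The Gauss equation -/

lemma gram_inv (E : Fin 2 → R41) : (gram E)⁻¹ =
    (gram E).det⁻¹ • !![lorentz (E 1) (E 1), -lorentz (E 0) (E 1);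
      -lorentz (E 0) (E 1), lorentz (E 0) (E 0)] := by
  rw [Matrix.inv_def, Ring.inverse_eq_inv', Matrix.adjugate_fin_two]
  simp [gram, lorentz_comm (E 1) (E 0)]

lemma det_gram (E : Fin 2 → R41) : (gram E).det =
    lorentz (E 0) (E 0) * lorentz (E 1) (E 1) - lorentz (E 0) (E 1) ^ 2 := by
  rw [Matrix.det_fin_two]
  simp only [gram, Matrix.of_apply, lorentz_comm (E 1) (E 0)]
  ring

lemma raise_eq (E : Fin 2 → R41) (w : Fin 2 → ℝ) : raise E w =
    ((lorentz (E 1) (E 1) * w 0 - lorentz (E 0) (E 1) * w 1) / (gram E).det) • E 0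
      + ((lorentz (E 0) (E 0) * w 1 - lorentz (E 0) (E 1) * w 0) / (gram E).det) • E 1 := by
  rw [raise, gram_inv, Fin.sum_univ_two]
  congr 2 <;> simp [Matrix.mulVec, dotProduct, Fin.sum_univ_two] <;> ring

namespace IsParamSurface

variable {U : Set E2} {Ψ ν : E2 → R41} {ε : ℝ} {x : E2}

lemma det_gram_coordField (Ψ : E2 → R41) (x : E2) : (gram (coordField Ψ x)).det = gdet Ψ x :=
  det_gram _

lemma tangentPart_eq (S : IsParamSurface U Ψ ν ε) (hx : x ∈ U) (v : R41) :
    tangentPart (coordField Ψ x) v =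
      v - (ε * lorentz v (ν x)) • ν x - lorentz v (Ψ x) • Ψ x := by
  have h := (S.frame x hx).expansion v
  rw [tangentPart, raise_eq, det_gram, eq_sub_iff_add_eq, eq_sub_iff_add_eq]
  conv_rhs => rw [h]
  simp only [coordField, pd]
  module

/-- The component along `∂₀Ψ` of a second covariant derivative of the coordinate field `∂ₖΨ`. The
terms in `ν` and `Ψ` come from the normal part of the first derivative. -/
lemma lorentz_covDeriv_covDeriv (S : IsParamSurface U Ψ ν ε) (hx : x ∈ U) (i j k : Fin 2) :
    lorentz (covDeriv Ψ i (covDeriv Ψ j fun y => coordField Ψ y k) x) (pd 0 Ψ x) =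
      lorentz (pd i (pd j (pd k Ψ)) x) (pd 0 Ψ x) + ε * sff Ψ ν k j x * sff Ψ ν 0 i x
        + fff Ψ j k x * fff Ψ i 0 x := by
  have hU := S.isOpen
  have h1 : ∀ y ∈ U, covDeriv Ψ j (fun y => coordField Ψ y k) y =
      pd j (pd k Ψ) y - (ε * sff Ψ ν k j y) • ν y - (-fff Ψ j k y) • Ψ y := fun y hy => by
    rw [covDeriv, S.tangentPart_eq hy,
      show fderiv ℝ (fun y => coordField Ψ y k) y (basisVec j) = pd j (pd k Ψ) y from rfl,
      S.normal_pd₂ hy, S.position_pd₂ hy]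
  have d1 := (S.smooth_pd₂ j k).diffAt hU hx
  have d2 := ((S.smooth_sff k j).diffAt hU hx).const_mul ε
  have d3 := ((S.smooth_fff j k).diffAt hU hx).fun_neg
  have d4 := S.smooth_normal.diffAt hU hx
  have d5 := S.smooth.diffAt hU hx
  rw [covDeriv, S.tangentPart_eq hx, show fderiv ℝ (covDeriv Ψ j fun y => coordField Ψ y k) x
    (basisVec i) = pd i (covDeriv Ψ j fun y => coordField Ψ y k) x from rfl,
    pd_congr_on hU hx h1, pd_sub (d1.fun_sub (d2.fun_smul d4)) (d3.fun_smul d5),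
    pd_sub d1 (d2.fun_smul d4), pd_smul d2 d4, pd_smul d3 d5]
  have h2 : lorentz (pd i ν x) (pd 0 Ψ x) = -sff Ψ ν 0 i x := by
    rw [sff, neg_neg, lorentz_comm]
  simp only [lorentz_sub_left, lorentz_add_left, lorentz_smul_left, S.normal_pd hx,
    S.position_pd hx, h2]
  rw [show lorentz (pd i Ψ x) (pd 0 Ψ x) = fff Ψ i 0 x from rfl]
  ring

/-- The Gauss equation `K = 1 + ε det S`. -/
lemma gaussCurvatureParam_eq (S : IsParamSurface U Ψ ν ε) (hx : x ∈ U) :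
    gaussCurvatureParam Ψ x = 1 + ε * detS Ψ ν x := by
  have hW := S.gdet_ne hx
  have hU := S.isOpen
  rw [gaussCurvatureParam, det_gram_coordField, curvField,
    show coordField Ψ x 0 = pd 0 Ψ x from rfl, lorentz_sub_left, S.lorentz_covDeriv_covDeriv hx,
    S.lorentz_covDeriv_covDeriv hx, pd_comm (S.smooth_pd 1) hU hx 1 0, S.sff_comm hx 1 0, detS,
    fff_comm Ψ 1 0, div_eq_iff hW]
  have hWd : gdet Ψ x = fff Ψ 0 0 x * fff Ψ 1 1 x - fff Ψ 0 1 x ^ 2 := rfl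
  field_simp
  rw [hWd]
  ring

/-! ### Surfaces with constant principal curvatures -/

/-- The discriminant of the characteristic polynomial of the shape operator, through the three
minors of the pair of fundamental forms. -/
lemma discr_mul_gdet_sq (S : IsParamSurface U Ψ ν ε) (hx : x ∈ U) :
    (trS Ψ ν x ^ 2 - 4 * detS Ψ ν x) * gdet Ψ x ^ 2 =
      (fff Ψ 0 0 x * sff Ψ ν 1 1 x - fff Ψ 1 1 x * sff Ψ ν 0 0 x) ^ 2
      + 4 * (fff Ψ 0 0 x * sff Ψ ν 0 1 x - fff Ψ 0 1 x * sff Ψ ν 0 0 x)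
        * (fff Ψ 1 1 x * sff Ψ ν 0 1 x - fff Ψ 0 1 x * sff Ψ ν 1 1 x) := by
  have hW := S.gdet_ne hx
  have hWd : gdet Ψ x = fff Ψ 0 0 x * fff Ψ 1 1 x - fff Ψ 0 1 x ^ 2 := rfl
  rw [trS, detS]
  field_simp
  rw [hWd]
  ring

/-- If the principal curvatures are constant and distinct (real or not), the shape operator is
parallel. The components of `∇b` solve a linear system whose matrix is the Sylvester matrix of the
two fundamental forms, seen as binary quadratic forms. -/
lemma dsff_eq_zero (S : IsParamSurface U Ψ ν ε) {h d : ℝ} (hh : ∀ y ∈ U, trS Ψ ν y = h)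
    (hd : ∀ y ∈ U, detS Ψ ν y = d) (hδ : h ^ 2 - 4 * d ≠ 0) (hx : x ∈ U) (i j k : Fin 2) :
    dsff Ψ ν i j k x = 0 := by
  have hU := S.isOpen
  have hR := S.discr_mul_gdet_sq hx
  rw [hh x hx, hd x hx] at hR
  have hR0 : (h ^ 2 - 4 * d) * gdet Ψ x ^ 2 ≠ 0 := mul_ne_zero hδ (pow_ne_zero 2 (S.gdet_ne hx))
  rw [hR] at hR0
  have hdl : ∀ i j k, dsff Ψ ν i j k x = dsff Ψ ν j i k x := S.dsff_comm_left hx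
  have hdr : ∀ i j k, dsff Ψ ν i j k x = dsff Ψ ν i k j x := S.dsff_comm_right hx
  have g0 := S.gdet_mul_pd_trS hx 0
  have g1 := S.gdet_mul_pd_trS hx 1
  have b0 := S.gdet_mul_pd_detS hx 0
  have b1 := S.gdet_mul_pd_detS hx 1
  have e1 : dsff Ψ ν 1 0 1 x = dsff Ψ ν 0 1 1 x := hdl _ _ _
  have e2 : dsff Ψ ν 1 0 0 x = dsff Ψ ν 0 0 1 x := (hdl _ _ _).trans (hdr _ _ _)
  have e3 : dsff Ψ ν 1 1 0 x = dsff Ψ ν 0 1 1 x := (hdr _ _ _).trans e1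
  have e4 : dsff Ψ ν 0 1 0 x = dsff Ψ ν 0 0 1 x := hdr _ _ _
  rw [pd_eq_zero_of_const_on hU hx hh, mul_zero] at g0 g1
  rw [pd_eq_zero_of_const_on hU hx hd, mul_zero] at b0 b1
  rw [e1, e2] at g1 b1
  generalize fff Ψ 0 0 x = g₀₀ at *
  generalize fff Ψ 0 1 x = g₀₁ at *
  generalize fff Ψ 1 1 x = g₁₁ at *
  generalize sff Ψ ν 0 0 x = b₀₀ at *
  generalize sff Ψ ν 0 1 x = b₀₁ at *
  generalize sff Ψ ν 1 1 x = b₁₁ at *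
  have t1 : dsff Ψ ν 0 0 1 x = 0 := by
    refine (mul_eq_zero.1 ?_).resolve_left hR0
    linear_combination (g₀₀ * b₁₁ - g₁₁ * b₀₀) * (b₀₀ * g1 - g₀₀ * b1)
      + 2 * (g₀₀ * b₀₁ - g₀₁ * b₀₀) * (g₁₁ * b0 - b₁₁ * g0)
  have t2 : dsff Ψ ν 0 1 1 x = 0 := by
    refine (mul_eq_zero.1 ?_).resolve_left hR0
    linear_combination (g₀₀ * b₁₁ - g₁₁ * b₀₀) * (g₁₁ * b0 - b₁₁ * g0)
      + 2 * (g₁₁ * b₀₁ - g₀₁ * b₁₁) * (g₀₀ * b1 - b₀₀ * g1)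
  have t0 : dsff Ψ ν 0 0 0 x = 0 := by
    refine (mul_eq_zero.1 ?_).resolve_left hR0
    rw [t1, t2] at g0 b0
    linear_combination (g₀₀ * b₁₁ - g₁₁ * b₀₀) * (b₀₀ * g0 - g₀₀ * b0)
      + 4 * (g₀₀ * b₀₁ - g₀₁ * b₀₀) * (g₀₁ * b0 - b₀₁ * g0)
  have t3 : dsff Ψ ν 1 1 1 x = 0 := by
    refine (mul_eq_zero.1 ?_).resolve_left hR0
    rw [t1, t2] at g1 b1
    linear_combination (g₀₀ * b₁₁ - g₁₁ * b₀₀) * (g₁₁ * b1 - b₁₁ * g1)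
      + 4 * (g₁₁ * b₀₁ - g₀₁ * b₁₁) * (g₀₁ * b1 - b₀₁ * g1)
  fin_cases i <;> fin_cases j <;> fin_cases k <;>
    simp only [Fin.zero_eta, Fin.mk_one, e1, e2, e3, e4, t0, t1, t2, t3]

/-- A surface with constant distinct principal curvatures is flat. -/
lemma detS_eq_of_isoparametric (S : IsParamSurface U Ψ ν ε) {h d : ℝ}
    (hh : ∀ y ∈ U, trS Ψ ν y = h) (hd : ∀ y ∈ U, detS Ψ ν y = d) (hδ : h ^ 2 - 4 * d ≠ 0)
    (hx : x ∈ U) : d = -ε := by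
  have hU := S.isOpen
  have hW := S.gdet_ne hx
  have hT : ∀ i j k, ∀ y ∈ U, lorentz (pd i (pd j ν) y) (pd k Ψ y) =
      lorentz (pd i (pd j Ψ) y) (pd k ν y) := fun i j k y hy => by
    have := S.dsff_eq_zero hh hd hδ hy i j k
    rw [dsff] at this
    linarith
  -- `Z(k,i;l,j) = ⟨∂ₖ∂ᵢν, ∂ₗ∂ⱼΨ⟩ - ⟨∂ₖ∂ᵢΨ, ∂ₗ∂ⱼν⟩` is symmetric in `k` and `l`
  have hZ : ∀ i j k l, lorentz (pd k (pd i ν) x) (pd l (pd j Ψ) x)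
      - lorentz (pd k (pd i Ψ) x) (pd l (pd j ν) x) =
      lorentz (pd l (pd k (pd i Ψ)) x) (pd j ν x)
        - lorentz (pd l (pd k (pd i ν)) x) (pd j Ψ x) := fun i j k l => by
    have h1 := pd_congr_on hU hx (hT k i j) l
    rw [pd_lorentz ((S.smooth_pd₂_normal k i).diffAt hU hx) ((S.smooth_pd j).diffAt hU hx),
      pd_lorentz ((S.smooth_pd₂ k i).diffAt hU hx) ((S.smooth_pd_normal j).diffAt hU hx)] at h1
    linarith
  have hsym : ∀ i j, lorentz (pd 0 (pd i ν) x) (pd 1 (pd j Ψ) x)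
      - lorentz (pd 0 (pd i Ψ) x) (pd 1 (pd j ν) x) =
      lorentz (pd 1 (pd i ν) x) (pd 0 (pd j Ψ) x)
      - lorentz (pd 1 (pd i Ψ) x) (pd 0 (pd j ν) x) := fun i j => by
    rw [hZ, hZ, pd_comm (S.smooth_pd i) hU hx, pd_comm (S.smooth_pd_normal i) hU hx]
  have hval : ∀ i j k l, lorentz (pd k (pd i ν) x) (pd l (pd j Ψ) x)
      - lorentz (pd k (pd i Ψ) x) (pd l (pd j ν) x) =
      (1 + ε * d) * (fff Ψ k i x * sff Ψ ν j l x - sff Ψ ν k i x * fff Ψ l j x) :=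
    fun i j k l => by
    have hf := S.frame x hx
    have he := hf.sign_sq
    have hs := S.sff_comm hx
    rw [hf.lorentz_eq (pd k (pd i ν) x), hf.lorentz_eq (pd k (pd i Ψ) x), S.normal_pd₂ hx,
      S.normal_pd₂ hx, S.position_pd₂ hx, S.position_pd₂ hx, S.normal_pd₂_normal hx,
      S.normal_pd₂_normal hx, S.position_pd₂_normal hx, S.position_pd₂_normal hx,
      S.lorentz_pd_normal_pd_normal hx, S.lorentz_pd_normal_pd_normal hx, hh x hx, hd x hx]
    simp only [hT _ _ _ x hx, S.lorentz_pd_normal hx, hs 1 0, hs i k, hs l j]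
    simp only [fff, gdet] at hW ⊢
    field_simp
    ring
  have h00 := hsym 0 0
  have h11 := hsym 1 1
  have h01 := hsym 0 1
  rw [hval, hval] at h00 h11 h01
  simp only [S.sff_comm hx 1 0, fff_comm Ψ 1 0] at h00 h11 h01
  by_contra hne
  have hk : 1 + ε * d ≠ 0 := fun h0 => hne (by
    linear_combination ε * h0 - d * (S.frame x hx).sign_sq)
  have hR := S.discr_mul_gdet_sq hx
  rw [hh x hx, hd x hx] at hR
  have hR0 : (h ^ 2 - 4 * d) * gdet Ψ x ^ 2 ≠ 0 := mul_ne_zero hδ (pow_ne_zero 2 hW)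
  apply hR0
  rw [hR]
  have z0 : fff Ψ 0 0 x * sff Ψ ν 0 1 x - fff Ψ 0 1 x * sff Ψ ν 0 0 x = 0 := by
    refine (mul_eq_zero.1 ?_).resolve_left hk
    linear_combination (1 / 2) * h00
  have z1 : fff Ψ 0 0 x * sff Ψ ν 1 1 x - fff Ψ 1 1 x * sff Ψ ν 0 0 x = 0 := by
    refine (mul_eq_zero.1 ?_).resolve_left hk
    linear_combination h01
  rw [z0, z1]
  ring

end IsParamSurface

/-! ### Passage to charts -/

section Charts

variable {M : Type*} [TopologicalSpace M] [ChartedSpace E2 M]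

/-- The expression of a function in the preferred chart at `p`. -/
def inChart {G : Type*} (p : M) (F : M → G) : E2 → G := F ∘ (extChartAt (𝓡 2) p).symm

/-- The image of the preferred chart at `p`. -/
abbrev chartImage (p : M) : Set E2 := (extChartAt (𝓡 2) p).target

lemma isOpen_chartImage (p : M) : IsOpen (chartImage p) := isOpen_extChartAt_target p

lemma inChart_extChartAt {G : Type*} {F : M → G} {p q : M} (hq : q ∈ (extChartAt (𝓡 2) p).source) :
    inChart p F (extChartAt (𝓡 2) p q) = F q := by
  simp only [inChart, Function.comp, (extChartAt (𝓡 2) p).left_inv hq]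

variable {G : Type*} [NormedAddCommGroup G] [NormedSpace ℝ G]

lemma sum_basisVec (v : E2) : v = ∑ i, v i • basisVec i := by
  ext k
  fin_cases k <;> simp [basisVec, Fin.sum_univ_two]

variable [IsManifold (𝓡 2) ∞ M]

lemma smooth_inChart {F : M → G} (hF : ContMDiff (𝓡 2) 𝓘(ℝ, G) ∞ F) (p : M) :
    Smooth (chartImage p) (inChart p F) :=
  contMDiffOn_iff_contDiffOn.1 (hF.comp_contMDiffOn (contMDiffOn_extChartAt_symm p))

/-- The derivative of the inverse of the chart at `p`, at the image of `q`. -/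
def chartDeriv (p q : M) : E2 →L[ℝ] E2 :=
  mfderivWithin 𝓘(ℝ, E2) (𝓡 2) (extChartAt (𝓡 2) p).symm (Set.range (𝓡 2))
    (extChartAt (𝓡 2) p q)

/-- Change of basis between the coordinate fields of the chart at `p` and the preferred basis
at `q`. -/
def jacobian (p q : M) : Matrix (Fin 2) (Fin 2) ℝ :=
  Matrix.of fun i j => chartDeriv p q (basisVec j) i

/-- The derivative of `F` at `q`, with the tangent space at `q` identified with the plane. -/
def derivAt (F : M → G) (q : M) : E2 →L[ℝ] G := mfderiv (𝓡 2) 𝓘(ℝ, G) F q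

/-- The derivative of `F` at `q` along the `i`-th preferred basis vector. -/
def partialAt (F : M → G) (q : M) (i : Fin 2) : G := derivAt F q (basisVec i)

omit [IsManifold (𝓡 2) ∞ M] in
lemma chartDeriv_basisVec (p q : M) (j : Fin 2) :
    chartDeriv p q (basisVec j) = ∑ i, jacobian p q i j • basisVec i :=
  sum_basisVec _

/-- The chain rule: partial derivatives in the chart at `p` are combinations, with coefficients in
the Jacobian matrix, of the derivatives along the preferred basis at `q`. -/
lemma pd_inChart {F : M → G} {p q : M} (hq : q ∈ (extChartAt (𝓡 2) p).source)
    (hF : MDifferentiableAt (𝓡 2) 𝓘(ℝ, G) F q) (j : Fin 2) :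
    pd j (inChart p F) (extChartAt (𝓡 2) p q) = ∑ i, jacobian p q i j • partialAt F q i := by
  have : IsManifold (𝓡 2) 1 M := .of_le (n := ∞) (by simp)
  have hxt := (extChartAt (𝓡 2) p).map_source hq
  have hleft := (extChartAt (𝓡 2) p).left_inv hq
  have hs := mdifferentiableWithinAt_extChartAt_symm (I := 𝓡 2) hxt
  have hc : mfderivWithin 𝓘(ℝ, E2) 𝓘(ℝ, G) (F ∘ (extChartAt (𝓡 2) p).symm) (Set.range (𝓡 2))
        (extChartAt (𝓡 2) p q) =
      (mfderiv (𝓡 2) 𝓘(ℝ, G) F q).comp (mfderivWithin 𝓘(ℝ, E2) (𝓡 2)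
        (extChartAt (𝓡 2) p).symm (Set.range (𝓡 2)) (extChartAt (𝓡 2) p q)) := by
    apply mfderiv_comp_mfderivWithin_of_eq hF hs _ hleft
    rw [ModelWithCorners.range_eq_univ]
    exact uniqueMDiffWithinAt_univ _
  have h1 : fderiv ℝ (inChart p F) (extChartAt (𝓡 2) p q) =
      (derivAt F q).comp (chartDeriv p q) := by
    refine Eq.trans ?_ hc
    rw [ModelWithCorners.range_eq_univ, mfderivWithin_univ, mfderiv_eq_fderiv]; rfl
  rw [pd, h1, ContinuousLinearMap.comp_apply, chartDeriv_basisVec]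
  simp only [map_sum, map_smul, partialAt]

lemma exists_equiv_eq_chartDeriv {p q : M} (hq : q ∈ (extChartAt (𝓡 2) p).source) :
    ∃ e : E2 ≃L[ℝ] E2, (e : E2 →L[ℝ] E2) = chartDeriv p q := by
  have : IsManifold (𝓡 2) 1 M := .of_le (n := ∞) (by simp)
  exact isInvertible_mfderivWithin_extChartAt_symm (I := 𝓡 2)
    ((extChartAt (𝓡 2) p).map_source hq)

lemma det_jacobian_ne_zero {p q : M} (hq : q ∈ (extChartAt (𝓡 2) p).source) :
    (jacobian p q).det ≠ 0 := by
  intro h0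
  obtain ⟨v, hv, hv0⟩ := Matrix.exists_mulVec_eq_zero_iff.2 h0
  obtain ⟨e, he⟩ := exists_equiv_eq_chartDeriv hq
  have key : chartDeriv p q (∑ j, v j • basisVec j) = 0 := by
    rw [map_sum]
    simp only [map_smul]
    ext i
    have := congrFun hv0 i
    simp only [Matrix.mulVec, dotProduct, jacobian, Matrix.of_apply, Fin.sum_univ_two] at this
    simp only [Fin.sum_univ_two, PiLp.add_apply, PiLp.smul_apply, smul_eq_mul]
    rw [mul_comm (v 0), mul_comm (v 1)]
    exact this
  rw [← he] at key
  have h3 : (∑ j, v j • basisVec j : E2) = 0 := by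
    apply e.injective
    rw [map_zero]; exact key
  apply hv
  have h5 : (WithLp.toLp 2 v : E2) = 0 := (sum_basisVec (WithLp.toLp 2 v)).trans h3
  ext i
  simpa using congrArg (fun w : E2 => w i) h5

end Charts

/-! ### Change of basis -/

section ChangeOfBasis

variable {E E' n n' : Fin 2 → R41} {J : Matrix (Fin 2) (Fin 2) ℝ}

/-- Pairings of two families, as a matrix. -/
lemma pairing_change (hE : ∀ j, E' j = ∑ i, J i j • E i) (hn : ∀ j, n' j = ∑ i, J i j • n i) :
    (Matrix.of fun i j => lorentz (E' i) (n' j)) =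
      J.transpose * (Matrix.of fun i j => lorentz (E i) (n j)) * J := by
  ext i j
  simp only [Matrix.mul_apply, Matrix.of_apply, Matrix.transpose_apply, hE, hn, Fin.sum_univ_two,
    lorentz_add_left, lorentz_add_right, lorentz_smul_left, lorentz_smul_right]
  ring

lemma gram_change (hE : ∀ j, E' j = ∑ i, J i j • E i) :
    gram E' = J.transpose * gram E * J := pairing_change hE hE

/-- The mixed tensor `g⁻¹ B` transforms by conjugation. -/
lemma gram_inv_mul_change (hJ : J.det ≠ 0) (hE : ∀ j, E' j = ∑ i, J i j • E i)
    (hn : ∀ j, n' j = ∑ i, J i j • n i) :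
    (gram E')⁻¹ * (Matrix.of fun i j => lorentz (E' i) (n' j)) =
      J⁻¹ * ((gram E)⁻¹ * (Matrix.of fun i j => lorentz (E i) (n j))) * J := by
  have hu : IsUnit J.det := isUnit_iff_ne_zero.2 hJ
  have hu' : IsUnit J.transpose.det := by rwa [Matrix.det_transpose]
  rw [gram_change hE, pairing_change hE hn, Matrix.mul_inv_rev, Matrix.mul_inv_rev]
  simp only [Matrix.mul_assoc]
  rw [Matrix.nonsing_inv_mul_cancel_left _ _ hu']

lemma raise_change (hJ : J.det ≠ 0) (hE : ∀ j, E' j = ∑ i, J i j • E i) {w w' : Fin 2 → ℝ}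
    (hw : ∀ j, w' j = ∑ i, J i j * w i) : raise E' w' = raise E w := by
  have hu : IsUnit J.det := isUnit_iff_ne_zero.2 hJ
  have hu' : IsUnit J.transpose.det := by rwa [Matrix.det_transpose]
  have hw' : w' = J.transpose.mulVec w := by
    ext j; rw [hw]; simp [Matrix.mulVec, dotProduct]
  have h1 : (gram E')⁻¹.mulVec w' = J⁻¹.mulVec ((gram E)⁻¹.mulVec w) := by
    rw [gram_change hE, Matrix.mul_inv_rev, Matrix.mul_inv_rev, hw', Matrix.mulVec_mulVec,
      Matrix.mulVec_mulVec, Matrix.mul_assoc, Matrix.mul_assoc, Matrix.nonsing_inv_mul _ hu',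
      Matrix.mul_one]
  have h2 : (gram E)⁻¹.mulVec w = J.mulVec (J⁻¹.mulVec ((gram E)⁻¹.mulVec w)) := by
    rw [Matrix.mulVec_mulVec _ J, Matrix.mul_nonsing_inv _ hu, Matrix.one_mulVec]
  rw [raise, raise, h1]
  conv_rhs => rw [h2]
  generalize J⁻¹.mulVec ((gram E)⁻¹.mulVec w) = u
  simp only [hE, Matrix.mulVec, dotProduct, Fin.sum_univ_two]
  module

lemma trace_conj (hJ : J.det ≠ 0) (A : Matrix (Fin 2) (Fin 2) ℝ) :
    (J⁻¹ * A * J).trace = A.trace := by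
  rw [Matrix.trace_mul_comm, ← Matrix.mul_assoc,
    Matrix.mul_nonsing_inv _ (isUnit_iff_ne_zero.2 hJ), Matrix.one_mul]

lemma det_conj (hJ : J.det ≠ 0) (A : Matrix (Fin 2) (Fin 2) ℝ) :
    (J⁻¹ * A * J).det = A.det := by
  rw [Matrix.det_mul_comm, ← Matrix.mul_assoc,
    Matrix.mul_nonsing_inv _ (isUnit_iff_ne_zero.2 hJ), Matrix.one_mul]

end ChangeOfBasis

/-! ### Geometry of a surface in a chart -/

/-- Gradient in coordinates. -/
def coordGrad (Ψ : E2 → R41) (f : E2 → ℝ) (x : E2) : R41 :=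
  raise (coordField Ψ x) fun i => pd i f x

/-- Matrix of the shape operator in coordinates. -/
def coordShape (Ψ ν : E2 → R41) (x : E2) : Matrix (Fin 2) (Fin 2) ℝ :=
  (gram (coordField Ψ x))⁻¹ * Matrix.of fun i j => sff Ψ ν i j x

/-- Matrix of the covariant Hessian in coordinates. -/
def coordHessian (Ψ : E2 → R41) (f : E2 → ℝ) (x : E2) : Matrix (Fin 2) (Fin 2) ℝ :=
  (gram (coordField Ψ x))⁻¹ *
    Matrix.of fun i j => lorentz (pd i Ψ x) (pd j (coordGrad Ψ f) x)

section

variable {Ψ ν : E2 → R41} {x : E2}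

lemma coordGrad_eq (Ψ : E2 → R41) (f : E2 → ℝ) (x : E2) : coordGrad Ψ f x =
    ((fff Ψ 1 1 x * pd 0 f x - fff Ψ 0 1 x * pd 1 f x) / gdet Ψ x) • pd 0 Ψ x
      + ((fff Ψ 0 0 x * pd 1 f x - fff Ψ 0 1 x * pd 0 f x) / gdet Ψ x) • pd 1 Ψ x := by
  rw [coordGrad, raise_eq, IsParamSurface.det_gram_coordField]
  rfl

lemma gram_coordField_inv (Ψ : E2 → R41) (x : E2) : (gram (coordField Ψ x))⁻¹ =
    (gdet Ψ x)⁻¹ • !![fff Ψ 1 1 x, -fff Ψ 0 1 x; -fff Ψ 0 1 x, fff Ψ 0 0 x] := by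
  rw [gram_inv, IsParamSurface.det_gram_coordField]; rfl

namespace IsParamSurface

variable {U : Set E2} {ε : ℝ}

lemma smooth_coordGrad (S : IsParamSurface U Ψ ν ε) {f : E2 → ℝ} (hf : Smooth U f) :
    Smooth U (coordGrad Ψ f) := by
  have h0 := hf.pd S.isOpen 0
  have h1 := hf.pd S.isOpen 1
  rw [funext (coordGrad_eq Ψ f)]
  exact ((((S.smooth_fff 1 1).mul h0).sub ((S.smooth_fff 0 1).mul h1)).div S.smooth_gdet
    fun _ hy => S.gdet_ne hy).smul (S.smooth_pd 0) |>.add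
    (((((S.smooth_fff 0 0).mul h1).sub ((S.smooth_fff 0 1).mul h0)).div S.smooth_gdet
      fun _ hy => S.gdet_ne hy).smul (S.smooth_pd 1))

lemma trace_coordShape (S : IsParamSurface U Ψ ν ε) (hx : x ∈ U) :
    (coordShape Ψ ν x).trace = trS Ψ ν x := by
  rw [coordShape, gram_coordField_inv, Matrix.trace_fin_two, trS]
  simp [Matrix.mul_apply, Fin.sum_univ_two, S.sff_comm hx 1 0]
  ring

lemma det_coordShape (S : IsParamSurface U Ψ ν ε) (hx : x ∈ U) :
    (coordShape Ψ ν x).det = detS Ψ ν x := by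
  have hW := S.gdet_ne hx
  have hWd : gdet Ψ x = fff Ψ 0 0 x * fff Ψ 1 1 x - fff Ψ 0 1 x ^ 2 := rfl
  rw [coordShape, gram_coordField_inv, Matrix.det_mul, detS]
  simp [Matrix.det_fin_two, S.sff_comm hx 1 0]
  field_simp
  rw [hWd]
  ring

lemma lorentz_pd_coordGrad (S : IsParamSurface U Ψ ν ε) (hx : x ∈ U) {f : E2 → ℝ}
    (hf : Smooth U f) (i j : Fin 2) :
    lorentz (pd i Ψ x) (pd j (coordGrad Ψ f) x) = covHess Ψ i j f x := by
  have hU := S.isOpen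
  have h1 : ∀ y ∈ U, lorentz (pd i Ψ y) (coordGrad Ψ f y) = pd i f y := fun y hy => by
    have hW := S.gdet_ne hy
    have hWd : gdet Ψ y = fff Ψ 0 0 y * fff Ψ 1 1 y - fff Ψ 0 1 y ^ 2 := rfl
    rw [coordGrad_eq, lorentz_add_right, lorentz_smul_right, lorentz_smul_right,
      show lorentz (pd i Ψ y) (pd 0 Ψ y) = fff Ψ i 0 y from rfl,
      show lorentz (pd i Ψ y) (pd 1 Ψ y) = fff Ψ i 1 y from rfl]
    field_simp
    fin_cases i <;> simp only [Fin.zero_eta, Fin.mk_one, hWd, fff_comm Ψ 1 0] <;> ring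
  have h2 := pd_congr_on hU hx h1 j
  rw [pd_lorentz ((S.smooth_pd i).diffAt hU hx) ((S.smooth_coordGrad hf).diffAt hU hx),
    coordGrad_eq, lorentz_add_right, lorentz_smul_right, lorentz_smul_right, ← chr, ← chr,
    pd_comm hf hU hx j i] at h2
  have h3 := S.chr_comm hx j i
  rw [h3, h3] at h2
  simp only [covHess, smul_eq_mul]
  linear_combination h2

/-- The coordinate expression of `tr (P₁ ∘ ∇²f)`. -/
lemma trace_newton_mul_coordHessian (S : IsParamSurface U Ψ ν ε) (hx : x ∈ U) {f : E2 → ℝ}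
    (hf : Smooth U f) :
    (((-2 * ε * (ε / 2 * (coordShape Ψ ν x).trace)) • (1 : Matrix (Fin 2) (Fin 2) ℝ)
      + coordShape Ψ ν x) * coordHessian Ψ f x).trace = coordL1 Ψ ν f x := by
  have hW := S.gdet_ne hx
  have hWd : gdet Ψ x = fff Ψ 0 0 x * fff Ψ 1 1 x - fff Ψ 0 1 x ^ 2 := rfl
  have he := (S.frame x hx).sign_sq
  have h10 : covHess Ψ 1 0 f x = covHess Ψ 0 1 f x := by
    simp only [covHess, S.chr_comm hx 1 0, pd_comm hf S.isOpen hx 1 0]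
  rw [show -2 * ε * (ε / 2 * (coordShape Ψ ν x).trace) = -trS Ψ ν x by
    rw [S.trace_coordShape hx]; linear_combination (-trS Ψ ν x) * he, coordHessian, coordShape,
    gram_coordField_inv, Matrix.trace_fin_two, coordL1, trS]
  simp only [S.lorentz_pd_coordGrad hx hf]
  rw [Matrix.eta_fin_two (Matrix.of fun i j => sff Ψ ν i j x),
    Matrix.eta_fin_two (Matrix.of fun i j => covHess Ψ i j f x), Matrix.one_fin_two]
  simp only [Matrix.of_apply, h10, S.sff_comm hx 1 0, Matrix.mul_fin_two,
    Matrix.smul_of, Matrix.smul_cons, Matrix.smul_empty, smul_eq_mul, Matrix.add_apply,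
    Matrix.mul_apply, Fin.sum_univ_two, Matrix.cons_val', Matrix.cons_val_zero,
    Matrix.cons_val_one, Matrix.cons_val_fin_one, add_mul]
  generalize gdet Ψ x = W at *
  field_simp
  rw [hWd]
  ring

end IsParamSurface

end

section Charts

variable {M : Type*} [TopologicalSpace M] [ChartedSpace E2 M] [IsManifold (𝓡 2) ∞ M]
  {ψ N : M → R41} {ε : ℝ} {p q : M}

lemma coordField_inChart {F : M → R41} (hq : q ∈ (extChartAt (𝓡 2) p).source)
    (hF : MDifferentiableAt (𝓡 2) 𝓘(ℝ, R41) F q) (j : Fin 2) :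
    coordField (inChart p F) (extChartAt (𝓡 2) p q) j = ∑ i, jacobian p q i j • partialVec F q i :=
  pd_inChart hq hF j

omit [IsManifold (𝓡 2) ∞ M] in
lemma mdifferentiableAt_of_smooth {G : Type*} [NormedAddCommGroup G] [NormedSpace ℝ G]
    {F : M → G} (hF : ContMDiff (𝓡 2) 𝓘(ℝ, G) ∞ F) : MDifferentiableAt (𝓡 2) 𝓘(ℝ, G) F q :=
  (hF q).mdifferentiableAt (by simp)

lemma mdifferentiableAt_of_chart {G : Type*} [NormedAddCommGroup G] [NormedSpace ℝ G]
    {F : M → G} {F' : E2 → G} (hF' : Smooth (chartImage p) F')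
    (h : ∀ q ∈ (extChartAt (𝓡 2) p).source, F q = F' (extChartAt (𝓡 2) p q))
    (hq : q ∈ (extChartAt (𝓡 2) p).source) : MDifferentiableAt (𝓡 2) 𝓘(ℝ, G) F q := by
  have h1 : ContMDiffAt (𝓡 2) 𝓘(ℝ, E2) ∞ (extChartAt (𝓡 2) p) q :=
    contMDiffAt_extChartAt' (by simpa using hq)
  have h2 : ContMDiffAt 𝓘(ℝ, E2) 𝓘(ℝ, G) ∞ F' (extChartAt (𝓡 2) p q) :=
    (hF'.contDiffAt ((isOpen_chartImage p).mem_nhds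
      ((extChartAt (𝓡 2) p).map_source hq))).contMDiffAt
  have h3 : ContMDiffAt (𝓡 2) 𝓘(ℝ, G) ∞ (F' ∘ extChartAt (𝓡 2) p) q := h2.comp q h1
  refine (h3.congr_of_eventuallyEq ?_).mdifferentiableAt (by simp)
  exact Filter.eventuallyEq_of_mem ((isOpen_extChartAt_source p).mem_nhds hq) h

omit [IsManifold (𝓡 2) ∞ M] in
lemma inChart_eq_of_chart {G : Type*} {F : M → G} {F' : E2 → G}
    (h : ∀ q ∈ (extChartAt (𝓡 2) p).source, F q = F' (extChartAt (𝓡 2) p q)) {x : E2}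
    (hx : x ∈ chartImage p) : inChart p F x = F' x := by
  rw [inChart, Function.comp, h _ ((extChartAt (𝓡 2) p).map_target hx),
    (extChartAt (𝓡 2) p).right_inv hx]

namespace IsOrientedSurface

/-- In each chart, the surface is a parametrized surface with unit normal field `N`. -/
lemma isParamSurface (hs : IsOrientedSurface ψ N ε) (p : M) :
    IsParamSurface (chartImage p) (inChart p ψ) (inChart p N) ε where
  isOpen := isOpen_chartImage p
  smooth := smooth_inChart hs.smooth p
  smooth_normal := smooth_inChart hs.smooth_normal p
  frame := by
    intro x hx
    set q := (extChartAt (𝓡 2) p).symm x with hqd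
    have hq : q ∈ (extChartAt (𝓡 2) p).source := (extChartAt (𝓡 2) p).map_target hx
    have hxq : extChartAt (𝓡 2) p q = x := (extChartAt (𝓡 2) p).right_inv hx
    have hE := fun j => coordField_inChart hq (mdifferentiableAt_of_smooth hs.smooth) j
    rw [hxq] at hE
    have hn : ∀ j, lorentz (N q) (coordField (inChart p ψ) x j) = 0 := fun j => by
      rw [hE]; simp [Fin.sum_univ_two, hs.normal]
    have hψE : ∀ j, lorentz (ψ q) (coordField (inChart p ψ) x j) = 0 := fun j => by
      have hd := (smooth_inChart hs.smooth p).diffAt (isOpen_chartImage p) hx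
      have h := pd_eq_zero_of_const_on (isOpen_chartImage p) hx
        (F := fun y => lorentz (inChart p ψ y) (inChart p ψ y)) (fun y _ => hs.mem_deSitter _) j
      rw [pd_lorentz hd hd, lorentz_comm (pd j _ _)] at h
      have h' : lorentz (inChart p ψ x) (pd j (inChart p ψ) x) = 0 := by linarith
      exact h'
    refine ⟨hs.sign, hs.unit_normal q, hs.mem_deSitter q, hs.normal_tangent_deSitter q, hn 0, hn 1,
      hψE 0, hψE 1, ?_⟩
    have hdet := congrArg Matrix.det (gram_change hE)
    rw [det_gram, Matrix.det_mul, Matrix.det_mul, Matrix.det_transpose] at hdet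
    change lorentz (coordField (inChart p ψ) x 0) (coordField (inChart p ψ) x 0)
      * lorentz (coordField (inChart p ψ) x 1) (coordField (inChart p ψ) x 1)
      - lorentz (coordField (inChart p ψ) x 0) (coordField (inChart p ψ) x 1) ^ 2 ≠ 0
    rw [hdet]
    exact mul_ne_zero (mul_ne_zero (det_jacobian_ne_zero hq) (hs.nondegenerate q))
      (det_jacobian_ne_zero hq)

lemma coordShape_eq (hs : IsOrientedSurface ψ N ε) (hq : q ∈ (extChartAt (𝓡 2) p).source) :
    coordShape (inChart p ψ) (inChart p N) (extChartAt (𝓡 2) p q) =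
      (jacobian p q)⁻¹ * shape ψ N q * jacobian p q := by
  have hE := fun j => coordField_inChart hq (mdifferentiableAt_of_smooth hs.smooth) j
  have hn := fun j => coordField_inChart hq (mdifferentiableAt_of_smooth hs.smooth_normal) j
  have h := gram_inv_mul_change (det_jacobian_ne_zero hq) hE (n := fun j => -partialVec N q j)
    (n' := fun j => -coordField (inChart p N) (extChartAt (𝓡 2) p q) j)
    (fun j => by rw [hn]; simp [Fin.sum_univ_two, add_comm])
  simp only [lorentz_neg_right] at h
  exact h

lemma trS_eq (hs : IsOrientedSurface ψ N ε) (hq : q ∈ (extChartAt (𝓡 2) p).source) :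
    trS (inChart p ψ) (inChart p N) (extChartAt (𝓡 2) p q) = (shape ψ N q).trace := by
  rw [← (hs.isParamSurface p).trace_coordShape ((extChartAt (𝓡 2) p).map_source hq),
    hs.coordShape_eq hq, trace_conj (det_jacobian_ne_zero hq)]

lemma detS_eq (hs : IsOrientedSurface ψ N ε) (hq : q ∈ (extChartAt (𝓡 2) p).source) :
    detS (inChart p ψ) (inChart p N) (extChartAt (𝓡 2) p q) = (shape ψ N q).det := by
  rw [← (hs.isParamSurface p).det_coordShape ((extChartAt (𝓡 2) p).map_source hq),
    hs.coordShape_eq hq, det_conj (det_jacobian_ne_zero hq)]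

lemma isUmbilicAt_iff (hs : IsOrientedSurface ψ N ε) (hq : q ∈ (extChartAt (𝓡 2) p).source) :
    IsUmbilicAt ψ N q ↔ ∃ κ : ℝ, coordShape (inChart p ψ) (inChart p N) (extChartAt (𝓡 2) p q) =
      κ • (1 : Matrix (Fin 2) (Fin 2) ℝ) := by
  have hu : IsUnit (jacobian p q).det := isUnit_iff_ne_zero.2 (det_jacobian_ne_zero hq)
  refine exists_congr fun κ => ?_
  rw [hs.coordShape_eq hq]
  constructor
  · intro h
    rw [h, Matrix.mul_smul, Matrix.mul_one, Matrix.smul_mul, Matrix.nonsing_inv_mul _ hu]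
  · intro h
    have h1 : jacobian p q * ((jacobian p q)⁻¹ * shape ψ N q * jacobian p q) * (jacobian p q)⁻¹ =
        shape ψ N q := by
      rw [Matrix.mul_assoc (jacobian p q)⁻¹, Matrix.mul_nonsing_inv_cancel_left _ _ hu,
        Matrix.mul_nonsing_inv_cancel_right _ _ hu]
    rw [← h1, h, Matrix.mul_smul, Matrix.mul_one, Matrix.smul_mul, Matrix.mul_nonsing_inv _ hu]

lemma gaussCurvature_eq (hs : IsOrientedSurface ψ N ε) (p : M) :
    gaussCurvature ψ p = 1 + ε * (shape ψ N p).det := by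
  rw [← hs.detS_eq (mem_extChartAt_source p)]
  exact (hs.isParamSurface p).gaussCurvatureParam_eq (mem_extChartAt_target p)

lemma grad_eq (hs : IsOrientedSurface ψ N ε) {f : M → ℝ} (hf : ContMDiff (𝓡 2) 𝓘(ℝ, ℝ) ∞ f)
    (hq : q ∈ (extChartAt (𝓡 2) p).source) :
    grad ψ f q = coordGrad (inChart p ψ) (inChart p f) (extChartAt (𝓡 2) p q) :=
  (raise_change (det_jacobian_ne_zero hq)
    (coordField_inChart hq (mdifferentiableAt_of_smooth hs.smooth))
    (pd_inChart hq (mdifferentiableAt_of_smooth hf))).symm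

/-- The operator `L₁`, defined pointwise with the preferred charts, is computed at all points of a
chart by its coordinate expression. -/
lemma chengYau_eq (hs : IsOrientedSurface ψ N ε) {f : M → ℝ} (hf : ContMDiff (𝓡 2) 𝓘(ℝ, ℝ) ∞ f)
    (hq : q ∈ (extChartAt (𝓡 2) p).source) :
    chengYau ψ N ε f q =
      coordL1 (inChart p ψ) (inChart p N) (inChart p f) (extChartAt (𝓡 2) p q) := by
  have S := hs.isParamSurface p
  have hx := (extChartAt (𝓡 2) p).map_source hq
  have hfs := smooth_inChart hf p
  have hgs := S.smooth_coordGrad hfs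
  have hgrad : ∀ q ∈ (extChartAt (𝓡 2) p).source, grad ψ f q =
      coordGrad (inChart p ψ) (inChart p f) (extChartAt (𝓡 2) p q) := fun q hq => hs.grad_eq hf hq
  have hJ := det_jacobian_ne_zero hq
  have hu : IsUnit (jacobian p q).det := isUnit_iff_ne_zero.2 hJ
  have hE := fun j => coordField_inChart hq (mdifferentiableAt_of_smooth hs.smooth) j
  have hV := fun j => coordField_inChart hq (mdifferentiableAt_of_chart hgs hgrad hq) j
  have hHess : coordHessian (inChart p ψ) (inChart p f) (extChartAt (𝓡 2) p q) =
      (jacobian p q)⁻¹ * hessian ψ f q * jacobian p q := by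
    refine Eq.trans ?_ (gram_inv_mul_change hJ hE hV)
    rw [coordHessian]
    congr 2
    ext i j
    have h := pd_congr_on (isOpen_chartImage p) hx
      (fun y hy => inChart_eq_of_chart hgrad hy) j
    rw [← h]
    rfl
  rw [← S.trace_newton_mul_coordHessian hx hfs, hHess, hs.coordShape_eq hq, trace_conj hJ,
    chengYau, newton, meanCurvature]
  rw [show ((-2 * ε * (ε / 2 * (shape ψ N q).trace)) • (1 : Matrix (Fin 2) (Fin 2) ℝ)
      + (jacobian p q)⁻¹ * shape ψ N q * jacobian p q) =
      (jacobian p q)⁻¹ * ((-2 * ε * (ε / 2 * (shape ψ N q).trace)) •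
        (1 : Matrix (Fin 2) (Fin 2) ℝ) + shape ψ N q) * jacobian p q by
    rw [Matrix.mul_add, Matrix.add_mul, Matrix.mul_smul, Matrix.mul_one, Matrix.smul_mul,
      Matrix.nonsing_inv_mul _ hu]]
  generalize (-2 * ε * (ε / 2 * (shape ψ N q).trace)) • (1 : Matrix (Fin 2) (Fin 2) ℝ)
    + shape ψ N q = A
  rw [show (jacobian p q)⁻¹ * A * jacobian p q * ((jacobian p q)⁻¹ * hessian ψ f q * jacobian p q) =
      (jacobian p q)⁻¹ * (A * hessian ψ f q) * jacobian p q by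
    simp only [Matrix.mul_assoc]
    rw [Matrix.mul_nonsing_inv_cancel_left _ _ hu], trace_conj hJ]

end IsOrientedSurface

end Charts

/-! ### Constancy on a connected surface -/

section Constancy

variable {M : Type*} [TopologicalSpace M] [ConnectedSpace M] [ChartedSpace E2 M]
  {G : Type*} [NormedAddCommGroup G] [NormedSpace ℝ G]

lemma eq_zero_of_basisVec {L : E2 →L[ℝ] G} (h : ∀ k, L (basisVec k) = 0) : L = 0 := by
  ext v
  rw [sum_basisVec v, map_sum]
  simp [h]

/-- A function whose partial derivatives vanish in all charts is constant on a connected surface. -/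
lemma exists_eq_const_of_pd {f : M → G} {F : M → E2 → G}
    (hF : ∀ p, ∀ x ∈ chartImage p, DifferentiableAt ℝ (F p) x)
    (h : ∀ p, ∀ q ∈ (extChartAt (𝓡 2) p).source, f q = F p (extChartAt (𝓡 2) p q))
    (h0 : ∀ p, ∀ x ∈ chartImage p, ∀ k, pd k (F p) x = 0) : ∃ c, ∀ q, f q = c := by
  have hloc : IsLocallyConstant f := by
    rw [IsLocallyConstant.iff_eventually_eq]
    intro p
    obtain ⟨r, hr, hball⟩ := Metric.isOpen_iff.1 (isOpen_chartImage p) _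
      (mem_extChartAt_target (I := 𝓡 2) p)
    have hc : ∀ x ∈ Metric.ball (extChartAt (𝓡 2) p p) r, F p x = F p (extChartAt (𝓡 2) p p) :=
      fun x hx => Metric.isOpen_ball.is_const_of_fderiv_eq_zero
        (convex_ball _ _).isPreconnected
        (fun y hy => (hF p y (hball hy)).differentiableWithinAt)
        (fun y hy => eq_zero_of_basisVec (h0 p y (hball hy))) hx (Metric.mem_ball_self hr)
    have hcont := (continuousAt_extChartAt (I := 𝓡 2) p).preimage_mem_nhds
      (Metric.ball_mem_nhds _ hr)
    filter_upwards [hcont, (isOpen_extChartAt_source (I := 𝓡 2) p).mem_nhds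
      (mem_extChartAt_source p)] with q hq hqs
    rw [h p q hqs, h p p (mem_extChartAt_source p), hc _ hq]
  obtain ⟨p₀⟩ := (inferInstance : Nonempty M)
  exact ⟨f p₀, fun q => hloc.apply_eq_of_preconnectedSpace q p₀⟩

/-- A function whose differential vanishes wherever a fixed non-zero polynomial of it does not
is constant: a primitive of the polynomial is constant along it. -/
lemma exists_eq_const_of_polynomial {f : M → ℝ} {F : M → E2 → ℝ}
    (hF : ∀ p, Smooth (chartImage p) (F p))
    (h : ∀ p, ∀ q ∈ (extChartAt (𝓡 2) p).source, f q = F p (extChartAt (𝓡 2) p q))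
    {P : Polynomial ℝ} (hP : P ≠ 0)
    (h0 : ∀ p, ∀ x ∈ chartImage p, ∀ k, P.eval (F p x) * pd k (F p) x = 0) :
    ∃ c, ∀ q, f q = c := by
  set Q : ℝ → ℝ := fun t => ∫ s in (0 : ℝ)..t, P.eval s with hQ
  have hQd : ∀ t, HasDerivAt Q (P.eval t) t := fun t =>
    (P.continuous.integral_hasStrictDerivAt 0 t).hasDerivAt
  have hFd : ∀ p, ∀ x ∈ chartImage p, DifferentiableAt ℝ (F p) x := fun p x hx =>
    (hF p).diffAt (isOpen_chartImage p) hx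
  have hcomp : ∀ p, ∀ x ∈ chartImage p, HasFDerivAt (fun y => Q (F p y))
      (P.eval (F p x) • fderiv ℝ (F p) x) x := fun p x hx =>
    (hQd _).comp_hasFDerivAt x (hFd p x hx).hasFDerivAt
  obtain ⟨c, hc⟩ := exists_eq_const_of_pd (f := fun q => Q (f q)) (F := fun p x => Q (F p x))
    (fun p x hx => (hcomp p x hx).differentiableAt) (fun p q hq => by rw [h p q hq])
    (fun p x hx k => by
      rw [pd, (hcomp p x hx).fderiv]
      exact h0 p x hx k)
  have hcont : Continuous f := by
    rw [continuous_iff_continuousAt]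
    intro p
    have h1 : ContinuousAt (fun q => F p (extChartAt (𝓡 2) p q)) p :=
      ContinuousAt.comp (f := extChartAt (𝓡 2) p)
        (hFd p _ (mem_extChartAt_target (I := 𝓡 2) p)).continuousAt (continuousAt_extChartAt p)
    refine h1.congr ?_
    filter_upwards [(isOpen_extChartAt_source (I := 𝓡 2) p).mem_nhds
      (mem_extChartAt_source p)] with q hq
    rw [h p q hq]
  have key : ∀ p q, ¬ f p < f q := by
    intro p q hpq
    have hsub : Set.Icc (f p) (f q) ⊆ Set.range f :=
      (isPreconnected_range hcont).Icc_subset ⟨p, rfl⟩ ⟨q, rfl⟩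
    have hroots : Set.Ioo (f p) (f q) ⊆ {t | P.IsRoot t} := by
      intro t ht
      have h1 : Q =ᶠ[nhds t] fun _ => c := by
        filter_upwards [Ioo_mem_nhds ht.1 ht.2] with s hs
        obtain ⟨r, hr⟩ := hsub (Set.Ioo_subset_Icc_self hs)
        rw [← hr, hc r]
      exact (hQd t).unique ((hasDerivAt_const t c).congr_of_eventuallyEq h1)
    exact (Set.Ioo_infinite hpq).mono hroots (Polynomial.finite_setOfPred_isRoot hP)
  obtain ⟨p₀⟩ := (inferInstance : Nonempty M)
  exact ⟨f p₀, fun q => le_antisymm (not_lt.1 (key p₀ q)) (not_lt.1 (key q p₀))⟩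

end Constancy

lemma quadratic_ne_zero {a b c : ℝ} (ha : a ≠ 0) :
    (Polynomial.C a * Polynomial.X ^ 2 + Polynomial.C b * Polynomial.X + Polynomial.C c) ≠ 0 := by
  intro h
  have := Polynomial.leadingCoeff_quadratic (b := b) (c := c) ha
  rw [h, Polynomial.leadingCoeff_zero] at this
  exact ha this.symm

/-! ### Surfaces of 2-type with one constant curvature function are isoparametric -/

section Isoparametric

variable {M : Type*} [TopologicalSpace M] [ChartedSpace E2 M] [IsManifold (𝓡 2) ∞ M]
  {ψ N ψ₁ ψ₂ : M → R41} {ε μ₁ μ₂ : ℝ} {a : R41} {p q : M}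

lemma IsVectorEigenfunction.coordL1_eq (hs : IsOrientedSurface ψ N ε)
    (h : IsVectorEigenfunction ψ N ε ψ₁ μ₁) (hq : q ∈ (extChartAt (𝓡 2) p).source) :
    coordL1 (inChart p ψ) (inChart p N) (inChart p ψ₁) (extChartAt (𝓡 2) p q) = μ₁ • ψ₁ q := by
  ext k
  rw [← coordL1_apply (isOpen_chartImage p) ((extChartAt (𝓡 2) p).map_source hq)
    (smooth_inChart h.smooth p)]
  have hk : ContMDiff (𝓡 2) 𝓘(ℝ, ℝ) ∞ fun q => ψ₁ q k :=
    ((ContinuousLinearMap.proj (R := ℝ) (φ := fun _ : Fin 4 => ℝ) k).contDiff.contMDiff).comp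
      h.smooth
  exact (hs.chengYau_eq hk hq).symm.trans (h.eigen k q)

lemma isCoordTwoType (hs : IsOrientedSurface ψ N ε) (h₁ : IsVectorEigenfunction ψ N ε ψ₁ μ₁)
    (h₂ : IsVectorEigenfunction ψ N ε ψ₂ μ₂) (h : ∀ q, ψ q = a + ψ₁ q + ψ₂ q) (p : M) :
    IsCoordTwoType (chartImage p) (inChart p ψ) (inChart p N) (inChart p ψ₁) (inChart p ψ₂)
      a μ₁ μ₂ where
  smooth₁ := smooth_inChart h₁.smooth p
  smooth₂ := smooth_inChart h₂.smooth p
  decomp _ _ := h _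
  eigen₁ x hx := by
    have := h₁.coordL1_eq hs ((extChartAt (𝓡 2) p).map_target hx)
    rwa [(extChartAt (𝓡 2) p).right_inv hx] at this
  eigen₂ x hx := by
    have := h₂.coordL1_eq hs ((extChartAt (𝓡 2) p).map_target hx)
    rwa [(extChartAt (𝓡 2) p).right_inv hx] at this

omit [IsManifold (𝓡 2) ∞ M] in
lemma IsPrincipalCurvatureAt.charpoly_eq {c : ℝ} (h : IsPrincipalCurvatureAt ψ N p c) :
    (shape ψ N p).det = c * ((shape ψ N p).trace - c) := by
  obtain ⟨X, hX, h⟩ := h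
  have hdet : (shape ψ N p - c • 1).det = 0 := by
    apply Matrix.exists_mulVec_eq_zero_iff.1
    refine ⟨X, hX, ?_⟩
    rw [Matrix.sub_mulVec, h, Matrix.smul_mulVec, Matrix.one_mulVec, sub_self]
  rw [Matrix.det_fin_two] at hdet ⊢
  rw [Matrix.trace_fin_two]
  simp only [Matrix.sub_apply, Matrix.smul_apply, Matrix.one_apply_eq, smul_eq_mul, mul_one, ne_eq,
    zero_ne_one, not_false_eq_true, Matrix.one_apply_ne, mul_zero, sub_zero, one_ne_zero] at hdet
  linear_combination hdet

namespace IsOrientedSurface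

variable (hs : IsOrientedSurface ψ N ε)
include hs

lemma trS_inChart {x : E2} (hx : x ∈ chartImage p) : trS (inChart p ψ) (inChart p N) x =
    (shape ψ N ((extChartAt (𝓡 2) p).symm x)).trace := by
  have := hs.trS_eq ((extChartAt (𝓡 2) p).map_target hx)
  rwa [(extChartAt (𝓡 2) p).right_inv hx] at this

lemma detS_inChart {x : E2} (hx : x ∈ chartImage p) : detS (inChart p ψ) (inChart p N) x =
    (shape ψ N ((extChartAt (𝓡 2) p).symm x)).det := by
  have := hs.detS_eq ((extChartAt (𝓡 2) p).map_target hx)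
  rwa [(extChartAt (𝓡 2) p).right_inv hx] at this

variable [ConnectedSpace M]

lemma exists_trace_const_of_polynomial {P : Polynomial ℝ} (hP : P ≠ 0)
    (h0 : ∀ p, ∀ x ∈ chartImage p, ∀ k, P.eval (trS (inChart p ψ) (inChart p N) x) *
      pd k (trS (inChart p ψ) (inChart p N)) x = 0) : ∃ c, ∀ p, (shape ψ N p).trace = c :=
  exists_eq_const_of_polynomial (F := fun p => trS (inChart p ψ) (inChart p N))
    (fun p => (hs.isParamSurface p).smooth_trS) (fun _ _ hq => (hs.trS_eq hq).symm) hP h0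

variable (h₁ : IsVectorEigenfunction ψ N ε ψ₁ μ₁)
  (h₂ : IsVectorEigenfunction ψ N ε ψ₂ μ₂) (h : ∀ q, ψ q = a + ψ₁ q + ψ₂ q)
include h₁ h₂ h

/-- Constant mean curvature forces `det S` to be constant. -/
lemma exists_det_const {c : ℝ} (hc : ∀ p, (shape ψ N p).trace = c) :
    ∃ d, ∀ p, (shape ψ N p).det = d :=
  exists_eq_const_of_polynomial (F := fun p => detS (inChart p ψ) (inChart p N))
    (fun p => (hs.isParamSurface p).smooth_detS) (fun _ _ hq => (hs.detS_eq hq).symm)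
    Polynomial.X_ne_zero fun p x hx k => by
      rw [Polynomial.eval_X]
      exact (isCoordTwoType hs h₁ h₂ h p).detS_mul_pd_detS_eq_zero (hs.isParamSurface p)
        (fun y hy => (hs.trS_inChart hy).trans (hc _)) hx k

/-- Constant `det S`, that is constant Gaussian curvature, forces `tr S` to be constant. -/
lemma exists_trace_const {d : ℝ} (hd : ∀ p, (shape ψ N p).det = d) :
    ∃ c, ∀ p, (shape ψ N p).trace = c := by
  have T := isCoordTwoType hs h₁ h₂ h
  have S := hs.isParamSurface
  have hd' : ∀ p, ∀ y ∈ chartImage p, detS (inChart p ψ) (inChart p N) y = d :=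
    fun p y hy => (hs.detS_inChart hy).trans (hd _)
  have hε : ε * ε = 1 := by rcases hs.sign with h | h <;> rw [h] <;> norm_num
  by_cases hd0 : d * (d + 2 * ε) = 0
  · rcases mul_eq_zero.1 hd0 with h0 | h0
    · refine hs.exists_trace_const_of_polynomial
        (quadratic_ne_zero (a := 12) (b := -8 * (μ₁ + μ₂)) (c := (μ₁ + μ₂) ^ 2) (by norm_num))
        fun p x hx k => ?_
      rw [← (T p).quadratic_mul_pd_trS_eq_zero_of_detS_const (S p) (hd' p) hx k, h0]
      simp only [Polynomial.eval_add, Polynomial.eval_mul, Polynomial.eval_C, Polynomial.eval_pow,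
        Polynomial.eval_X]
      ring
    · have h0' : d = -2 * ε := by linarith
      refine hs.exists_trace_const_of_polynomial
        (quadratic_ne_zero (a := -4) (b := 0) (c := 9 * (μ₁ + μ₂) ^ 2 - 32 * ε) (by norm_num))
        fun p x hx k => ?_
      have hq := (T p).quadratic_mul_pd_trS_eq_zero_of_detS_const (S p) (hd' p) hx k
      rw [h0', show 6 - 2 * (-2 * ε) ^ 2 - 2 * ε * (-2 * ε) = 2 by linear_combination (-4) * hε,
        show ε * (-2 * ε) = -2 by linear_combination (-2) * hε] at hq
      simp only [Polynomial.eval_add, Polynomial.eval_mul, Polynomial.eval_C, Polynomial.eval_pow,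
        Polynomial.eval_X]
      linear_combination hq
  · refine hs.exists_trace_const_of_polynomial one_ne_zero fun p x hx k => ?_
    rw [Polynomial.eval_one, one_mul]
    exact (mul_eq_zero.1
      ((T p).mul_pd_trS_eq_zero_of_detS_const (S p) (hd' p) hx k)).resolve_left hd0

/-- A constant non-zero principal curvature forces `tr S` to be constant. -/
lemma exists_trace_const_of_principal {c : ℝ} (hc : c ≠ 0)
    (hp : ∀ p, IsPrincipalCurvatureAt ψ N p c) : ∃ h, ∀ p, (shape ψ N p).trace = h := by
  have T := isCoordTwoType hs h₁ h₂ h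
  have S := hs.isParamSurface
  have hd' : ∀ p, ∀ y ∈ chartImage p, detS (inChart p ψ) (inChart p N) y =
      c * (trS (inChart p ψ) (inChart p N) y - c) := fun p y hy => by
    rw [hs.detS_inChart hy, hs.trS_inChart hy]
    exact (hp _).charpoly_eq
  have hcc : c ^ 2 ≠ 0 := pow_ne_zero 2 hc
  have hcomp : ∀ a₂ a₁ a₀ : ℝ, a₂ ≠ 0 → ((Polynomial.C a₂ * Polynomial.X ^ 2 +
      Polynomial.C (-2 * a₂ * c + a₁) * Polynomial.X + Polynomial.C (a₂ * c ^ 2 - a₁ * c + a₀))) ≠ 0 :=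
    fun a₂ a₁ a₀ h => quadratic_ne_zero h
  refine hs.exists_trace_const_of_polynomial (mul_ne_zero
    (hcomp (6 * c ^ 2) (-(18 * c ^ 3 + 2 * ε * c)) (-2 * ε * c ^ 2) (by positivity))
    (hcomp (12 * c ^ 2) (-24 * c ^ 3 + 2 * ε * c) (-6 * ε * c ^ 2) (by positivity)))
    fun p x hx k => ?_
  rw [← (T p).quartic_mul_pd_trS_eq_zero (S p) (hd' p) hx k]
  simp only [Polynomial.eval_add, Polynomial.eval_mul, Polynomial.eval_C, Polynomial.eval_pow,
    Polynomial.eval_X]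
  ring

/-- A surface of `L₁`-2-type with constant mean curvature, constant Gaussian curvature or a
constant principal curvature is isoparametric. -/
lemma isoparametric (hc : (∃ c, ∀ p, meanCurvature ψ N ε p = c) ∨
      (∃ c, ∀ p, gaussCurvature ψ p = c) ∨ ∃ κ, ∀ p, IsPrincipalCurvatureAt ψ N p κ) :
    ∃ c d, (∀ p, (shape ψ N p).trace = c) ∧ ∀ p, (shape ψ N p).det = d := by
  have hε : ε * ε = 1 := by rcases hs.sign with h | h <;> rw [h] <;> norm_num
  have htr : ∀ c, (∀ p, (shape ψ N p).trace = c) →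
      ∃ c d, (∀ p, (shape ψ N p).trace = c) ∧ ∀ p, (shape ψ N p).det = d := fun c hc => by
    obtain ⟨d, hd⟩ := hs.exists_det_const h₁ h₂ h hc
    exact ⟨c, d, hc, hd⟩
  have hdet : ∀ d, (∀ p, (shape ψ N p).det = d) →
      ∃ c d, (∀ p, (shape ψ N p).trace = c) ∧ ∀ p, (shape ψ N p).det = d := fun d hd => by
    obtain ⟨c, hc⟩ := hs.exists_trace_const h₁ h₂ h hd
    exact ⟨c, d, hc, hd⟩
  rcases hc with ⟨c, hc⟩ | ⟨c, hc⟩ | ⟨c, hc⟩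
  · refine htr (2 * ε * c) fun p => ?_
    rw [← hc p, meanCurvature]
    linear_combination (-(shape ψ N p).trace) * hε
  · refine hdet (ε * (c - 1)) fun p => ?_
    rw [← hc p, hs.gaussCurvature_eq]
    linear_combination (-(shape ψ N p).det) * hε
  · by_cases h0 : c = 0
    · refine hdet 0 fun p => ?_
      rw [(hc p).charpoly_eq, h0, zero_mul]
    · obtain ⟨t, ht⟩ := hs.exists_trace_const_of_principal h₁ h₂ h h0 hc
      exact htr t ht

omit [ConnectedSpace M] in
/-- On a surface of `L₁`-2-type, `L₁ψ` is not an affine function of `ψ`. -/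
lemma not_affine (hμ : μ₁ ≠ μ₂) {c d α : ℝ} {β : R41} (hc : ∀ p, (shape ψ N p).trace = c)
    (hd : ∀ p, (shape ψ N p).det = d)
    (hαβ : ∀ q, (-2 * ε * d) • N q + c • ψ q = α • ψ q + β) : False := by
  have h1 : ∀ p, ∀ y ∈ chartImage p, coordL1 (inChart p ψ) (inChart p N) (inChart p ψ) y =
      α • inChart p ψ y + β := fun p y hy => by
    rw [(hs.isParamSurface p).coordL1_position hy, hs.trS_inChart hy, hs.detS_inChart hy, hc, hd]
    exact hαβ _
  have key := fun q => (isCoordTwoType hs h₁ h₂ h q).affine_relations (h1 q)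
    (isOpen_chartImage q) (mem_extChartAt_target (I := 𝓡 2) q)
  simp only [inChart_extChartAt (mem_extChartAt_source _)] at key
  have hne : μ₁ - μ₂ ≠ 0 := sub_ne_zero.2 hμ
  by_cases hα : μ₁ = α
  · refine h₂.nonconstant ⟨(μ₂ - α)⁻¹ • (α • a + β), fun q => ?_⟩
    have hα' : μ₂ - α ≠ 0 := fun h0 => hne (by linarith)
    rw [← (key q).1, hα, sub_self, zero_smul, zero_add, inv_smul_smul₀ hα']
  · have hα' : μ₁ - α ≠ 0 := sub_ne_zero.2 hα
    refine h₁.nonconstant ⟨((μ₁ - α) * (μ₁ - μ₂))⁻¹ • (-μ₂) • (α • a + β), fun q => ?_⟩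
    rw [eq_inv_smul_iff₀ (mul_ne_zero hα' hne), ← (key q).1]
    linear_combination (norm := module) (key q).2

end IsOrientedSurface

end Isoparametric

/-! ### Umbilical points -/

namespace IsParamSurface

variable {U : Set E2} {Ψ ν : E2 → R41} {ε : ℝ} {x : E2}

lemma coordShape_eq_smul_iff (S : IsParamSurface U Ψ ν ε) (hx : x ∈ U) (κ : ℝ) :
    coordShape Ψ ν x = κ • (1 : Matrix (Fin 2) (Fin 2) ℝ) ↔
      ∀ i j, sff Ψ ν i j x = κ * fff Ψ i j x := by
  have hu : IsUnit (gram (coordField Ψ x)).det := by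
    rw [det_gram_coordField]; exact isUnit_iff_ne_zero.2 (S.gdet_ne hx)
  rw [coordShape]
  constructor
  · intro h i j
    have h1 := congrArg (fun A => (gram (coordField Ψ x) * A) i j) h
    simp only [Matrix.mul_nonsing_inv_cancel_left _ _ hu, Matrix.of_apply, Matrix.mul_smul,
      Matrix.mul_one, Matrix.smul_apply, smul_eq_mul] at h1
    exact h1
  · intro h
    have h1 : (Matrix.of fun i j => sff Ψ ν i j x) = κ • gram (coordField Ψ x) := by
      ext i j
      exact h i j
    rw [h1, Matrix.mul_smul, Matrix.nonsing_inv_mul _ hu]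

/-- The discriminant of the characteristic polynomial of the shape operator, as a sum of squares
when the metric is definite. -/
lemma sq_mul_discr (S : IsParamSurface U Ψ ν ε) (hx : x ∈ U) :
    (trS Ψ ν x ^ 2 - 4 * detS Ψ ν x) * (fff Ψ 0 0 x * gdet Ψ x) ^ 2 =
      (fff Ψ 0 0 x * (fff Ψ 0 0 x * sff Ψ ν 1 1 x - fff Ψ 1 1 x * sff Ψ ν 0 0 x)
        - 2 * fff Ψ 0 1 x * (fff Ψ 0 0 x * sff Ψ ν 0 1 x - fff Ψ 0 1 x * sff Ψ ν 0 0 x)) ^ 2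
      + 4 * gdet Ψ x * (fff Ψ 0 0 x * sff Ψ ν 0 1 x - fff Ψ 0 1 x * sff Ψ ν 0 0 x) ^ 2 := by
  have h := S.discr_mul_gdet_sq hx
  have hWd : gdet Ψ x = fff Ψ 0 0 x * fff Ψ 1 1 x - fff Ψ 0 1 x ^ 2 := rfl
  rw [mul_pow, mul_comm (fff Ψ 0 0 x ^ 2), ← mul_assoc, h, hWd]
  ring

lemma gdet_pos (S : IsParamSurface U Ψ ν ε) (hx : x ∈ U) (hε : ε = -1) : 0 < gdet Ψ x := by
  have h : gdet Ψ x * ε < 0 := (S.frame x hx).det_mul_sign_neg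
  rw [hε] at h
  linarith

lemma fff_ne_zero (hW : 0 < gdet Ψ x) : fff Ψ 0 0 x ≠ 0 := by
  intro h0
  rw [gdet, h0] at hW
  nlinarith [sq_nonneg (fff Ψ 0 1 x)]

lemma discr_nonneg (S : IsParamSurface U Ψ ν ε) (hx : x ∈ U) (hε : ε = -1) :
    0 ≤ trS Ψ ν x ^ 2 - 4 * detS Ψ ν x := by
  have hW := S.gdet_pos hx hε
  have h0 : 0 < (fff Ψ 0 0 x * gdet Ψ x) ^ 2 :=
    sq_pos_of_ne_zero (mul_ne_zero (fff_ne_zero hW) hW.ne')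
  refine nonneg_of_mul_nonneg_left ?_ h0
  rw [S.sq_mul_discr hx]
  positivity

/-- For a definite metric the shape operator is diagonalizable, so that a double principal curvature
makes it a multiple of the identity. -/
lemma sff_eq_of_discr_eq_zero (S : IsParamSurface U Ψ ν ε) (hx : x ∈ U) (hε : ε = -1)
    (h : trS Ψ ν x ^ 2 - 4 * detS Ψ ν x = 0) :
    ∃ κ, ∀ i j, sff Ψ ν i j x = κ * fff Ψ i j x := by
  have hW := S.gdet_pos hx hε
  have hg := fff_ne_zero hW
  have h1 := S.sq_mul_discr hx
  rw [h, zero_mul] at h1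
  have hu2 : (fff Ψ 0 0 x * sff Ψ ν 0 1 x - fff Ψ 0 1 x * sff Ψ ν 0 0 x) ^ 2 = 0 := by
    refine le_antisymm ?_ (sq_nonneg _)
    refine le_of_mul_le_mul_left ?_ hW
    nlinarith [sq_nonneg (fff Ψ 0 0 x * (fff Ψ 0 0 x * sff Ψ ν 1 1 x - fff Ψ 1 1 x * sff Ψ ν 0 0 x)
        - 2 * fff Ψ 0 1 x * (fff Ψ 0 0 x * sff Ψ ν 0 1 x - fff Ψ 0 1 x * sff Ψ ν 0 0 x))]
  have hu := pow_eq_zero_iff (two_ne_zero) |>.1 hu2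
  rw [hu] at h1
  have hw : fff Ψ 0 0 x * sff Ψ ν 1 1 x - fff Ψ 1 1 x * sff Ψ ν 0 0 x = 0 := by
    have h2 : (fff Ψ 0 0 x * (fff Ψ 0 0 x * sff Ψ ν 1 1 x - fff Ψ 1 1 x * sff Ψ ν 0 0 x)) ^ 2 = 0 := by
      linear_combination -h1
    exact (mul_eq_zero.1 (pow_eq_zero_iff two_ne_zero |>.1 h2)).resolve_left hg
  refine ⟨sff Ψ ν 0 0 x / fff Ψ 0 0 x, fun i j => ?_⟩
  rw [div_mul_eq_mul_div, eq_div_iff hg]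
  fin_cases i <;> fin_cases j <;>
    simp only [Fin.zero_eta, Fin.mk_one, S.sff_comm hx 1 0, fff_comm Ψ 1 0]
  · linear_combination hu
  · linear_combination hu
  · linear_combination hw

lemma pd_normal_add_smul_eq_zero (S : IsParamSurface U Ψ ν ε) (hx : x ∈ U) {κ : ℝ}
    (h : ∀ i j, sff Ψ ν i j x = κ * fff Ψ i j x) (j : Fin 2) :
    pd j (fun y => ν y + κ • Ψ y) x = 0 := by
  have hd := S.smooth.diffAt S.isOpen hx
  rw [pd_add (F' := fun y => κ • Ψ y) (S.smooth_normal.diffAt S.isOpen hx) (hd.const_smul κ),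
    pd_const_smul hd]
  have key : ∀ i, lorentz (pd j ν x + κ • pd j Ψ x) (pd i Ψ x) = 0 := fun i => by
    have h1 := h i j
    rw [sff, fff] at h1
    rw [lorentz_add_left, lorentz_smul_left, lorentz_comm, lorentz_comm (pd j Ψ x)]
    linarith
  refine (S.frame x hx).eq_zero (key 0) (key 1) ?_ ?_
  · rw [lorentz_comm, lorentz_add_right, lorentz_smul_right, S.normal_pd_normal hx, S.normal_pd hx]
    ring
  · rw [lorentz_comm, lorentz_add_right, lorentz_smul_right, S.position_pd_normal hx,
      S.position_pd hx]
    ring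

end IsParamSurface

namespace IsOrientedSurface

variable {M : Type*} [TopologicalSpace M] [ChartedSpace E2 M] [IsManifold (𝓡 2) ∞ M]
  {ψ N ψ₁ ψ₂ : M → R41} {ε μ₁ μ₂ : ℝ} {a : R41} {p q : M} (hs : IsOrientedSurface ψ N ε)
include hs

lemma isUmbilicAt_iff_sff (hq : q ∈ (extChartAt (𝓡 2) p).source) :
    IsUmbilicAt ψ N q ↔ ∃ κ : ℝ, ∀ i j, sff (inChart p ψ) (inChart p N) i j
      (extChartAt (𝓡 2) p q) = κ * fff (inChart p ψ) i j (extChartAt (𝓡 2) p q) := by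
  rw [hs.isUmbilicAt_iff hq]
  exact exists_congr fun κ => (hs.isParamSurface p).coordShape_eq_smul_iff
    ((extChartAt (𝓡 2) p).map_source hq) κ

lemma discr_nonneg (hε : ε = -1) (p : M) :
    0 ≤ (shape ψ N p).trace ^ 2 - 4 * (shape ψ N p).det := by
  have h := (hs.isParamSurface p).discr_nonneg (mem_extChartAt_target (I := 𝓡 2) p) hε
  rwa [hs.trS_eq (mem_extChartAt_source p), hs.detS_eq (mem_extChartAt_source p)] at h

lemma isUmbilicAt_of_discr_eq_zero (hε : ε = -1)
    (h : (shape ψ N p).trace ^ 2 - 4 * (shape ψ N p).det = 0) : IsUmbilicAt ψ N p := by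
  rw [hs.isUmbilicAt_iff_sff (mem_extChartAt_source p)]
  apply (hs.isParamSurface p).sff_eq_of_discr_eq_zero (mem_extChartAt_target p) hε
  rwa [hs.trS_eq (mem_extChartAt_source p), hs.detS_eq (mem_extChartAt_source p)]

/-- Along a totally umbilical surface with constant mean curvature, `N + κψ` is constant. -/
lemma exists_normal_add_smul_eq_const [ConnectedSpace M] {c : ℝ}
    (hc : ∀ p, (shape ψ N p).trace = c) (hu : ∀ p, IsUmbilicAt ψ N p) :
    ∃ β, ∀ q, N q + (c / 2) • ψ q = β := by
  have S := hs.isParamSurface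
  refine exists_eq_const_of_pd (F := fun p y => inChart p N y + (c / 2) • inChart p ψ y)
    (fun p x hx => ?_) (fun p q hq => ?_) fun p x hx k => ?_
  · exact ((S p).smooth_normal.diffAt (isOpen_chartImage p) hx).fun_add
      (((S p).smooth.diffAt (isOpen_chartImage p) hx).const_smul (c / 2))
  · rw [inChart_extChartAt hq, inChart_extChartAt hq]
  · apply (S p).pd_normal_add_smul_eq_zero hx
    have hq := (extChartAt (𝓡 2) p).map_target hx
    obtain ⟨κ, hκ⟩ := (hs.isUmbilicAt_iff hq).1 (hu _)
    rw [(extChartAt (𝓡 2) p).right_inv hx] at hκ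
    have h1 := (S p).trace_coordShape hx
    rw [hs.trS_inChart hx, hc, hκ, Matrix.trace_fin_two] at h1
    simp only [Matrix.smul_apply, Matrix.one_apply_eq, smul_eq_mul, mul_one] at h1
    rw [← (S p).coordShape_eq_smul_iff hx, hκ, ← h1]
    congr 1
    ring

variable [ConnectedSpace M] (h₁ : IsVectorEigenfunction ψ N ε ψ₁ μ₁)
  (h₂ : IsVectorEigenfunction ψ N ε ψ₂ μ₂) (h : ∀ q, ψ q = a + ψ₁ q + ψ₂ q) (hμ : μ₁ ≠ μ₂)
include h₁ h₂ h hμ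

/-- A totally umbilical surface has `N + κψ` constant, so `L₁ψ` would be an affine function
of `ψ`. -/
lemma not_totally_umbilic {c d : ℝ} (hc : ∀ p, (shape ψ N p).trace = c)
    (hd : ∀ p, (shape ψ N p).det = d) : ∃ p, ¬ IsUmbilicAt ψ N p := by
  by_contra! hu
  obtain ⟨β, hβ⟩ := hs.exists_normal_add_smul_eq_const hc hu
  refine hs.not_affine h₁ h₂ h hμ hc hd (α := c + 2 * ε * d * (c / 2)) (β := (-2 * ε * d) • β)
    fun q => ?_
  rw [← hβ q]
  module

omit [ConnectedSpace M] in
lemma det_const_ne_zero {c d : ℝ} (hc : ∀ p, (shape ψ N p).trace = c)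
    (hd : ∀ p, (shape ψ N p).det = d) : d ≠ 0 := by
  rintro rfl
  exact hs.not_affine h₁ h₂ h hμ hc hd (α := c) (β := 0) fun q => by simp

omit h₁ h₂ h hμ [ConnectedSpace M] in
lemma det_eq_neg_sign {c d : ℝ} (hc : ∀ p, (shape ψ N p).trace = c)
    (hd : ∀ p, (shape ψ N p).det = d) (hδ : c ^ 2 - 4 * d ≠ 0) (p : M) : d = -ε :=
  (hs.isParamSurface p).detS_eq_of_isoparametric (fun _ hy => (hs.trS_inChart hy).trans (hc _))
    (fun _ hy => (hs.detS_inChart hy).trans (hd _)) hδ (mem_extChartAt_target p)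

end IsOrientedSurface

/-! ### Unique continuation for linear systems -/

section Continuation

variable {G : Type*} [NormedAddCommGroup G] [NormedSpace ℝ G]

lemma fderiv_eq_sum_pd (Y : E2 → G) (x v : E2) : fderiv ℝ Y x v = ∑ i, v i • pd i Y x := by
  conv_lhs => rw [sum_basisVec v, map_sum]
  simp only [map_smul, pd]

/-- Grönwall's inequality along rays: a map whose derivatives are bounded by a multiple of its own
norm vanishes near each of its zeros. -/
lemma eventually_eq_zero_of_norm_pd_le {U : Set E2} (hU : IsOpen U) {Y : E2 → G}
    (hY : ∀ x ∈ U, DifferentiableAt ℝ Y x) {A : E2 → ℝ} (hA : ContinuousOn A U)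
    (hb : ∀ x ∈ U, ∀ k, ‖pd k Y x‖ ≤ A x * ‖Y x‖) {x₀ : E2} (hx₀ : x₀ ∈ U) (h0 : Y x₀ = 0) :
    ∀ᶠ x in nhds x₀, Y x = 0 := by
  have hA' : ∀ᶠ x in nhds x₀, A x < |A x₀| + 1 :=
    (hA.continuousAt (hU.mem_nhds hx₀)).eventually_lt_const (by linarith [le_abs_self (A x₀)])
  obtain ⟨r, hr, hball⟩ := Metric.eventually_nhds_iff_ball.1 (hA'.and (hU.mem_nhds hx₀))
  filter_upwards [Metric.ball_mem_nhds x₀ hr] with x hx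
  set v := x - x₀ with hv
  have hseg : ∀ t ∈ Set.Icc (0 : ℝ) 1, x₀ + t • v ∈ Metric.ball x₀ r := fun t ht => by
    rw [mem_ball_iff_norm, add_sub_cancel_left, norm_smul, Real.norm_of_nonneg ht.1]
    have : ‖v‖ < r := by rw [hv]; exact mem_ball_iff_norm.1 hx
    nlinarith [norm_nonneg v, ht.1, ht.2]
  have hderiv : ∀ t ∈ Set.Icc (0 : ℝ) 1,
      HasDerivAt (fun s : ℝ => Y (x₀ + s • v)) (fderiv ℝ Y (x₀ + t • v) v) t := fun t ht => by
    have h1 : HasDerivAt (fun s : ℝ => x₀ + s • v) v t := by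
      simpa using ((hasDerivAt_id t).smul_const v).const_add x₀
    exact (hY _ (hball _ (hseg t ht)).2).hasFDerivAt.comp_hasDerivAt t h1
  have h1 := eq_zero_of_abs_deriv_le_mul_abs_self_of_eq_zero_right
    (f := fun s : ℝ => Y (x₀ + s • v)) (K := (|v 0| + |v 1|) * (|A x₀| + 1)) (a := 0) (b := 1)
    (fun t ht => (hderiv t ht).continuousAt.continuousWithinAt)
    (fun t ht => (hderiv t (Set.Ico_subset_Icc_self ht)).hasDerivWithinAt) (by simpa using h0)
    (fun t ht => by
      have hm := hball _ (hseg t (Set.Ico_subset_Icc_self ht))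
      have hk : ∀ k, ‖pd k Y (x₀ + t • v)‖ ≤ (|A x₀| + 1) * ‖Y (x₀ + t • v)‖ := fun k =>
        (hb _ hm.2 k).trans (mul_le_mul_of_nonneg_right hm.1.le (norm_nonneg _))
      rw [fderiv_eq_sum_pd, Fin.sum_univ_two]
      refine (norm_add_le _ _).trans ?_
      rw [norm_smul, norm_smul, Real.norm_eq_abs, Real.norm_eq_abs]
      have h0 := mul_le_mul_of_nonneg_left (hk 0) (abs_nonneg (v 0))
      have h1 := mul_le_mul_of_nonneg_left (hk 1) (abs_nonneg (v 1))
      linarith) 1 (Set.right_mem_Icc.2 zero_le_one)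
  simpa [hv] using h1

variable {U : Set E2} {Ψ ν F : E2 → R41} {ε : ℝ} {x₀ : E2} {c : Fin 2 → Fin 2 → E2 → ℝ}

lemma pd_pd_eq_covHess_add (Ψ : E2 → R41) (F : E2 → G) (i j : Fin 2) (x : E2) :
    pd i (pd j F) x = covHess Ψ i j F x
      + ((fff Ψ 1 1 x * chr Ψ i j 0 x - fff Ψ 0 1 x * chr Ψ i j 1 x) / gdet Ψ x) • pd 0 F x
      + ((fff Ψ 0 0 x * chr Ψ i j 1 x - fff Ψ 0 1 x * chr Ψ i j 0 x) / gdet Ψ x) • pd 1 F x := by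
  rw [covHess]; abel

lemma pd_const_lorentz {x : E2} (hF : DifferentiableAt ℝ F x) (v : R41) (i : Fin 2) :
    pd i (fun y => lorentz v (F y)) x = lorentz v (pd i F x) := by
  rw [pd_lorentz (differentiableAt_const v) hF, pd_const, lorentz_zero_left, zero_add]

/-- The 1-jet of `⟨v, F⟩` in coordinates. -/
def jet (v : R41) (F : E2 → R41) (x : E2) : ℝ × ℝ × ℝ :=
  (lorentz v (F x), lorentz v (pd 0 F x), lorentz v (pd 1 F x))

/-- The 1-jet of `⟨v, F⟩` satisfies a linear first-order system when the covariant Hessian of `F` is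
a multiple of `F`. -/
lemma jet_eventually_eq_zero (S : IsParamSurface U Ψ ν ε) (hF : Smooth U F)
    (hc : ∀ i j, ContinuousOn (c i j) U)
    (h : ∀ i j, ∀ x ∈ U, covHess Ψ i j F x = c i j x • F x) {v : R41} (hx₀ : x₀ ∈ U)
    (h0 : jet v F x₀ = 0) : ∀ᶠ x in nhds x₀, jet v F x = 0 := by
  have hU := S.isOpen
  set γ₀ : Fin 2 → Fin 2 → E2 → ℝ := fun i j x =>
    (fff Ψ 1 1 x * chr Ψ i j 0 x - fff Ψ 0 1 x * chr Ψ i j 1 x) / gdet Ψ x with hγ₀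
  set γ₁ : Fin 2 → Fin 2 → E2 → ℝ := fun i j x =>
    (fff Ψ 0 0 x * chr Ψ i j 1 x - fff Ψ 0 1 x * chr Ψ i j 0 x) / gdet Ψ x with hγ₁
  have hγ₀c : ∀ i j, ContinuousOn (γ₀ i j) U := fun i j =>
    (((S.smooth_fff 1 1).mul (S.smooth_chr i j 0)).sub
      ((S.smooth_fff 0 1).mul (S.smooth_chr i j 1))).continuousOn.div S.smooth_gdet.continuousOn
      fun _ hy => S.gdet_ne hy
  have hγ₁c : ∀ i j, ContinuousOn (γ₁ i j) U := fun i j =>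
    (((S.smooth_fff 0 0).mul (S.smooth_chr i j 1)).sub
      ((S.smooth_fff 0 1).mul (S.smooth_chr i j 0))).continuousOn.div S.smooth_gdet.continuousOn
      fun _ hy => S.gdet_ne hy
  have hFd : ∀ x ∈ U, DifferentiableAt ℝ F x := fun x hx => hF.diffAt hU hx
  have hpd : ∀ i, ∀ x ∈ U, DifferentiableAt ℝ (pd i F) x := fun i x hx =>
    (hF.pd hU i).diffAt hU hx
  have hd0 : ∀ x ∈ U, DifferentiableAt ℝ (fun y => lorentz v (F y)) x := fun x hx =>
    differentiableAt_lorentz (differentiableAt_const v) (hFd x hx)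
  have hd : ∀ i, ∀ x ∈ U, DifferentiableAt ℝ (fun y => lorentz v (pd i F y)) x := fun i x hx =>
    differentiableAt_lorentz (differentiableAt_const v) (hpd i x hx)
  have hjet : ∀ x ∈ U, ∀ k, pd k (jet v F) x =
      (lorentz v (pd k F x), lorentz v (pd k (pd 0 F) x), lorentz v (pd k (pd 1 F) x)) := by
    intro x hx k
    rw [← pd_const_lorentz (hFd x hx), ← pd_const_lorentz (hpd 0 x hx),
      ← pd_const_lorentz (hpd 1 x hx)]
    have := (hd0 x hx).hasFDerivAt.prodMk ((hd 0 x hx).hasFDerivAt.prodMk (hd 1 x hx).hasFDerivAt)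
    rw [pd, show jet v F = fun y => (lorentz v (F y), lorentz v (pd 0 F y), lorentz v (pd 1 F y))
      from rfl, this.fderiv]
    rfl
  have hn0 : ∀ x, |lorentz v (F x)| ≤ ‖jet v F x‖ := fun x => norm_fst_le (jet v F x)
  have hn1 : ∀ x k, |lorentz v (pd k F x)| ≤ ‖jet v F x‖ := fun x k => by
    refine le_trans ?_ (norm_snd_le (jet v F x))
    fin_cases k
    · exact norm_fst_le (jet v F x).2
    · exact norm_snd_le (jet v F x).2
  refine eventually_eq_zero_of_norm_pd_le hU (Y := jet v F)
    (A := fun x => 1 + ∑ i, ∑ j, (|c i j x| + |γ₀ i j x| + |γ₁ i j x|))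
    (fun x hx => (hd0 x hx).prodMk ((hd 0 x hx).prodMk (hd 1 x hx))) ?_ (fun x hx k => ?_) hx₀ h0
  · exact continuousOn_const.add (continuousOn_finsetSum _ fun i _ => continuousOn_finsetSum _
      fun j _ => ((hc i j).abs.add (hγ₀c i j).abs).add (hγ₁c i j).abs)
  · set n := ‖jet v F x‖ with hn
    have hn0' : 0 ≤ n := norm_nonneg _
    set a : Fin 2 → Fin 2 → ℝ := fun i j => |c i j x| + |γ₀ i j x| + |γ₁ i j x| with ha
    have ha0 : ∀ i j, 0 ≤ a i j := fun i j => by positivity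
    have hale : ∀ j, a k j ≤ 1 + ∑ i, ∑ j, a i j := fun j => by
      have h1 := Finset.single_le_sum (f := fun j => a k j) (fun j _ => ha0 k j) (Finset.mem_univ j)
      have h2 := Finset.single_le_sum (f := fun i => ∑ j, a i j)
        (fun i _ => Finset.sum_nonneg fun j _ => ha0 i j) (Finset.mem_univ k)
      exact h1.trans (h2.trans (le_add_of_nonneg_left zero_le_one))
    have h2 : ∀ j, |lorentz v (pd k (pd j F) x)| ≤ a k j * n := fun j => by
      rw [pd_pd_eq_covHess_add Ψ, h k j x hx, lorentz_add_right, lorentz_add_right,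
        lorentz_smul_right, lorentz_smul_right, lorentz_smul_right]
      refine (abs_add_three _ _ _).trans ?_
      rw [abs_mul, abs_mul, abs_mul]
      have e0 := mul_le_mul_of_nonneg_left (hn0 x) (abs_nonneg (c k j x))
      have e1 := mul_le_mul_of_nonneg_left (hn1 x 0) (abs_nonneg (γ₀ k j x))
      have e2 := mul_le_mul_of_nonneg_left (hn1 x 1) (abs_nonneg (γ₁ k j x))
      simp only [ha]
      linarith
    have h3 : ∀ j, |lorentz v (pd k (pd j F) x)| ≤ (1 + ∑ i, ∑ j, a i j) * n := fun j =>
      (h2 j).trans (mul_le_mul_of_nonneg_right (hale j) hn0')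
    have h4 : |lorentz v (pd k F x)| ≤ (1 + ∑ i, ∑ j, a i j) * n := by
      have : 0 ≤ ∑ i, ∑ j, a i j :=
        Finset.sum_nonneg fun i _ => Finset.sum_nonneg fun j _ => ha0 i j
      nlinarith [hn1 x k]
    rw [hjet x hx k]
    exact max_le h4 (max_le (h3 0) (h3 1))

end Continuation

section GlobalContinuation

variable {M : Type*} [TopologicalSpace M] [ConnectedSpace M] [ChartedSpace E2 M]
  [IsManifold (𝓡 2) ∞ M] {ψ N F : M → R41} {ε : ℝ}

/-- If the covariant Hessian of `F` is a multiple of `F`, then `⟨v, F⟩` vanishes identically as soon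
as its 1-jet vanishes at one point. -/
lemma lorentz_eq_zero_of_jet (hs : IsOrientedSurface ψ N ε)
    (hF : ContMDiff (𝓡 2) 𝓘(ℝ, R41) ∞ F) {c : M → Fin 2 → Fin 2 → E2 → ℝ}
    (hc : ∀ p i j, ContinuousOn (c p i j) (chartImage p))
    (h : ∀ p i j, ∀ x ∈ chartImage p,
      covHess (inChart p ψ) i j (inChart p F) x = c p i j x • inChart p F x)
    {v : R41} {p₀ : M} (h0 : jet v (inChart p₀ F) (extChartAt (𝓡 2) p₀ p₀) = 0) (p : M) :
    lorentz v (F p) = 0 := by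
  have hFp := smooth_inChart hF
  have hloc : ∀ p, jet v (inChart p F) (extChartAt (𝓡 2) p p) = 0 →
      p ∈ interior {q | lorentz v (F q) = 0} := fun p hp => by
    rw [mem_interior_iff_mem_nhds]
    have h1 := jet_eventually_eq_zero (hs.isParamSurface p) (hFp p) (hc p) (h p)
      (mem_extChartAt_target p) hp
    filter_upwards [(continuousAt_extChartAt (I := 𝓡 2) p).eventually h1,
      (isOpen_extChartAt_source (I := 𝓡 2) p).mem_nhds (mem_extChartAt_source p)] with q hq hqs
    have h2 := congrArg Prod.fst hq
    simp only [jet, inChart_extChartAt hqs] at h2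
    exact h2
  have hclosed : IsClosed (interior {q | lorentz v (F q) = 0}) := by
    refine isClosed_of_closure_subset fun p hp => hloc p ?_
    by_contra hne
    have hcont : ContinuousAt (jet v (inChart p F)) (extChartAt (𝓡 2) p p) := by
      have hU := isOpen_chartImage p
      have hx := mem_extChartAt_target (I := 𝓡 2) p
      have hcc : ∀ {F' : E2 → R41}, Smooth (chartImage p) F' →
          ContinuousAt (fun y => lorentz v (F' y)) (extChartAt (𝓡 2) p p) := fun hF' =>
        (differentiableAt_lorentz (differentiableAt_const v) (hF'.diffAt hU hx)).continuousAt
      exact (hcc (hFp p)).prodMk ((hcc ((hFp p).pd hU 0)).prodMk (hcc ((hFp p).pd hU 1)))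
    have hev := (continuousAt_extChartAt (I := 𝓡 2) p).eventually (hcont.eventually_ne hne)
    obtain ⟨q, hqZ, hq1, hqs⟩ := ((mem_closure_iff_frequently.1 hp).and_eventually
      (hev.and ((isOpen_extChartAt_source (I := 𝓡 2) p).mem_nhds (mem_extChartAt_source p)))).exists
    apply hq1
    set x := extChartAt (𝓡 2) p q with hxd
    have hx : x ∈ chartImage p := (extChartAt (𝓡 2) p).map_source hqs
    have hz : ∀ᶠ y in nhds x, lorentz v (inChart p F y) = 0 := by
      have h1 : Filter.Tendsto (extChartAt (𝓡 2) p).symm (nhds x) (nhds q) := by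
        have := continuousAt_extChartAt_symm'' (I := 𝓡 2) hx
        rwa [ContinuousAt, hxd, (extChartAt (𝓡 2) p).left_inv hqs] at this
      exact h1.eventually (mem_interior_iff_mem_nhds.1 hqZ)
    have hk : ∀ k, lorentz v (pd k (inChart p F) x) = 0 := fun k => by
      rw [← pd_const_lorentz ((hFp p).diffAt (isOpen_chartImage p) hx),
        pd_congr (F' := fun _ => 0) hz, pd_const]
    simp only [jet, hk, hz.self_of_nhds]
    rfl
  have huniv := IsClopen.eq_univ ⟨hclosed, isOpen_interior⟩ ⟨p₀, hloc p₀ h0⟩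
  have hp : p ∈ interior {q | lorentz v (F q) = 0} := huniv ▸ Set.mem_univ p
  exact interior_subset (s := {q | lorentz v (F q) = 0}) hp

end GlobalContinuation

/-! ### Focal maps of an isoparametric surface with two principal curvatures -/

namespace IsParamSurface

variable {U : Set E2} {Ψ ν : E2 → R41} {ε : ℝ} {x : E2} {k l : ℝ}

/-- If the shape operator is parallel with eigenvalues `k` and `l`, and `kl = -ε`, the covariant
Hessian of the focal map `ν + kΨ` is a multiple of it. The tangential part is `∇S = 0`, and the
normal part is `S² = (k + l) S - kl`. -/
lemma covHess_normal_add_smul (S : IsParamSurface U Ψ ν ε) (hx : x ∈ U)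
    (hT : ∀ i j m, dsff Ψ ν i j m x = 0) (ht : trS Ψ ν x = k + l) (hd : detS Ψ ν x = k * l)
    (hkl : k * l = -ε) (i j : Fin 2) :
    covHess Ψ i j (fun y => ν y + k • Ψ y) x =
      (ε * l * (k * fff Ψ i j x - sff Ψ ν i j x)) • (ν x + k • Ψ x) := by
  have hF := S.frame x hx
  have hsq := hF.sign_sq
  rw [covHess_add S.isOpen hx S.smooth_normal (S.smooth.const_smul k),
    covHess_const_smul S.isOpen hx S.smooth]
  have hP : ∀ m, lorentz (covHess Ψ i j Ψ x) (pd m Ψ x) = 0 := fun m => by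
    rw [S.covHess_position hx, lorentz_sub_left, lorentz_smul_left, lorentz_smul_left,
      S.normal_pd hx, S.position_pd hx]
    ring
  have key : ∀ m, lorentz (covHess Ψ i j ν x + k • covHess Ψ i j Ψ x) (pd m Ψ x) =
      lorentz ((ε * l * (k * fff Ψ i j x - sff Ψ ν i j x)) • (ν x + k • Ψ x)) (pd m Ψ x) :=
    fun m => by
      rw [lorentz_add_left, lorentz_smul_left, hP, S.lorentz_covHess_normal_pd hx, hT,
        lorentz_smul_left, lorentz_add_left, lorentz_smul_left, S.normal_pd hx, S.position_pd hx]
      ring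
  have hqn := (lorentz_comm (Ψ x) (ν x)).trans hF.nq
  refine hF.ext (key 0) (key 1) ?_ ?_
  · rw [lorentz_add_left, lorentz_smul_left, S.lorentz_covHess_normal_normal hx,
      S.covHess_position hx, lorentz_sub_left, lorentz_smul_left, lorentz_smul_left, hF.nn, hqn,
      lorentz_smul_left, lorentz_add_left, lorentz_smul_left, hF.nn, hqn, ht, hd]
    linear_combination (k * sff Ψ ν i j x - l * (k * fff Ψ i j x - sff Ψ ν i j x)) * hsq
  · rw [lorentz_add_left, lorentz_smul_left, S.lorentz_covHess_normal_position hx,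
      S.covHess_position hx, lorentz_sub_left, lorentz_smul_left, lorentz_smul_left, hF.qq, hF.nq,
      lorentz_smul_left, lorentz_add_left, lorentz_smul_left, hF.qq, hF.nq]
    linear_combination (-ε * (k * fff Ψ i j x - sff Ψ ν i j x)) * hkl
      + (k * fff Ψ i j x - sff Ψ ν i j x) * hsq

lemma pd_normal_add_smul (S : IsParamSurface U Ψ ν ε) (hx : x ∈ U) (k : ℝ) (j : Fin 2) :
    pd j (fun y => ν y + k • Ψ y) x = pd j ν x + k • pd j Ψ x := by
  have hd := S.smooth.diffAt S.isOpen hx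
  rw [pd_add (F' := fun y => k • Ψ y) (S.smooth_normal.diffAt S.isOpen hx) (hd.const_smul k),
    pd_const_smul hd]

lemma lorentz_focal_focal (S : IsParamSurface U Ψ ν ε) (hx : x ∈ U) (k l : ℝ) :
    lorentz (ν x + k • Ψ x) (ν x + l • Ψ x) = ε + k * l := by
  have hF := S.frame x hx
  have hqn := (lorentz_comm (Ψ x) (ν x)).trans hF.nq
  simp only [lorentz_add_left, lorentz_add_right, lorentz_smul_left, lorentz_smul_right, hF.nn,
    hF.qq, hF.nq, hqn]
  ring

lemma lorentz_focal_pd_focal (S : IsParamSurface U Ψ ν ε) (hx : x ∈ U) (k l : ℝ) (j : Fin 2) :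
    lorentz (ν x + k • Ψ x) (pd j (fun y => ν y + l • Ψ y) x) = 0 := by
  rw [S.pd_normal_add_smul hx]
  simp only [lorentz_add_left, lorentz_add_right, lorentz_smul_left, lorentz_smul_right,
    S.normal_pd hx, S.position_pd hx, S.normal_pd_normal hx, S.position_pd_normal hx]
  ring

lemma lorentz_pd_focal_pd_focal (S : IsParamSurface U Ψ ν ε) (hx : x ∈ U) (k l : ℝ)
    (i j : Fin 2) :
    lorentz (pd i (fun y => ν y + k • Ψ y) x) (pd j (fun y => ν y + l • Ψ y) x) =
      (trS Ψ ν x - k - l) * sff Ψ ν i j x + (k * l - detS Ψ ν x) * fff Ψ i j x := by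
  rw [S.pd_normal_add_smul hx, S.pd_normal_add_smul hx]
  have h1 : lorentz (pd i ν x) (pd j Ψ x) = -sff Ψ ν i j x := by
    rw [S.sff_comm hx, sff, lorentz_comm, neg_neg]
  have h2 : lorentz (pd i Ψ x) (pd j ν x) = -sff Ψ ν i j x := by rw [sff, neg_neg]
  simp only [lorentz_add_left, lorentz_add_right, lorentz_smul_left, lorentz_smul_right,
    S.lorentz_pd_normal_pd_normal hx, h1, h2]
  rw [← fff]
  ring

end IsParamSurface

section Focal

variable {M : Type*} [TopologicalSpace M] [ConnectedSpace M] [ChartedSpace E2 M]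
  [IsManifold (𝓡 2) ∞ M] {ψ N : M → R41} {ε k l : ℝ}

namespace IsOrientedSurface

variable (hs : IsOrientedSurface ψ N ε) (hkl : k ≠ l) (hdet : k * l = -ε)
  (ht : ∀ p, (shape ψ N p).trace = k + l) (hd : ∀ p, (shape ψ N p).det = k * l)
include hs hkl hdet ht hd

/-- The images of the two focal maps `N + kψ` and `N + lψ` are orthogonal to each other. -/
lemma lorentz_focal (p q : M) : lorentz (N q + l • ψ q) (N p + k • ψ p) = 0 := by
  have S := hs.isParamSurface
  have ht' : ∀ p, ∀ y ∈ chartImage p, trS (inChart p ψ) (inChart p N) y = k + l :=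
    fun p _ hy => (hs.trS_inChart hy).trans (ht _)
  have hd' : ∀ p, ∀ y ∈ chartImage p, detS (inChart p ψ) (inChart p N) y = k * l :=
    fun p _ hy => (hs.detS_inChart hy).trans (hd _)
  have hδ : (k + l) ^ 2 - 4 * (k * l) ≠ 0 := by
    rw [show (k + l) ^ 2 - 4 * (k * l) = (k - l) ^ 2 by ring]
    exact pow_ne_zero 2 (sub_ne_zero.2 hkl)
  have hF : ContMDiff (𝓡 2) 𝓘(ℝ, R41) ∞ fun q => N q + k • ψ q :=
    hs.smooth_normal.add (((contDiff_id (𝕜 := ℝ) (E := R41)).const_smul k).contMDiff.comp hs.smooth)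
  have hx := mem_extChartAt_target (I := 𝓡 2) q
  refine lorentz_eq_zero_of_jet hs hF (c := fun p i j x =>
    ε * l * (k * fff (inChart p ψ) i j x - sff (inChart p ψ) (inChart p N) i j x))
    (fun p i j => ?_) (fun p i j x hx => ?_) (v := N q + l • ψ q) (p₀ := q) ?_ p
  · exact continuousOn_const.mul ((continuousOn_const.mul ((S p).smooth_fff i j).continuousOn).sub
      ((S p).smooth_sff i j).continuousOn)
  · exact (S p).covHess_normal_add_smul hx
      (fun i j m => (S p).dsff_eq_zero (ht' p) (hd' p) hδ hx i j m) (ht' p x hx) (hd' p x hx) hdet i j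
  · have h0 := (S q).lorentz_focal_focal hx l k
    have h1 := (S q).lorentz_focal_pd_focal hx l k
    rw [inChart_extChartAt (mem_extChartAt_source q),
      inChart_extChartAt (mem_extChartAt_source q)] at h0
    simp only [inChart_extChartAt (mem_extChartAt_source q)] at h1
    refine Prod.ext ?_ (Prod.ext (h1 0) (h1 1))
    refine Eq.trans ?_ (h0.trans ?_)
    · simp only [jet]
      rw [inChart_extChartAt (mem_extChartAt_source q)]
    · change ε + l * k = 0
      linear_combination hdet

end IsOrientedSurface

end Focal

/-! ### Orthogonal bases of the Lorentz-Minkowski space -/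

section Bases

/-- Two orthogonal vectors are not both timelike. -/
lemma not_timelike_of_orthogonal {x y : R41} (hx : lorentz x x < 0) (hy : lorentz y y < 0) :
    lorentz x y ≠ 0 := by
  intro h
  simp only [lorentz] at hx hy h
  have hcs : (x 1 * y 1 + x 2 * y 2 + x 3 * y 3) ^ 2 ≤
      (x 1 ^ 2 + x 2 ^ 2 + x 3 ^ 2) * (y 1 ^ 2 + y 2 ^ 2 + y 3 ^ 2) := by
    nlinarith [sq_nonneg (x 1 * y 2 - x 2 * y 1), sq_nonneg (x 1 * y 3 - x 3 * y 1),
      sq_nonneg (x 2 * y 3 - x 3 * y 2)]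
  rw [show x 1 * y 1 + x 2 * y 2 + x 3 * y 3 = x 0 * y 0 by linarith, mul_pow] at hcs
  have h1 : x 1 ^ 2 + x 2 ^ 2 + x 3 ^ 2 < x 0 ^ 2 := by linarith
  have h2 : y 1 ^ 2 + y 2 ^ 2 + y 3 ^ 2 < y 0 ^ 2 := by linarith
  have h3 := mul_lt_mul'' h1 h2 (by positivity) (by positivity)
  linarith

variable {o : Fin 4 → R41}

/-- An orthogonal basis without null vectors has exactly one timelike vector: the determinant of its
Gram matrix is negative, and two of them are never timelike. -/
lemma exists_timelike (ho : ∀ i j, i ≠ j → lorentz (o i) (o j) = 0)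
    (hn : ∀ i, lorentz (o i) (o i) ≠ 0) :
    ∃ i, lorentz (o i) (o i) < 0 ∧ ∀ j, j ≠ i → 0 < lorentz (o j) (o j) := by
  have hprod : ∏ i, lorentz (o i) (o i) = -(Matrix.of o).det ^ 2 := by
    set m : Matrix (Fin 4) (Fin 4) ℝ := Matrix.of o with hm
    set η : Matrix (Fin 4) (Fin 4) ℝ := Matrix.diagonal ![-1, 1, 1, 1] with hη
    have h1 : m * η * m.transpose =
        Matrix.diagonal fun i => lorentz (o i) (o i) := by
      ext i j
      have hij : (m * η * m.transpose) i j = lorentz (o i) (o j) := by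
        rw [Matrix.mul_apply]
        simp [hm, hη, Matrix.mul_diagonal, Fin.sum_univ_four, lorentz]
      rw [hij]
      by_cases h : i = j
      · rw [h, Matrix.diagonal_apply_eq]
      · rw [Matrix.diagonal_apply_ne _ h, ho i j h]
    have h2 := congrArg Matrix.det h1
    rw [Matrix.det_mul, Matrix.det_mul, Matrix.det_transpose, Matrix.det_diagonal,
      Matrix.det_diagonal] at h2
    rw [← h2]
    simp [Fin.prod_univ_four]
    ring
  have hex : ∃ i, lorentz (o i) (o i) < 0 := by
    by_contra! h
    have h1 : 0 < ∏ i, lorentz (o i) (o i) :=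
      Finset.prod_pos fun i _ => lt_of_le_of_ne (h i) (hn i).symm
    rw [hprod] at h1
    nlinarith [sq_nonneg (Matrix.of o).det]
  obtain ⟨i, hi⟩ := hex
  refine ⟨i, hi, fun j hj => lt_of_le_of_ne (not_lt.1 fun h => ?_) (hn j).symm⟩
  exact not_timelike_of_orthogonal h hi (ho j i hj)

/-- The coordinates with respect to the normalization of an orthogonal basis form an isometry. -/
lemma exists_isometry_of_orthogonal (ho : ∀ i j, i ≠ j → lorentz (o i) (o j) = 0)
    (h0 : lorentz (o 0) (o 0) < 0) (hpos : ∀ j, j ≠ 0 → 0 < lorentz (o j) (o j)) :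
    ∃ A : R41 ≃ₗ[ℝ] R41, (∀ x y, lorentz (A x) (A y) = lorentz x y) ∧
      ∀ v i, lorentz v (o i) = 0 → A v i = 0 := by
  have hn : ∀ i, lorentz (o i) (o i) ≠ 0 := fun i => by
    by_cases h : i = 0
    · rw [h]; exact h0.ne
    · exact (hpos i h).ne'
  set e : Fin 4 → R41 := fun i => (Real.sqrt |lorentz (o i) (o i)|)⁻¹ • o i with he
  have hs : ∀ i, Real.sqrt |lorentz (o i) (o i)| ≠ 0 := fun i =>
    (Real.sqrt_pos.2 (abs_pos.2 (hn i))).ne'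
  have hee : ∀ i, lorentz (e i) (e i) = lorentz (o i) (o i) / |lorentz (o i) (o i)| := fun i => by
    simp only [he, lorentz_smul_left, lorentz_smul_right]
    have h1 := hs i
    have h2 := Real.mul_self_sqrt (abs_nonneg (lorentz (o i) (o i)))
    have h3 := abs_pos.2 (hn i)
    field_simp
    rw [sq, h2, mul_comm]
  have he0 : lorentz (e 0) (e 0) = -1 := by
    rw [hee, abs_of_neg h0, div_neg, div_self h0.ne]
  have hei : ∀ i, i ≠ 0 → lorentz (e i) (e i) = 1 := fun i hi => by
    rw [hee, abs_of_pos (hpos i hi), div_self (hpos i hi).ne']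
  have heo : ∀ i j, i ≠ j → lorentz (e i) (e j) = 0 := fun i j hij => by
    simp only [he, lorentz_smul_left, lorentz_smul_right, ho i j hij, mul_zero]
  set B : R41 →ₗ[ℝ] R41 := Fintype.linearCombination ℝ e with hB
  have hBe : ∀ y j, lorentz (B y) (e j) = y j * lorentz (e j) (e j) := fun y j => by
    rw [hB, Fintype.linearCombination_apply, Fin.sum_univ_four]
    simp only [lorentz_add_left, lorentz_smul_left]
    fin_cases j <;> simp [heo]
  have hBi : ∀ y z, lorentz (B y) (B z) = lorentz y z := fun y z => by
    have h1 : lorentz (B y) (B z) = ∑ j, z j * lorentz (B y) (e j) := by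
      conv_lhs => rw [hB, Fintype.linearCombination_apply ℝ e z, Fin.sum_univ_four]
      simp [Fin.sum_univ_four, hB]
    rw [h1]
    simp only [hBe, Fin.sum_univ_four, he0, hei 1 (by decide), hei 2 (by decide),
      hei 3 (by decide)]
    simp only [lorentz]
    ring
  have hne : ∀ i, lorentz (e i) (e i) ≠ 0 := fun i => by
    rw [hee]; exact div_ne_zero (hn i) (abs_pos.2 (hn i)).ne'
  have hinj : Function.Injective B := by
    rw [injective_iff_map_eq_zero]
    intro y hy
    ext j
    have := hBe y j
    rw [hy, lorentz_zero_left] at this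
    exact (mul_eq_zero.1 this.symm).resolve_right (hne j)
  set A := (LinearEquiv.ofInjectiveEndo B hinj).symm with hA
  have hBA : ∀ v, B (A v) = v := fun v => (LinearEquiv.ofInjectiveEndo B hinj).apply_symm_apply v
  refine ⟨A, fun x y => ?_, fun v i hv => ?_⟩
  · rw [← hBi, hBA, hBA]
  · have := hBe (A v) i
    rw [hBA, he] at this
    simp only [lorentz_smul_right, hv, mul_zero] at this
    refine (mul_eq_zero.1 this.symm).resolve_right ?_
    simpa [he] using hne i

/-- An orthogonal decomposition into two planes is, after an isometry, the standard one. -/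
lemma exists_isometry_of_planes (ho : ∀ i j, i ≠ j → lorentz (o i) (o j) = 0)
    (hn : ∀ i, lorentz (o i) (o i) ≠ 0) :
    ∃ A : R41 ≃ₗ[ℝ] R41, (∀ x y, lorentz (A x) (A y) = lorentz x y) ∧
      ((∀ v, lorentz v (o 0) = 0 → lorentz v (o 1) = 0 → A v 0 = 0 ∧ A v 1 = 0) ∧
        (∀ v, lorentz v (o 2) = 0 → lorentz v (o 3) = 0 → A v 2 = 0 ∧ A v 3 = 0) ∨
      (∀ v, lorentz v (o 2) = 0 → lorentz v (o 3) = 0 → A v 0 = 0 ∧ A v 1 = 0) ∧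
        (∀ v, lorentz v (o 0) = 0 → lorentz v (o 1) = 0 → A v 2 = 0 ∧ A v 3 = 0)) := by
  obtain ⟨i, hi, hpos⟩ := exists_timelike ho hn
  have key : ∀ s : Fin 4 → Fin 4, Function.Injective s → s 0 = i →
      ∃ A : R41 ≃ₗ[ℝ] R41, (∀ x y, lorentz (A x) (A y) = lorentz x y) ∧
        ∀ v j, lorentz v (o (s j)) = 0 → A v j = 0 := fun s hs h0 =>
    exists_isometry_of_orthogonal (o := fun j => o (s j)) (fun a b hab => ho _ _ (hs.ne hab))
      (by rw [h0]; exact hi) fun j hj => hpos _ fun h => hj (hs (h.trans h0.symm))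
  fin_cases i
  · obtain ⟨A, hA, hv⟩ := key ![0, 1, 2, 3] (by decide) rfl
    exact ⟨A, hA, .inl ⟨fun v h0 h1 => ⟨hv v 0 h0, hv v 1 h1⟩, fun v h0 h1 => ⟨hv v 2 h0, hv v 3 h1⟩⟩⟩
  · obtain ⟨A, hA, hv⟩ := key ![1, 0, 2, 3] (by decide) rfl
    exact ⟨A, hA, .inl ⟨fun v h0 h1 => ⟨hv v 0 h1, hv v 1 h0⟩, fun v h0 h1 => ⟨hv v 2 h0, hv v 3 h1⟩⟩⟩
  · obtain ⟨A, hA, hv⟩ := key ![2, 3, 0, 1] (by decide) rfl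
    exact ⟨A, hA, .inr ⟨fun v h0 h1 => ⟨hv v 0 h0, hv v 1 h1⟩, fun v h0 h1 => ⟨hv v 2 h0, hv v 3 h1⟩⟩⟩
  · obtain ⟨A, hA, hv⟩ := key ![3, 2, 0, 1] (by decide) rfl
    exact ⟨A, hA, .inr ⟨fun v h0 h1 => ⟨hv v 0 h1, hv v 1 h0⟩, fun v h0 h1 => ⟨hv v 2 h0, hv v 3 h1⟩⟩⟩

end Bases

/-! ### Recognition of the standard products -/

/-- The maps `(y, s, t) ↦ sΨ(y) + tν(y)` are open at the points of the surface. -/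
lemma IsParamSurface.map_nhds_normal_exponential {U : Set E2} {Ψ ν : E2 → R41} {ε : ℝ} {x : E2}
    (S : IsParamSurface U Ψ ν ε) (hx : x ∈ U) :
    Filter.map (fun z : E2 × ℝ × ℝ => z.2.1 • Ψ z.1 + z.2.2 • ν z.1) (nhds (x, 1, 0)) =
      nhds (Ψ x) := by
  have hΨ : HasStrictFDerivAt Ψ (fderiv ℝ Ψ x) x :=
    (S.smooth.contDiffAt (S.isOpen.mem_nhds hx)).hasStrictFDerivAt (by simp)
  have hν : HasStrictFDerivAt ν (fderiv ℝ ν x) x :=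
    (S.smooth_normal.contDiffAt (S.isOpen.mem_nhds hx)).hasStrictFDerivAt (by simp)
  have h1 : HasStrictFDerivAt (fun z : E2 × ℝ × ℝ => z.2.1)
      ((ContinuousLinearMap.fst ℝ ℝ ℝ).comp (ContinuousLinearMap.snd ℝ E2 (ℝ × ℝ))) (x, 1, 0) :=
    ((ContinuousLinearMap.fst ℝ ℝ ℝ).comp (ContinuousLinearMap.snd ℝ E2 (ℝ × ℝ))).hasStrictFDerivAt
  have h2 : HasStrictFDerivAt (fun z : E2 × ℝ × ℝ => z.2.2)
      ((ContinuousLinearMap.snd ℝ ℝ ℝ).comp (ContinuousLinearMap.snd ℝ E2 (ℝ × ℝ))) (x, 1, 0) :=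
    ((ContinuousLinearMap.snd ℝ ℝ ℝ).comp (ContinuousLinearMap.snd ℝ E2 (ℝ × ℝ))).hasStrictFDerivAt
  have h3 : HasStrictFDerivAt (fun z : E2 × ℝ × ℝ => z.1)
      (ContinuousLinearMap.fst ℝ E2 (ℝ × ℝ)) (x, 1, 0) :=
    (ContinuousLinearMap.fst ℝ E2 (ℝ × ℝ)).hasStrictFDerivAt
  have hΨ' := HasStrictFDerivAt.comp (x, (1 : ℝ), (0 : ℝ)) (g := Ψ) hΨ h3
  have hν' := HasStrictFDerivAt.comp (x, (1 : ℝ), (0 : ℝ)) (g := ν) hν h3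
  have hG := (h1.smul hΨ').add (h2.smul hν')
  have := hG.map_nhds_eq_of_surj ?_
  · refine this.trans ?_
    simp
  · rw [LinearMap.range_eq_top]
    intro v
    have hv := (S.frame x hx).expansion v
    set a := (lorentz (pd 1 Ψ x) (pd 1 Ψ x) * lorentz v (pd 0 Ψ x)
      - lorentz (pd 0 Ψ x) (pd 1 Ψ x) * lorentz v (pd 1 Ψ x)) /
        (lorentz (pd 0 Ψ x) (pd 0 Ψ x) * lorentz (pd 1 Ψ x) (pd 1 Ψ x)
          - lorentz (pd 0 Ψ x) (pd 1 Ψ x) ^ 2)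
    set b := (lorentz (pd 0 Ψ x) (pd 0 Ψ x) * lorentz v (pd 1 Ψ x)
      - lorentz (pd 0 Ψ x) (pd 1 Ψ x) * lorentz v (pd 0 Ψ x)) /
        (lorentz (pd 0 Ψ x) (pd 0 Ψ x) * lorentz (pd 1 Ψ x) (pd 1 Ψ x)
          - lorentz (pd 0 Ψ x) (pd 1 Ψ x) ^ 2)
    refine ⟨(a • basisVec 0 + b • basisVec 1, lorentz v (Ψ x), ε * lorentz v (ν x)), ?_⟩
    conv_rhs => rw [hv]
    simp [pd]
    abel

section Product

variable {M : Type*} [TopologicalSpace M] [ConnectedSpace M] [ChartedSpace E2 M]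
  [IsManifold (𝓡 2) ∞ M] {ψ N : M → R41} {ε k l : ℝ}

namespace IsOrientedSurface

variable (hs : IsOrientedSurface ψ N ε) (hkl : k ≠ l) (hdet : k * l = -ε)
include hs hkl hdet

omit [ConnectedSpace M] in
/-- Once the focal maps `N + kψ` and `N + lψ` take values in the two coordinate planes, `ψ` lies on
a product of two plane curves of constant square. It is open there: a nearby point `sψ + tN` of the
product has `(s - lt)² = (s - kt)² = 1`, which forces `s = 1` and `t = 0`. -/
lemma isOpenPortionOf_of_isometry (A : R41 ≃ₗ[ℝ] R41)
    (hA : ∀ x y, lorentz (A x) (A y) = lorentz x y)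
    (hF : ∀ p, A (N p + k • ψ p) 2 = 0 ∧ A (N p + k • ψ p) 3 = 0)
    (hG : ∀ p, A (N p + l • ψ p) 0 = 0 ∧ A (N p + l • ψ p) 1 = 0) :
    IsOpenPortionOf ψ {x | -(x 0) ^ 2 + (x 1) ^ 2 = k / (k - l) ∧
      (x 2) ^ 2 + (x 3) ^ 2 = l / (l - k)} := by
  have hkl0 : k - l ≠ 0 := sub_ne_zero.2 hkl
  have hlk0 : l - k ≠ 0 := sub_ne_zero.2 hkl.symm
  have hε : ε ≠ 0 := by rcases hs.sign with h | h <;> rw [h] <;> norm_num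
  have hk : k ≠ 0 := by rintro rfl; apply hε; linarith
  have hl : l ≠ 0 := by rintro rfl; apply hε; linarith
  have hqn : ∀ p, lorentz (ψ p) (N p) = 0 := fun p =>
    (lorentz_comm _ _).trans (hs.normal_tangent_deSitter p)
  have hqq : ∀ p, lorentz (ψ p) (ψ p) = 1 := hs.mem_deSitter
  have hFF : ∀ p, -(A (N p + k • ψ p) 0) ^ 2 + (A (N p + k • ψ p) 1) ^ 2 = k * (k - l) := fun p => by
    have h := hA (N p + k • ψ p) (N p + k • ψ p)
    simp only [lorentz_add_left, lorentz_add_right, lorentz_smul_left, lorentz_smul_right,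
      hs.unit_normal, hs.normal_tangent_deSitter, hqn, hqq] at h
    rw [lorentz, (hF p).1, (hF p).2] at h
    linear_combination h + hdet
  have hGG : ∀ p, (A (N p + l • ψ p) 2) ^ 2 + (A (N p + l • ψ p) 3) ^ 2 = l * (l - k) := fun p => by
    have h := hA (N p + l • ψ p) (N p + l • ψ p)
    simp only [lorentz_add_left, lorentz_add_right, lorentz_smul_left, lorentz_smul_right,
      hs.unit_normal, hs.normal_tangent_deSitter, hqn, hqq] at h
    rw [lorentz, (hG p).1, (hG p).2] at h
    linear_combination h + hdet
  have hcomb : ∀ p s t, A (s • ψ p + t • N p) = ((s - l * t) / (k - l)) • A (N p + k • ψ p)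
      + ((s - k * t) / (l - k)) • A (N p + l • ψ p) := fun p s t => by
    rw [← map_smul, ← map_smul, ← map_add]
    congr 1
    match_scalars <;> field_simp <;> ring
  have h01 : ∀ p s t, -(A (s • ψ p + t • N p) 0) ^ 2 + (A (s • ψ p + t • N p) 1) ^ 2 =
      (s - l * t) ^ 2 * (k / (k - l)) := fun p s t => by
    rw [hcomb]
    simp only [Pi.add_apply, Pi.smul_apply, smul_eq_mul, (hG p).1, (hG p).2, mul_zero, add_zero]
    rw [mul_pow, mul_pow, ← mul_neg, ← mul_add, hFF]
    field_simp
  have h23 : ∀ p s t, (A (s • ψ p + t • N p) 2) ^ 2 + (A (s • ψ p + t • N p) 3) ^ 2 =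
      (s - k * t) ^ 2 * (l / (l - k)) := fun p s t => by
    rw [hcomb]
    simp only [Pi.add_apply, Pi.smul_apply, smul_eq_mul, (hF p).1, (hF p).2, mul_zero, zero_add]
    rw [mul_pow, mul_pow, ← mul_add, hGG]
    field_simp
  set P : Set R41 := {x | -(x 0) ^ 2 + (x 1) ^ 2 = k / (k - l) ∧
    (x 2) ^ 2 + (x 3) ^ 2 = l / (l - k)} with hP
  refine ⟨A, hA, interior {z | z ∈ P → z ∈ Set.range fun p => A (ψ p)}, isOpen_interior, ?_⟩
  apply subset_antisymm
  · rintro _ ⟨p, rfl⟩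
    refine ⟨?_, ?_⟩
    · rw [mem_interior_iff_mem_nhds]
      have hcont : Continuous A.symm := LinearMap.continuous_of_finiteDimensional
        (A.symm : R41 →ₗ[ℝ] R41)
      have htend : Filter.Tendsto A.symm (nhds (A (ψ p))) (nhds (ψ p)) := by
        have := hcont.tendsto (A (ψ p))
        rwa [A.symm_apply_apply] at this
      have hmap := (hs.isParamSurface p).map_nhds_normal_exponential
        (mem_extChartAt_target (I := 𝓡 2) p)
      rw [inChart_extChartAt (mem_extChartAt_source p)] at hmap
      have hpos : ∀ᶠ z : E2 × ℝ × ℝ in nhds (extChartAt (𝓡 2) p p, 1, 0),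
          0 < z.2.1 - l * z.2.2 ∧ 0 < z.2.1 - k * z.2.2 := by
        have hc : ∀ m : ℝ, ∀ᶠ z : E2 × ℝ × ℝ in nhds (extChartAt (𝓡 2) p p, 1, 0),
            0 < z.2.1 - m * z.2.2 := fun m => by
          have h1 : Continuous fun z : E2 × ℝ × ℝ => z.2.1 - m * z.2.2 := by fun_prop
          exact h1.continuousAt.eventually_const_lt (by simp)
        exact (hc l).and (hc k)
      have himg := Filter.image_mem_map (m := fun z : E2 × ℝ × ℝ =>
        z.2.1 • inChart p ψ z.1 + z.2.2 • inChart p N z.1) hpos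
      rw [hmap] at himg
      filter_upwards [htend himg] with w ⟨⟨y, s, t⟩, ⟨hl', hk'⟩, hz⟩ hw
      simp only at hl' hk' hz
      have hw' : w = A (s • ψ ((extChartAt (𝓡 2) p).symm y)
          + t • N ((extChartAt (𝓡 2) p).symm y)) := by
        rw [← A.symm_apply_eq, ← hz]; rfl
      rw [hw'] at hw
      obtain ⟨e1, e2⟩ := hw
      rw [h01] at e1
      rw [h23] at e2
      have f1 : (s - l * t) ^ 2 = 1 := by
        have : k / (k - l) ≠ 0 := div_ne_zero hk hkl0
        field_simp at e1
        linarith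
      have f2 : (s - k * t) ^ 2 = 1 := by
        have : l / (l - k) ≠ 0 := div_ne_zero hl hlk0
        field_simp at e2
        linarith
      have g1 : s - l * t = 1 := by nlinarith
      have g2 : s - k * t = 1 := by nlinarith
      have ht : t = 0 := by
        have : (k - l) * t = 0 := by linarith
        exact (mul_eq_zero.1 this).resolve_left hkl0
      have hs1 : s = 1 := by rw [ht] at g1; linarith
      refine ⟨(extChartAt (𝓡 2) p).symm y, ?_⟩
      rw [hw', ht, hs1, one_smul, zero_smul, add_zero]
    · have h1 := h01 p 1 0
      have h2 := h23 p 1 0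
      simp only [one_smul, zero_smul, add_zero, mul_zero, sub_zero, one_pow, one_mul] at h1 h2
      exact ⟨h1, h2⟩
  · rintro z ⟨hz, hzP⟩
    exact interior_subset hz hzP

lemma isOpenPortionOfStandardProduct_of_isometry (A : R41 ≃ₗ[ℝ] R41)
    (hA : ∀ x y, lorentz (A x) (A y) = lorentz x y)
    (hF : ∀ p, A (N p + k • ψ p) 2 = 0 ∧ A (N p + k • ψ p) 3 = 0)
    (hG : ∀ p, A (N p + l • ψ p) 0 = 0 ∧ A (N p + l • ψ p) 1 = 0) :
    IsOpenPortionOfStandardProduct ψ := by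
  have h := hs.isOpenPortionOf_of_isometry hkl hdet A hA hF hG
  have hkl0 : k - l ≠ 0 := sub_ne_zero.2 hkl
  have hlk0 : l - k ≠ 0 := sub_ne_zero.2 hkl.symm
  have hε : ε ≠ 0 := by rcases hs.sign with h | h <;> rw [h] <;> norm_num
  have hk : k ≠ 0 := by rintro rfl; apply hε; linarith
  have hl : l ≠ 0 := by rintro rfl; apply hε; linarith
  have hsum : k / (k - l) = 1 - l / (l - k) := by
    field_simp; ring
  have hk0 : k / (k - l) ≠ 0 := div_ne_zero hk hkl0
  obtain ⟨p⟩ := (inferInstance : Nonempty M)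
  have hR0 : 0 ≤ l / (l - k) := by
    obtain ⟨U, -, hU⟩ := h.choose_spec.2
    have : h.choose (ψ p) ∈ U ∩ _ := hU ▸ Set.mem_range_self p
    rw [← this.2.2]
    positivity
  have hR : 0 < l / (l - k) := lt_of_le_of_ne hR0 (div_ne_zero hl hlk0).symm
  set r := Real.sqrt (l / (l - k)) with hr
  have hr2 : r ^ 2 = l / (l - k) := Real.sq_sqrt hR0
  have hr0 : 0 < r := Real.sqrt_pos.2 hR
  rw [hsum, ← hr2] at h hk0
  rcases lt_or_gt_of_ne hk0 with hneg | hpos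
  · right
    refine ⟨r, by nlinarith, ?_⟩
    rw [productH1S1, Real.sq_sqrt (by linarith)]
    convert h using 6
    ring
  · left
    refine ⟨r, hr0, by nlinarith, ?_⟩
    rw [productS11S1, Real.sq_sqrt hpos.le]
    exact h

variable (ht : ∀ p, (shape ψ N p).trace = k + l) (hd : ∀ p, (shape ψ N p).det = k * l)
include ht hd

lemma lorentz_pd_focal (p q : M) (i : Fin 2) :
    lorentz (N p + k • ψ p) (pd i (fun y => inChart q N y + l • inChart q ψ y)
      (extChartAt (𝓡 2) q q)) = 0 := by
  have S := hs.isParamSurface q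
  have hx := mem_extChartAt_target (I := 𝓡 2) q
  rw [← pd_const_lorentz (F := fun y => inChart q N y + l • inChart q ψ y)
    ((S.smooth_normal.diffAt S.isOpen hx).fun_add
      ((S.smooth.diffAt S.isOpen hx).const_smul l))]
  refine pd_eq_zero_of_const_on (c := 0) S.isOpen hx (fun y _ => ?_) i
  rw [lorentz_comm]
  exact hs.lorentz_focal hkl hdet ht hd _ _

omit [ConnectedSpace M] hdet in
/-- The focal map `N + kψ` has a non-null coordinate derivative at each point, for otherwise
`S = k`. -/
lemma exists_pd_focal_ne_zero (q : M) :
    ∃ i, lorentz (pd i (fun y => inChart q N y + k • inChart q ψ y) (extChartAt (𝓡 2) q q))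
      (pd i (fun y => inChart q N y + k • inChart q ψ y) (extChartAt (𝓡 2) q q)) ≠ 0 := by
  have S := hs.isParamSurface q
  have hx := mem_extChartAt_target (I := 𝓡 2) q
  have hW := S.gdet_ne hx
  have htr : trS (inChart q ψ) (inChart q N) (extChartAt (𝓡 2) q q) = k + l :=
    (hs.trS_inChart hx).trans (ht _)
  have hdt : detS (inChart q ψ) (inChart q N) (extChartAt (𝓡 2) q q) = k * l :=
    (hs.detS_inChart hx).trans (hd _)
  by_contra! h
  simp only [S.lorentz_pd_focal_pd_focal hx, htr, hdt] at h
  have hkl0 : l - k ≠ 0 := sub_ne_zero.2 hkl.symm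
  have hp : ∀ i, sff (inChart q ψ) (inChart q N) i i (extChartAt (𝓡 2) q q) =
      k * fff (inChart q ψ) i i (extChartAt (𝓡 2) q q) := fun i => by
    apply mul_left_cancel₀ hkl0
    linear_combination h i
  rw [trS, div_eq_iff hW, hp, hp] at htr
  rw [detS, div_eq_iff hW, hp, hp] at hdt
  rw [gdet] at htr hdt hW
  generalize sff (inChart q ψ) (inChart q N) 0 1 (extChartAt (𝓡 2) q q) = b at *
  generalize fff (inChart q ψ) 0 0 (extChartAt (𝓡 2) q q) = g00 at *
  generalize fff (inChart q ψ) 0 1 (extChartAt (𝓡 2) q q) = g01 at *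
  generalize fff (inChart q ψ) 1 1 (extChartAt (𝓡 2) q q) = g11 at *
  have hb2 : (b - k * g01) ^ 2 = 0 := by linear_combination -hdt + k * htr
  have hb : b - k * g01 = 0 := pow_eq_zero_iff two_ne_zero |>.1 hb2
  have : (l - k) * (g00 * g11 - g01 ^ 2) = 0 := by
    linear_combination (-2 * g01) * hb - htr
  exact mul_ne_zero hkl0 hW this

/-- An isoparametric surface with two distinct principal curvatures `k`, `l` is an open portion of a
standard product. -/
theorem isOpenPortionOfStandardProduct : IsOpenPortionOfStandardProduct ψ := by
  obtain ⟨q⟩ := (inferInstance : Nonempty M)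
  have S := hs.isParamSurface q
  have hx := mem_extChartAt_target (I := 𝓡 2) q
  have hdet' : l * k = -ε := by rw [mul_comm]; exact hdet
  have ht' : ∀ p, (shape ψ N p).trace = l + k := fun p => by rw [ht, add_comm]
  have hd' : ∀ p, (shape ψ N p).det = l * k := fun p => by rw [hd, mul_comm]
  have htr : trS (inChart q ψ) (inChart q N) (extChartAt (𝓡 2) q q) = k + l :=
    (hs.trS_inChart hx).trans (ht _)
  have hdt : detS (inChart q ψ) (inChart q N) (extChartAt (𝓡 2) q q) = k * l :=
    (hs.detS_inChart hx).trans (hd _)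
  obtain ⟨i, hi⟩ := hs.exists_pd_focal_ne_zero hkl ht hd q
  obtain ⟨j, hj⟩ := hs.exists_pd_focal_ne_zero hkl.symm ht' hd' q
  set F : E2 → R41 := fun y => inChart q N y + k • inChart q ψ y with hF
  set G : E2 → R41 := fun y => inChart q N y + l • inChart q ψ y with hG
  set x := extChartAt (𝓡 2) q q with hxd
  have hε : ε ≠ 0 := by rcases hs.sign with h | h <;> rw [h] <;> norm_num
  have hk : k ≠ 0 := by rintro rfl; apply hε; linarith
  have hl : l ≠ 0 := by rintro rfl; apply hε; linarith
  have hFF : lorentz (F x) (F x) ≠ 0 := by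
    rw [S.lorentz_focal_focal hx, show ε + k * k = k * (k - l) by linear_combination hdet]
    exact mul_ne_zero hk (sub_ne_zero.2 hkl)
  have hGG : lorentz (G x) (G x) ≠ 0 := by
    rw [S.lorentz_focal_focal hx, show ε + l * l = l * (l - k) by linear_combination hdet]
    exact mul_ne_zero hl (sub_ne_zero.2 hkl.symm)
  have hFG : lorentz (F x) (G x) = 0 := by
    rw [S.lorentz_focal_focal hx]; linear_combination hdet
  have hFF' := S.lorentz_focal_pd_focal hx k k i
  have hFG' := S.lorentz_focal_pd_focal hx k l j
  have hGF' := S.lorentz_focal_pd_focal hx l k i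
  have hGG' := S.lorentz_focal_pd_focal hx l l j
  have hF'G' : lorentz (pd i F x) (pd j G x) = 0 := by
    rw [S.lorentz_pd_focal_pd_focal hx, htr, hdt]; ring
  obtain ⟨A, hA, h⟩ := exists_isometry_of_planes (o := ![F x, pd i F x, G x, pd j G x])
    (fun a b hab => by
      fin_cases a <;> fin_cases b <;>
        first
        | exact absurd rfl hab
        | assumption
        | exact (lorentz_comm _ _).trans (by assumption))
    (fun a => by fin_cases a <;> assumption)
  have hFx : F x = N q + k • ψ q := by
    simp only [hF, hxd, inChart_extChartAt (mem_extChartAt_source q)]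
  have hGx : G x = N q + l • ψ q := by
    simp only [hG, hxd, inChart_extChartAt (mem_extChartAt_source q)]
  have v1 : ∀ p, lorentz (N p + k • ψ p) (G x) = 0 := fun p => by
    rw [hGx]; exact hs.lorentz_focal hkl.symm hdet' ht' hd' q p
  have v2 : ∀ p, lorentz (N p + l • ψ p) (F x) = 0 := fun p => by
    rw [hFx]; exact hs.lorentz_focal hkl hdet ht hd q p
  have v3 : ∀ p, lorentz (N p + k • ψ p) (pd j G x) = 0 := fun p =>
    hs.lorentz_pd_focal hkl hdet ht hd p q j
  have v4 : ∀ p, lorentz (N p + l • ψ p) (pd i F x) = 0 := fun p =>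
    hs.lorentz_pd_focal hkl.symm hdet' ht' hd' p q i
  rcases h with ⟨h01, h23⟩ | ⟨h01, h23⟩
  · exact hs.isOpenPortionOfStandardProduct_of_isometry hkl hdet A hA
      (fun p => h23 _ (v1 p) (v3 p)) fun p => h01 _ (v2 p) (v4 p)
  · exact hs.isOpenPortionOfStandardProduct_of_isometry hkl.symm hdet' A hA
      (fun p => h23 _ (v2 p) (v4 p)) fun p => h01 _ (v1 p) (v3 p)

end IsOrientedSurface

end Product

/-! ### Null frames on Lorentzian surfaces -/

section Along

variable {G : Type*} [NormedAddCommGroup G] [NormedSpace ℝ G] {U : Set E2} {x : E2}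

/-- Derivative of `F` along the vector field `w` of the coordinate plane. For a parametrization `Ψ`,
`along w Ψ` is the tangent field of the surface with coordinates `w`. -/
def along (w : E2 → E2) (F : E2 → G) (x : E2) : G := fderiv ℝ F x (w x)

lemma along_eq (w : E2 → E2) (F : E2 → G) (x : E2) : along w F x = ∑ i, w x i • pd i F x :=
  fderiv_eq_sum_pd F x (w x)

lemma Smooth.along (hU : IsOpen U) {w : E2 → E2} {F : E2 → G} (hF : Smooth U F)
    (hw : Smooth U w) : Smooth U (along w F) :=
  ContDiffOn.clm_apply (hF.fderiv_of_isOpen hU (by simp)) hw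

lemma along_eq_zero_of_const_on (hU : IsOpen U) (hx : x ∈ U) {F : E2 → G} {c : G}
    (h : ∀ y ∈ U, F y = c) (w : E2 → E2) : along w F x = 0 := by
  rw [along_eq]
  exact Finset.sum_eq_zero fun i _ => by rw [pd_eq_zero_of_const_on hU hx h, smul_zero]

lemma along_lorentz {F F' : E2 → R41} (hF : DifferentiableAt ℝ F x)
    (hF' : DifferentiableAt ℝ F' x) (w : E2 → E2) :
    along w (fun y => lorentz (F y) (F' y)) x =
      lorentz (along w F x) (F' x) + lorentz (F x) (along w F' x) := by
  simp only [along_eq, pd_lorentz hF hF', Fin.sum_univ_two, lorentz_add_left, lorentz_add_right,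
    lorentz_smul_left, lorentz_smul_right, smul_eq_mul]
  ring

lemma along_apply {F : E2 → R41} (hF : DifferentiableAt ℝ F x) (w : E2 → E2) (k : Fin 4) :
    along w (fun y => F y k) x = along w F x k := by
  simp only [along_eq, pd_apply hF, Fin.sum_univ_two, Pi.add_apply, Pi.smul_apply]

/-- The commutator of derivations is the derivation along the Lie bracket. -/
lemma along_along_sub (hU : IsOpen U) (hx : x ∈ U) {F : E2 → G} (hF : Smooth U F)
    {v w : E2 → E2} (hv : Smooth U v) (hw : Smooth U w) :
    along v (along w F) x - along w (along v F) x =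
      fderiv ℝ F x (fderiv ℝ w x (v x) - fderiv ℝ v x (w x)) := by
  have hd : DifferentiableAt ℝ (fderiv ℝ F) x :=
    Smooth.diffAt (hF.fderiv_of_isOpen hU (m := ∞) (by simp)) hU hx
  have hsymm := (hF.contDiffAt (hU.mem_nhds hx)).isSymmSndFDerivAt
    (by simpa using WithTop.coe_le_coe.2 (le_top : (2 : ℕ∞) ≤ ⊤))
  have h : ∀ {v w : E2 → E2}, DifferentiableAt ℝ w x → along v (along w F) x =
      fderiv ℝ F x (fderiv ℝ w x (v x)) + fderiv ℝ (fderiv ℝ F) x (v x) (w x) := fun {v w} hw => by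
    rw [along, show along w F = fun y => fderiv ℝ F y (w y) from rfl, fderiv_clm_apply hd hw]
    rfl
  rw [h (hw.diffAt hU hx), h (hv.diffAt hU hx), hsymm.eq (v x) (w x), map_sub]
  abel

end Along

namespace IsParamSurface

variable {U : Set E2} {Ψ ν : E2 → R41} {ε : ℝ} {x : E2} (S : IsParamSurface U Ψ ν ε) (hx : x ∈ U)
include S hx

lemma normal_fderiv (v : E2) : lorentz (ν x) (fderiv ℝ Ψ x v) = 0 := by
  rw [fderiv_eq_sum_pd, Fin.sum_univ_two]; simp [S.normal_pd hx]

lemma position_fderiv (v : E2) : lorentz (Ψ x) (fderiv ℝ Ψ x v) = 0 := by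
  rw [fderiv_eq_sum_pd, Fin.sum_univ_two]; simp [S.position_pd hx]

lemma normal_fderiv_normal (v : E2) : lorentz (ν x) (fderiv ℝ ν x v) = 0 := by
  rw [fderiv_eq_sum_pd, Fin.sum_univ_two]; simp [S.normal_pd_normal hx]

lemma position_fderiv_normal (v : E2) : lorentz (Ψ x) (fderiv ℝ ν x v) = 0 := by
  rw [fderiv_eq_sum_pd, Fin.sum_univ_two]; simp [S.position_pd_normal hx]

lemma fderiv_symm (v w : E2) : lorentz (fderiv ℝ Ψ x v) (fderiv ℝ ν x w) =
    lorentz (fderiv ℝ Ψ x w) (fderiv ℝ ν x v) := by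
  have h := S.sff_comm hx 0 1
  simp only [sff, neg_inj] at h
  rw [fderiv_eq_sum_pd Ψ, fderiv_eq_sum_pd ν, fderiv_eq_sum_pd Ψ, fderiv_eq_sum_pd ν]
  simp only [Fin.sum_univ_two, lorentz_add_left, lorentz_add_right, lorentz_smul_left,
    lorentz_smul_right]
  linear_combination (v 0 * w 1 - v 1 * w 0) * h

end IsParamSurface

/-- Two vector fields, given by their coordinates, which form a null frame of the parametrized
surface, normalized by `⟨A, B⟩ = -1`. -/
structure IsNullFrame (U : Set E2) (Ψ : E2 → R41) (wA wB : E2 → E2) : Prop where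
  smoothA : Smooth U wA
  smoothB : Smooth U wB
  AA : ∀ x ∈ U, lorentz (along wA Ψ x) (along wA Ψ x) = 0
  BB : ∀ x ∈ U, lorentz (along wB Ψ x) (along wB Ψ x) = 0
  AB : ∀ x ∈ U, lorentz (along wA Ψ x) (along wB Ψ x) = -1

namespace IsNullFrame

variable {U : Set E2} {Ψ ν : E2 → R41} {ε κ : ℝ} {x : E2} {wA wB : E2 → E2}

lemma symm (F : IsNullFrame U Ψ wA wB) : IsNullFrame U Ψ wB wA :=
  ⟨F.smoothB, F.smoothA, F.BB, F.AA, fun x hx => (lorentz_comm _ _).trans (F.AB x hx)⟩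

variable (F : IsNullFrame U Ψ wA wB) (S : IsParamSurface U Ψ ν ε)
include F S

lemma smooth_along_A : Smooth U (along wA Ψ) := S.smooth.along S.isOpen F.smoothA

lemma smooth_along_B : Smooth U (along wB Ψ) := S.smooth.along S.isOpen F.smoothB

lemma adapted (hx : x ∈ U) :
    IsAdaptedFrame (along wA Ψ x) (along wB Ψ x) (ν x) (Ψ x) ε where
  sign := S.sign hx
  nn := (S.frame x hx).nn
  qq := (S.frame x hx).qq
  nq := (S.frame x hx).nq
  n₀ := S.normal_fderiv hx _
  n₁ := S.normal_fderiv hx _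
  q₀ := S.position_fderiv hx _
  q₁ := S.position_fderiv hx _
  det_ne := by rw [F.AA x hx, F.AB x hx]; norm_num

/-- In a null frame the mean curvature is given by `b(A, B)`, and a double principal curvature means
that `b(A, A) b(B, B) = 0`. -/
lemma trS_detS_eq (hx : x ∈ U) :
    trS Ψ ν x = 2 * lorentz (along wA Ψ x) (along wB ν x) ∧
      detS Ψ ν x = lorentz (along wA Ψ x) (along wB ν x) ^ 2
        - lorentz (along wA Ψ x) (along wA ν x) * lorentz (along wB Ψ x) (along wB ν x) := by
  set J : Matrix (Fin 2) (Fin 2) ℝ := Matrix.of fun i j => (![wA x, wB x] j) i with hJ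
  set E' : Fin 2 → R41 := ![along wA Ψ x, along wB Ψ x] with hE'
  set n' : Fin 2 → R41 := ![-along wA ν x, -along wB ν x] with hn'
  have hE : ∀ j, E' j = ∑ i, J i j • coordField Ψ x i := fun j => by
    fin_cases j <;> exact along_eq _ _ _
  have hn : ∀ j, n' j = ∑ i, J i j • (-pd i ν x) := fun j => by
    fin_cases j <;> simp [hn', hJ, along_eq, add_comm]
  have hg : gram E' = !![0, -1; -1, 0] := by
    ext i j
    fin_cases i <;> fin_cases j <;> simp [gram, hE', F.AA x hx, F.BB x hx, F.AB x hx]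
    rw [lorentz_comm, F.AB x hx]
  have hJ0 : J.det ≠ 0 := by
    intro h0
    have h1 := congrArg Matrix.det (gram_change hE)
    rw [hg, Matrix.det_mul, h0, mul_zero, Matrix.det_fin_two] at h1
    norm_num at h1
  have hconj := gram_inv_mul_change hJ0 hE hn
  have hS : (gram (coordField Ψ x))⁻¹ *
      (Matrix.of fun i j => lorentz (coordField Ψ x i) (-pd j ν x)) = coordShape Ψ ν x := by
    simp only [lorentz_neg_right]; rfl
  have hinv : (gram E')⁻¹ = !![0, -1; -1, 0] := by
    rw [gram_inv, hg, Matrix.det_fin_two]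
    simp [hE', F.AA x hx, F.BB x hx, F.AB x hx]
  have hBA : lorentz (along wB Ψ x) (along wA ν x) = lorentz (along wA Ψ x) (along wB ν x) :=
    S.fderiv_symm hx _ _
  rw [hS, hinv, Matrix.eta_fin_two (Matrix.of fun i j => lorentz (E' i) (n' j))] at hconj
  simp only [hE', hn', Matrix.of_apply, Matrix.cons_val_zero, Matrix.cons_val_one,
    lorentz_neg_right, hBA, Matrix.mul_fin_two] at hconj
  constructor
  · rw [← S.trace_coordShape hx, ← trace_conj hJ0, ← hconj, Matrix.trace_fin_two_of]
    ring
  · rw [← S.det_coordShape hx, ← det_conj hJ0, ← hconj, Matrix.det_fin_two_of]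
    ring

variable (hκ : ∀ y ∈ U, lorentz (along wA Ψ y) (along wB ν y) = κ)
include hκ

/-- The Weingarten equation in a null frame. -/
lemma along_A_normal (hx : x ∈ U) : along wA ν x =
    -κ • along wA Ψ x - lorentz (along wA Ψ x) (along wA ν x) • along wB Ψ x := by
  have hF := F.adapted S hx
  have hBA : lorentz (along wB Ψ x) (along wA ν x) = κ :=
    (S.fderiv_symm hx _ _).trans (hκ x hx)
  have hAB := F.AB x hx
  have hBA' := (lorentz_comm _ _).trans hAB
  refine hF.ext ?_ ?_ ?_ ?_
  · rw [lorentz_sub_left, lorentz_smul_left, lorentz_smul_left, F.AA x hx, hBA', lorentz_comm]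
    ring
  · rw [lorentz_sub_left, lorentz_smul_left, lorentz_smul_left, F.BB x hx, hAB, lorentz_comm, hBA]
    ring
  · rw [lorentz_sub_left, lorentz_smul_left, lorentz_smul_left, lorentz_comm _ (ν x),
      lorentz_comm _ (ν x), lorentz_comm _ (ν x), hF.n₀, hF.n₁]
    rw [along, S.normal_fderiv_normal hx]
    ring
  · rw [lorentz_sub_left, lorentz_smul_left, lorentz_smul_left, lorentz_comm _ (Ψ x),
      lorentz_comm _ (Ψ x), lorentz_comm _ (Ψ x), hF.q₀, hF.q₁]
    rw [along, S.position_fderiv_normal hx]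
    ring

omit F in
lemma mixed_symm (hx : x ∈ U) : lorentz (along wB Ψ x) (along wA ν x) = κ :=
  (S.fderiv_symm hx _ _).trans (hκ x hx)

lemma along_B_normal (hx : x ∈ U) : along wB ν x =
    -κ • along wB Ψ x - lorentz (along wB Ψ x) (along wB ν x) • along wA Ψ x :=
  F.symm.along_A_normal S (fun _ hy => mixed_symm S hκ hy) hx

/-- The Codazzi equation in a null frame: `b(B, B)` satisfies a linear equation along `A`. -/
lemma along_A_sff_B (hx : x ∈ U) :
    along wA (fun y => lorentz (along wB Ψ y) (along wB ν y)) x =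
      (-2 * lorentz (along wA (along wB Ψ) x) (along wA Ψ x)) *
        lorentz (along wB Ψ x) (along wB ν x) := by
  have hU := S.isOpen
  have hA := (F.smooth_along_A S).diffAt hU hx
  have hB := (F.smooth_along_B S).diffAt hU hx
  have hAν := (S.smooth_normal.along hU F.smoothA).diffAt hU hx
  have hBν := (S.smooth_normal.along hU F.smoothB).diffAt hU hx
  have e1 := along_lorentz hB hBν wA
  have e2 := along_lorentz hB hAν wB
  rw [along_eq_zero_of_const_on hU hx (fun y hy => mixed_symm S hκ hy)] at e2
  have e3 := along_along_sub hU hx S.smooth_normal F.smoothA F.smoothB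
  have e4 := along_along_sub hU hx S.smooth F.smoothA F.smoothB
  have e5 := S.fderiv_symm hx (wB x) (fderiv ℝ wB x (wA x) - fderiv ℝ wA x (wB x))
  rw [← e3, ← e4] at e5
  have e5' : lorentz (along wB Ψ x) (along wA (along wB ν) x - along wB (along wA ν) x) =
      lorentz (along wA (along wB Ψ) x - along wB (along wA Ψ) x) (along wB ν x) := e5
  rw [lorentz_sub_right, lorentz_sub_left] at e5'
  have f1 := along_lorentz hB hB wA
  rw [along_eq_zero_of_const_on hU hx F.BB, lorentz_comm (along wB Ψ x)] at f1
  have f2 := along_lorentz hB hB wB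
  rw [along_eq_zero_of_const_on hU hx F.BB, lorentz_comm (along wB Ψ x)] at f2
  have f3 := along_lorentz hA hA wB
  rw [along_eq_zero_of_const_on hU hx F.AA, lorentz_comm (along wA Ψ x)] at f3
  have f4 := along_lorentz hA hB wB
  rw [along_eq_zero_of_const_on hU hx F.AB, lorentz_comm (along wA Ψ x)] at f4
  have g1 := congrArg (lorentz (along wA (along wB Ψ) x)) (F.along_B_normal S hκ hx)
  have g2 := congrArg (lorentz (along wB (along wA Ψ) x)) (F.along_B_normal S hκ hx)
  have g3 := congrArg (lorentz (along wB (along wB Ψ) x)) (F.along_A_normal S hκ hx)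
  simp only [lorentz_sub_right, lorentz_smul_right] at g1 g2 g3
  linear_combination e1 - e2 + e5' + 2 * g1 - g2 - g3 + κ * f1
    - (lorentz (along wA Ψ x) (along wA ν x) / 2) * f2
    - (lorentz (along wB Ψ x) (along wB ν x) / 2) * f3 - κ * f4

omit hκ in
/-- If `b(B, B) = 0` then the derivative of `B` along itself is a multiple of `B`. It vanishes if
the time component of `B` is constant, and the integral curves of `B` are then straight lines. -/
lemma along_B_B_eq_zero (hB0 : ∀ y ∈ U, along wB Ψ y 0 = 1) (hx : x ∈ U)
    (hq : lorentz (along wB Ψ x) (along wB ν x) = 0) : along wB (along wB Ψ) x = 0 := by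
  have hU := S.isOpen
  have hF := F.adapted S hx
  have hB := (F.smooth_along_B S).diffAt hU hx
  have f2 := along_lorentz hB hB wB
  rw [along_eq_zero_of_const_on hU hx F.BB, lorentz_comm (along wB Ψ x)] at f2
  have f3 := along_lorentz hB (S.smooth_normal.diffAt hU hx) wB
  have hBν : ∀ y ∈ U, lorentz (along wB Ψ y) (ν y) = 0 := fun y hy =>
    (lorentz_comm _ _).trans (S.normal_fderiv hy _)
  have hBΨ : ∀ y ∈ U, lorentz (along wB Ψ y) (Ψ y) = 0 := fun y hy =>
    (lorentz_comm _ _).trans (S.position_fderiv hy _)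
  rw [along_eq_zero_of_const_on hU hx hBν, hq] at f3
  have f4 := along_lorentz hB (S.smooth.diffAt hU hx) wB
  rw [along_eq_zero_of_const_on hU hx hBΨ] at f4
  have hAB := F.AB x hx
  have key : along wB (along wB Ψ) x =
      (-lorentz (along wB (along wB Ψ) x) (along wA Ψ x)) • along wB Ψ x := by
    refine hF.ext ?_ ?_ ?_ ?_
    · rw [lorentz_smul_left, lorentz_comm (along wB Ψ x) (along wA Ψ x), hAB]; ring
    · rw [lorentz_smul_left, F.BB x hx]; linarith
    · rw [lorentz_smul_left, lorentz_comm (along wB Ψ x) (ν x), hF.n₁]; linarith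
    · have hBB : lorentz (along wB Ψ x) (along wB Ψ x) = 0 := F.BB x hx
      rw [lorentz_smul_left, lorentz_comm (along wB Ψ x) (Ψ x), hF.q₁]
      change 0 = _ + lorentz (along wB Ψ x) (along wB Ψ x) at f4
      linarith
  have h0 := congrFun key 0
  rw [← along_apply hB, along_eq_zero_of_const_on hU hx hB0, Pi.smul_apply, hB0 x hx, smul_eq_mul,
    mul_one] at h0
  rw [key, ← h0, zero_smul]

end IsNullFrame

namespace IsParamSurface

variable {U : Set E2} {Ψ ν : E2 → R41} {ε : ℝ} {x : E2}

/-- Minus the square of the tangential part of the time axis. -/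
def timeNorm (Ψ : E2 → R41) (x : E2) : ℝ :=
  -(fff Ψ 1 1 x * (pd 0 Ψ x 0) ^ 2 - 2 * fff Ψ 0 1 x * pd 0 Ψ x 0 * pd 1 Ψ x 0
    + fff Ψ 0 0 x * (pd 1 Ψ x 0) ^ 2) / gdet Ψ x

/-- Coordinates of the null directions of a Lorentzian surface: the tangential part `T` of the time
axis plus or minus, according to the sign `σ`, a vector orthogonal to `T` of opposite square. -/
def nullDir (Ψ : E2 → R41) (σ : ℝ) (x : E2) : E2 :=
  ((-fff Ψ 1 1 x * pd 0 Ψ x 0 + fff Ψ 0 1 x * pd 1 Ψ x 0) / gdet Ψ x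
      + σ * (pd 1 Ψ x 0 / Real.sqrt (-gdet Ψ x))) • basisVec 0
    + ((-fff Ψ 0 0 x * pd 1 Ψ x 0 + fff Ψ 0 1 x * pd 0 Ψ x 0) / gdet Ψ x
      - σ * (pd 0 Ψ x 0 / Real.sqrt (-gdet Ψ x))) • basisVec 1

lemma along_nullDir (Ψ : E2 → R41) (σ : ℝ) (x : E2) : along (nullDir Ψ σ) Ψ x =
    ((-fff Ψ 1 1 x * pd 0 Ψ x 0 + fff Ψ 0 1 x * pd 1 Ψ x 0) / gdet Ψ x
      + σ * (pd 1 Ψ x 0 / Real.sqrt (-gdet Ψ x))) • pd 0 Ψ x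
    + ((-fff Ψ 0 0 x * pd 1 Ψ x 0 + fff Ψ 0 1 x * pd 0 Ψ x 0) / gdet Ψ x
      - σ * (pd 0 Ψ x 0 / Real.sqrt (-gdet Ψ x))) • pd 1 Ψ x := by
  rw [along, nullDir, map_add, map_smul, map_smul]; rfl

variable (S : IsParamSurface U Ψ ν ε) (hε : ε = 1)
include S hε

lemma gdet_neg (hx : x ∈ U) : gdet Ψ x < 0 := by
  have h : gdet Ψ x * ε < 0 := (S.frame x hx).det_mul_sign_neg
  rw [hε] at h
  linarith

/-- The time axis has square `-1`, and its components along `ν` and `Ψ` are spacelike. -/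
lemma one_le_timeNorm (hx : x ∈ U) : 1 ≤ timeNorm Ψ x := by
  have h := (S.frame x hx).lorentz_eq ![1, 0, 0, 0] ![1, 0, 0, 0]
  have he : ∀ v : R41, lorentz ![1, 0, 0, 0] v = -v 0 := fun v => by simp [lorentz]
  rw [hε] at h
  simp only [he] at h
  simp only [Matrix.cons_val_zero] at h
  have h2 : timeNorm Ψ x = -((fff Ψ 1 1 x * (-pd 0 Ψ x 0 * -pd 0 Ψ x 0)
      - fff Ψ 0 1 x * (-pd 0 Ψ x 0 * -pd 1 Ψ x 0 + -pd 1 Ψ x 0 * -pd 0 Ψ x 0)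
      + fff Ψ 0 0 x * (-pd 1 Ψ x 0 * -pd 1 Ψ x 0)) / gdet Ψ x) := by
    rw [timeNorm]; ring
  have h3 : -(-1 : ℝ) = timeNorm Ψ x - 1 * (-ν x 0 * -ν x 0) - -Ψ x 0 * -Ψ x 0 := by
    rw [h2, h]
    simp only [fff, gdet]
    ring
  nlinarith [sq_nonneg (ν x 0), sq_nonneg (Ψ x 0)]

lemma lorentz_along_nullDir (hx : x ∈ U) (σ σ' : ℝ) :
    lorentz (along (nullDir Ψ σ) Ψ x) (along (nullDir Ψ σ') Ψ x) =
      (σ * σ' - 1) * timeNorm Ψ x := by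
  have hW := S.gdet_neg hε hx
  have hs0 : Real.sqrt (-gdet Ψ x) ≠ 0 := (Real.sqrt_pos.2 (by linarith)).ne'
  have hs2 : Real.sqrt (-gdet Ψ x) ^ 2 = -gdet Ψ x := Real.sq_sqrt (by linarith)
  have hWd : gdet Ψ x = fff Ψ 0 0 x * fff Ψ 1 1 x - fff Ψ 0 1 x ^ 2 := rfl
  rw [along_nullDir, along_nullDir, timeNorm]
  simp only [lorentz_add_left, lorentz_add_right, lorentz_smul_left, lorentz_smul_right]
  simp only [← fff.eq_def, fff_comm Ψ 1 0]
  have hW0 := hW.ne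
  set s := Real.sqrt (-gdet Ψ x)
  have hs3 : gdet Ψ x = -s ^ 2 := by linarith
  rw [hs3] at hWd ⊢
  field_simp
  generalize fff Ψ 0 0 x = g00 at *
  generalize fff Ψ 0 1 x = g01 at *
  generalize fff Ψ 1 1 x = g11 at *
  generalize pd 0 Ψ x 0 = e0 at *
  generalize pd 1 Ψ x 0 = e1 at *
  linear_combination (-(g11 * e0 ^ 2 - 2 * g01 * e0 * e1 + g00 * e1 ^ 2)) * hWd

omit S hε in
lemma along_nullDir_time (Ψ : E2 → R41) (x : E2) (σ : ℝ) :
    along (nullDir Ψ σ) Ψ x 0 = timeNorm Ψ x := by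
  rw [along_nullDir, timeNorm]
  simp only [Pi.add_apply, Pi.smul_apply, smul_eq_mul]
  ring

omit hε in
lemma smooth_timeNorm : Smooth U (timeNorm Ψ) := by
  have hp : ∀ i, Smooth U (fun y => pd i Ψ y 0) := fun i => contDiffOn_pi.1 (S.smooth_pd i) 0
  have hg := S.smooth_fff
  unfold timeNorm
  exact ((((hg 1 1).mul ((hp 0).pow 2)).sub
    (((contDiffOn_const.mul (hg 0 1)).mul (hp 0)).mul (hp 1))).add
      ((hg 0 0).mul ((hp 1).pow 2))).neg.div S.smooth_gdet fun y hy => S.gdet_ne hy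

lemma smooth_nullDir (σ : ℝ) : Smooth U (nullDir Ψ σ) := by
  have hp : ∀ i, Smooth U (fun y => pd i Ψ y 0) := fun i => contDiffOn_pi.1 (S.smooth_pd i) 0
  have hg := S.smooth_fff
  have hW : ∀ y ∈ U, -gdet Ψ y ≠ 0 := fun y hy => neg_ne_zero.2 (S.gdet_ne hy)
  have hs : ContDiffOn ℝ ∞ (fun y => Real.sqrt (-gdet Ψ y)) U := S.smooth_gdet.neg.sqrt hW
  have hs0 : ∀ y ∈ U, Real.sqrt (-gdet Ψ y) ≠ 0 := fun y hy =>
    (Real.sqrt_pos.2 (by linarith [S.gdet_neg hε hy])).ne'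
  have h0 : ∀ y ∈ U, gdet Ψ y ≠ 0 := fun y hy => S.gdet_ne hy
  unfold nullDir
  refine ContDiffOn.add
    (ContDiffOn.fun_smul (ContDiffOn.add (f := fun y => _) (g := fun y => _) ?_ ?_)
      contDiffOn_const)
    (ContDiffOn.fun_smul (ContDiffOn.sub (f := fun y => _) (g := fun y => _) ?_ ?_)
      contDiffOn_const)
  · exact (((hg 1 1).neg.mul (hp 0)).add ((hg 0 1).mul (hp 1))).div S.smooth_gdet h0
  · exact contDiffOn_const.mul ((hp 1).div hs hs0)
  · exact (((hg 0 0).neg.mul (hp 1)).add ((hg 0 1).mul (hp 0))).div S.smooth_gdet h0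
  · exact contDiffOn_const.mul ((hp 0).div hs hs0)

omit S hε in
lemma along_smul {G : Type*} [NormedAddCommGroup G] [NormedSpace ℝ G] (c : E2 → ℝ) (w : E2 → E2)
    (F : E2 → G) (x : E2) : along (fun y => c y • w y) F x = c x • along w F x :=
  map_smul _ _ _

/-- The null directions of a Lorentzian surface, suitably normalized, form a null frame. -/
lemma isNullFrame {σ : ℝ} (hσ : σ * σ = 1) : IsNullFrame U Ψ
    (fun y => (1 / 2 : ℝ) • nullDir Ψ (-σ) y) (fun y => (timeNorm Ψ y)⁻¹ • nullDir Ψ σ y) where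
  smoothA := contDiffOn_const.fun_smul (S.smooth_nullDir hε _)
  smoothB := (S.smooth_timeNorm.inv fun y hy => by
    linarith [S.one_le_timeNorm hε hy]).fun_smul (S.smooth_nullDir hε _)
  AA y hy := by
    rw [along_smul, lorentz_smul_left, lorentz_smul_right, S.lorentz_along_nullDir hε hy]
    linear_combination (timeNorm Ψ y / 4) * hσ
  BB y hy := by
    rw [along_smul, lorentz_smul_left, lorentz_smul_right, S.lorentz_along_nullDir hε hy, hσ]
    ring
  AB y hy := by
    have h := S.one_le_timeNorm hε hy
    have h0 : timeNorm Ψ y ≠ 0 := by linarith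
    rw [along_smul, along_smul, lorentz_smul_left, lorentz_smul_right,
      S.lorentz_along_nullDir hε hy]
    field_simp
    linear_combination (-1 : ℝ) * hσ

lemma along_nullB_time (hx : x ∈ U) (σ : ℝ) :
    along (fun y => (timeNorm Ψ y)⁻¹ • nullDir Ψ σ y) Ψ x 0 = 1 := by
  have h0 : timeNorm Ψ x ≠ 0 := by linarith [S.one_le_timeNorm hε hx]
  rw [along_smul, Pi.smul_apply, along_nullDir_time, smul_eq_mul,
    inv_mul_cancel₀ h0]

end IsParamSurface

/-! ### Integral curves of vector fields -/

section IntegralCurves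

variable {E : Type*} [NormedAddCommGroup E] [NormedSpace ℝ E] {w : E → E} {x₀ : E}

/-- Integral curves starting near `x₀` exist for a uniform time and stay near `x₀`. -/
lemma exists_integralCurve [CompleteSpace E] (hw : ContDiffAt ℝ 1 w x₀) {O : Set E}
    (hO : O ∈ nhds x₀) : ∃ r > 0, ∃ η > 0, ∀ x ∈ Metric.ball x₀ r, ∃ α : ℝ → E, α 0 = x ∧
      ∀ t ∈ Set.Ioo (-η) η, α t ∈ O ∧ HasDerivAt α (w (α t)) t := by
  obtain ⟨η, hη, _, r, _, _, hr, hpl⟩ := IsPicardLindelof.of_contDiffAt_one hw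
  obtain ⟨α, hα, hcont⟩ :=
    (hpl 0).exists_forall_mem_closedBall_eq_hasDerivWithinAt_continuousOn
  have hN : Metric.closedBall x₀ r ×ˢ Set.Icc (0 - η) (0 + η) ∈ nhds (x₀, (0 : ℝ)) :=
    prod_mem_nhds (Metric.closedBall_mem_nhds _ hr) (Icc_mem_nhds (by linarith) (by linarith))
  have hα0 : α (x₀, 0) = x₀ := (hα x₀ (Metric.mem_closedBall_self hr.le)).1
  have hpre : α ⁻¹' O ∈ nhds (x₀, (0 : ℝ)) :=
    (hcont.continuousAt hN).preimage_mem_nhds (by rwa [hα0])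
  obtain ⟨ρ, hρ, hball⟩ := Metric.mem_nhds_iff.1 hpre
  refine ⟨min r ρ, lt_min hr hρ, min η ρ, lt_min hη hρ, fun x hx => ?_⟩
  have hxr : x ∈ Metric.closedBall x₀ r :=
    Metric.ball_subset_closedBall (Metric.ball_subset_ball (min_le_left _ _) hx)
  refine ⟨fun t => α (x, t), (hα x hxr).1, fun t ht => ⟨hball ?_, ?_⟩⟩
  · rw [Metric.mem_ball, Prod.dist_eq, max_lt_iff]
    refine ⟨lt_of_lt_of_le (Metric.mem_ball.1 hx) (min_le_right _ _), ?_⟩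
    rw [Real.dist_eq, sub_zero]
    exact (abs_lt.2 ht).trans_le (min_le_right _ _)
  · have h1 : -η < t := (neg_le_neg (min_le_left _ _)).trans_lt ht.1
    have h2 : t < η := ht.2.trans_le (min_le_left _ _)
    exact ((hα x hxr).2 t ⟨by linarith, by linarith⟩).hasDerivAt
      (Icc_mem_nhds (by linarith) (by linarith))

lemma contDiffOn_integralCurve [CompleteSpace E] {U : Set E} (hw : ContDiffOn ℝ ∞ w U)
    {α : ℝ → E} {a b : ℝ}
    (hα : ∀ t ∈ Set.Ioo a b, α t ∈ U ∧ HasDerivAt α (w (α t)) t) :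
    ContDiffOn ℝ ∞ α (Set.Ioo a b) := by
  intro t ht
  obtain ⟨a', ha', hat⟩ := exists_between ht.1
  obtain ⟨b', htb, hb'⟩ := exists_between ht.2
  have hsub : Set.Icc a' b' ⊆ Set.Ioo a b := fun s hs => ⟨ha'.trans_le hs.1, hs.2.trans_lt hb'⟩
  have h := ODE.contDiffOn_enat_Icc_of_hasDerivWithinAt (n := ⊤) (f := fun _ : ℝ => w) (u := U)
    (hw.comp contDiff_snd.contDiffOn fun y hy => hy.2)
    (fun s hs => (hα s (hsub hs)).2.hasDerivWithinAt) (fun s hs => (hα s (hsub hs)).1)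
  exact (h.contDiffAt (Icc_mem_nhds hat htb)).contDiffWithinAt

/-- A solution of a linear equation which vanishes once vanishes identically. -/
lemma eq_zero_of_hasDerivAt_mul {f c : ℝ → ℝ} {K a b t₀ : ℝ} (hK : ∀ t ∈ Set.Ioo a b, |c t| ≤ K)
    (hf : ∀ t ∈ Set.Ioo a b, HasDerivAt f (c t * f t) t) (ht₀ : t₀ ∈ Set.Ioo a b)
    (h0 : f t₀ = 0) : ∀ t ∈ Set.Ioo a b, f t = 0 := by
  refine ODE_solution_unique_of_mem_Ioo (v := fun t y => c t * y) (s := fun _ => Set.univ)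
    (K := K.toNNReal) (g := fun _ => 0) (fun t ht => ?_) ht₀ (fun t ht => ⟨hf t ht, trivial⟩)
    (fun t _ => ⟨by simpa using hasDerivAt_const t (0 : ℝ), trivial⟩) h0
  refine LipschitzOnWith.of_dist_le_mul fun y _ z _ => ?_
  rw [Real.dist_eq, Real.dist_eq, ← mul_sub, abs_mul]
  exact mul_le_mul_of_nonneg_right ((hK t ht).trans (Real.le_coe_toNNReal K)) (abs_nonneg _)

/-- Chords of a curve whose velocity is close to `v₀` are close to multiples of `v₀`. -/
lemma norm_sub_sub_smul_le {α : ℝ → E} {v : E → E} {v₀ : E} {c η : ℝ}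
    (hα : ∀ t ∈ Set.Ioo (-η) η, ‖v (α t) - v₀‖ ≤ c ∧ HasDerivAt α (v (α t)) t) {s t : ℝ}
    (hs : s ∈ Set.Ioo (-η) η) (ht : t ∈ Set.Ioo (-η) η) :
    ‖α s - α t - (s - t) • v₀‖ ≤ c * |s - t| := by
  have hd : ∀ τ ∈ Set.Ioo (-η) η,
      HasDerivWithinAt (fun τ => α τ - τ • v₀) (v (α τ) - v₀) (Set.Ioo (-η) η) τ := fun τ hτ => by
    have h := ((hα τ hτ).2.sub ((hasDerivAt_id τ).smul_const v₀)).hasDerivWithinAt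
      (s := Set.Ioo (-η) η)
    rwa [one_smul] at h
  have h := (convex_Ioo (-η) η).norm_image_sub_le_of_norm_hasDerivWithin_le hd
    (fun τ hτ => (hα τ hτ).1) ht hs
  rw [Real.norm_eq_abs] at h
  refine le_trans (le_of_eq (congrArg _ ?_)) h
  rw [sub_smul]
  abel

/-- In the plane, integral curves of two transversal vector fields through nearby points meet. -/
lemma exists_integralCurve_inter {v w : E2 → E2} {x₀ : E2} (hv : ContDiffAt ℝ 1 v x₀)
    (hw : ContDiffAt ℝ 1 w x₀) (hli : LinearIndependent ℝ ![v x₀, w x₀]) {O : Set E2}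
    (hO : O ∈ nhds x₀) : ∃ r > 0, ∀ x ∈ Metric.ball x₀ r, ∀ y ∈ Metric.ball x₀ r,
      ∃ (α β : ℝ → E2) (η : ℝ), α 0 = x ∧ β 0 = y ∧ 0 < η ∧
        (∀ t ∈ Set.Ioo (-η) η, α t ∈ O ∧ HasDerivAt α (v (α t)) t) ∧
        (∀ t ∈ Set.Ioo (-η) η, β t ∈ O ∧ HasDerivAt β (w (β t)) t) ∧
        ∃ s ∈ Set.Ioo (-η) η, ∃ t ∈ Set.Ioo (-η) η, α s = β t := by
  set f' : ℝ × ℝ →L[ℝ] E2 := (ContinuousLinearMap.fst ℝ ℝ ℝ).smulRight (v x₀)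
    - (ContinuousLinearMap.snd ℝ ℝ ℝ).smulRight (w x₀) with hf'
  have hf'a : ∀ q : ℝ × ℝ, f' q = q.1 • v x₀ - q.2 • w x₀ := fun q => rfl
  have hinj : LinearMap.ker (f' : ℝ × ℝ →ₗ[ℝ] E2) = ⊥ := by
    rw [LinearMap.ker_eq_bot']
    intro q hq
    have h := LinearIndependent.pair_iff.1 hli q.1 (-q.2)
      (by rw [neg_smul, ← sub_eq_add_neg]; exact hq)
    exact Prod.ext h.1 (neg_eq_zero.1 h.2)
  have hsurj : LinearMap.range (f' : ℝ × ℝ →ₗ[ℝ] E2) = ⊤ :=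
    (LinearMap.ker_eq_bot_iff_range_eq_top_of_finrank_eq_finrank (by simp)).1 hinj
  set R := f'.nonlinearRightInverseOfSurjective hsurj
  have hRpos : 0 < (R.nnnorm : ℝ) := f'.nonlinearRightInverseOfSurjective_nnnorm_pos hsurj
  set c : ℝ := (R.nnnorm : ℝ)⁻¹ / 4 with hc
  have hc0 : 0 < c := by positivity
  have hnear : ∀ {u : E2 → E2}, ContDiffAt ℝ 1 u x₀ →
      O ∩ {z | ‖u z - u x₀‖ ≤ c} ∈ nhds x₀ := fun {u} hu => by
    refine Filter.inter_mem hO ?_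
    have h := hu.continuousAt.sub (continuousAt_const (y := u x₀))
    have h2 := h.norm
    simp only [Pi.sub_apply] at h2
    exact (h2.eventually_lt (continuousAt_const (y := c)) (by simpa using hc0)).mono
      fun z hz => le_of_lt hz
  obtain ⟨r₁, hr₁, η₁, hη₁, H₁⟩ := exists_integralCurve hv (hnear hv)
  obtain ⟨r₂, hr₂, η₂, hη₂, H₂⟩ := exists_integralCurve hw (hnear hw)
  set η := min η₁ η₂ with hη
  have hη0 : 0 < η := lt_min hη₁ hη₂
  refine ⟨min (min r₁ r₂) (c * η / 2), lt_min (lt_min hr₁ hr₂) (by positivity),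
    fun x hx y hy => ?_⟩
  obtain ⟨α, hα0, hα⟩ := H₁ x
    (Metric.ball_subset_ball ((min_le_left _ _).trans (min_le_left _ _)) hx)
  obtain ⟨β, hβ0, hβ⟩ := H₂ y
    (Metric.ball_subset_ball ((min_le_left _ _).trans (min_le_right _ _)) hy)
  have s₁ : Set.Ioo (-η) η ⊆ Set.Ioo (-η₁) η₁ :=
    Set.Ioo_subset_Ioo (neg_le_neg (min_le_left _ _)) (min_le_left _ _)
  have s₂ : Set.Ioo (-η) η ⊆ Set.Ioo (-η₂) η₂ :=
    Set.Ioo_subset_Ioo (neg_le_neg (min_le_right _ _)) (min_le_right _ _)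
  refine ⟨α, β, η, hα0, hβ0, hη0, fun t ht => ⟨(hα t (s₁ ht)).1.1, (hα t (s₁ ht)).2⟩,
    fun t ht => ⟨(hβ t (s₂ ht)).1.1, (hβ t (s₂ ht)).2⟩, ?_⟩
  have hα' : ∀ t ∈ Set.Ioo (-η) η, ‖v (α t) - v x₀‖ ≤ c ∧ HasDerivAt α (v (α t)) t :=
    fun t ht => ⟨(hα t (s₁ ht)).1.2, (hα t (s₁ ht)).2⟩
  have hβ' : ∀ t ∈ Set.Ioo (-η) η, ‖w (β t) - w x₀‖ ≤ c ∧ HasDerivAt β (w (β t)) t :=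
    fun t ht => ⟨(hβ t (s₂ ht)).1.2, (hβ t (s₂ ht)).2⟩
  set B : Set (ℝ × ℝ) := Metric.closedBall 0 (η / 2) with hB
  have hmem : ∀ q ∈ B, q.1 ∈ Set.Ioo (-η) η ∧ q.2 ∈ Set.Ioo (-η) η := fun q hq => by
    rw [hB, mem_closedBall_zero_iff, Prod.norm_def, max_le_iff, Real.norm_eq_abs,
      Real.norm_eq_abs] at hq
    exact ⟨abs_lt.1 (by linarith [hq.1]), abs_lt.1 (by linarith [hq.2])⟩
  have happ : ApproximatesLinearOn (fun q : ℝ × ℝ => α q.1 - β q.2) f' B (2 * c.toNNReal) := by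
    intro q hq q' hq'
    have h1 := norm_sub_sub_smul_le hα' (hmem q hq).1 (hmem q' hq').1
    have h2 := norm_sub_sub_smul_le hβ' (hmem q hq).2 (hmem q' hq').2
    have h3 : |q.1 - q'.1| ≤ ‖q - q'‖ := norm_fst_le (q - q')
    have h4 : |q.2 - q'.2| ≤ ‖q - q'‖ := norm_snd_le (q - q')
    have h5 : α q.1 - β q.2 - (α q'.1 - β q'.2) - f' (q - q')
        = (α q.1 - α q'.1 - (q.1 - q'.1) • v x₀) - (β q.2 - β q'.2 - (q.2 - q'.2) • w x₀) := by
      simp only [hf'a, Prod.fst_sub, Prod.snd_sub]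
      abel
    rw [h5]
    refine (norm_sub_le _ _).trans ?_
    rw [NNReal.coe_mul, Real.coe_toNNReal c hc0.le]
    have h6 := mul_le_mul_of_nonneg_left h3 hc0.le
    have h7 := mul_le_mul_of_nonneg_left h4 hc0.le
    push_cast
    linarith
  have hsurjB := happ.surjOn_closedBall_of_nonlinearRightInverse R (by positivity : 0 ≤ η / 2)
    subset_rfl
  have h0 : (0 : E2) ∈ Metric.closedBall ((fun q : ℝ × ℝ => α q.1 - β q.2) 0)
      (((R.nnnorm : ℝ)⁻¹ - (2 * c.toNNReal : NNReal)) * (η / 2)) := by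
    have hx' := lt_of_lt_of_le (Metric.mem_ball.1 hx) (min_le_right _ _)
    have hy' := lt_of_lt_of_le (Metric.mem_ball.1 hy) (min_le_right _ _)
    have h1 := dist_triangle_right x y x₀
    have h2 : ((2 * c.toNNReal : NNReal) : ℝ) = 2 * c := by
      rw [NNReal.coe_mul, Real.coe_toNNReal c hc0.le]; rfl
    have h3 : (R.nnnorm : ℝ)⁻¹ = 4 * c := by rw [hc]; ring
    rw [Metric.mem_closedBall, dist_zero_left]
    beta_reduce
    rw [Prod.fst_zero, Prod.snd_zero, hα0, hβ0,
      ← dist_eq_norm, h2, h3]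
    linarith
  obtain ⟨q, hq, hq0⟩ := hsurjB h0
  exact ⟨q.1, (hmem q hq).1, q.2, (hmem q hq).2, sub_eq_zero.1 hq0⟩

end IntegralCurves

/-! ### Local structure of surfaces with a double, non-diagonalizable principal curvature -/

lemma hasDerivAt_comp_integralCurve {G : Type*} [NormedAddCommGroup G] [NormedSpace ℝ G]
    {F : E2 → G} {w : E2 → E2} {α : ℝ → E2} {t : ℝ} (hF : DifferentiableAt ℝ F (α t))
    (hα : HasDerivAt α (w (α t)) t) : HasDerivAt (fun τ => F (α τ)) (along w F (α t)) t :=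
  hF.hasFDerivAt.comp_hasDerivAt t hα

namespace IsNullFrame

variable {U : Set E2} {Ψ ν : E2 → R41} {ε κ : ℝ} {x : E2} {wA wB : E2 → E2}
  (F : IsNullFrame U Ψ wA wB) (S : IsParamSurface U Ψ ν ε)
include F

lemma linearIndependent (hx : x ∈ U) : LinearIndependent ℝ ![wA x, wB x] := by
  rw [LinearIndependent.pair_iff]
  intro s t h
  have h1 : s • along wA Ψ x + t • along wB Ψ x = 0 := by
    have h2 := congrArg (fderiv ℝ Ψ x) h
    rwa [map_add, map_smul, map_smul, map_zero] at h2
  have hA := congrArg (lorentz (along wA Ψ x)) h1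
  have hB := congrArg (lorentz (along wB Ψ x)) h1
  simp only [lorentz_add_right, lorentz_smul_right, F.AA x hx, F.BB x hx, F.AB x hx,
    lorentz_comm (along wB Ψ x) (along wA Ψ x), lorentz_zero_right] at hA hB
  exact ⟨by linarith, by linarith⟩

include S

omit F in
lemma continuousAt_lorentz_along (hx : x ∈ U) {V W : E2 → R41} (hV : Smooth U V)
    (hW : Smooth U W) : ContinuousAt (fun y => lorentz (V y) (W y)) x :=
  ((hV.lorentz hW).diffAt S.isOpen hx).continuousAt

variable (hκ : ∀ y ∈ U, lorentz (along wA Ψ y) (along wB ν y) = κ)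
include hκ

/-- If `b(A, A)` and `b(B, B)` both vanish then the point is umbilical. -/
lemma sff_eq_of_eq_zero (hx : x ∈ U) (hA : lorentz (along wA Ψ x) (along wA ν x) = 0)
    (hB : lorentz (along wB Ψ x) (along wB ν x) = 0) (i j : Fin 2) :
    sff Ψ ν i j x = κ * fff Ψ i j x := by
  have hF := F.adapted S hx
  have h1 := F.along_A_normal S hκ hx
  have h2 := F.along_B_normal S hκ hx
  rw [hA, zero_smul, sub_zero] at h1
  rw [hB, zero_smul, sub_zero] at h2
  have key : pd j ν x = -κ • pd j Ψ x := by
    refine hF.ext ?_ ?_ ?_ ?_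
    · rw [lorentz_comm, show lorentz (along wA Ψ x) (pd j ν x) =
        lorentz (pd j Ψ x) (along wA ν x) from S.fderiv_symm hx _ _, h1, lorentz_smul_right,
        lorentz_smul_left]
    · rw [lorentz_comm, show lorentz (along wB Ψ x) (pd j ν x) =
        lorentz (pd j Ψ x) (along wB ν x) from S.fderiv_symm hx _ _, h2, lorentz_smul_right,
        lorentz_smul_left]
    · rw [lorentz_comm, S.normal_pd_normal hx, lorentz_smul_left, lorentz_comm, S.normal_pd hx,
        mul_zero]
    · rw [lorentz_comm, S.position_pd_normal hx, lorentz_smul_left, lorentz_comm,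
        S.position_pd hx, mul_zero]
  rw [sff, key, lorentz_smul_right, fff]
  ring

/-- If `b(A, A) b(B, B) = 0` then one of the two factors vanishes on a neighbourhood. Otherwise
an integral curve of `B` on which `b(A, A)` never vanishes would meet an integral curve of `A` on
which `b(B, B)` never vanishes. -/
lemma eventually_eq_zero_or
    (hprod : ∀ y ∈ U, lorentz (along wA Ψ y) (along wA ν y) *
      lorentz (along wB Ψ y) (along wB ν y) = 0) (hx : x ∈ U) :
    (∀ᶠ y in nhds x, lorentz (along wA Ψ y) (along wA ν y) = 0) ∨
      ∀ᶠ y in nhds x, lorentz (along wB Ψ y) (along wB ν y) = 0 := by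
  by_contra! hcon
  obtain ⟨hfA, hfB⟩ := hcon
  have hU := S.isOpen
  have hA := F.smooth_along_A S
  have hB := F.smooth_along_B S
  set cA : E2 → ℝ := fun y => -2 * lorentz (along wA (along wB Ψ) y) (along wA Ψ y)
  set cB : E2 → ℝ := fun y => -2 * lorentz (along wB (along wA Ψ) y) (along wB Ψ y)
  have hcA : ContinuousAt cA x := continuousAt_const.mul
    (continuousAt_lorentz_along S hx (hB.along hU F.smoothA) hA)
  have hcB : ContinuousAt cB x := continuousAt_const.mul
    (continuousAt_lorentz_along S hx (hA.along hU F.smoothB) hB)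
  have hbd : ∀ {c : E2 → ℝ}, ContinuousAt c x → ∀ᶠ y in nhds x, |c y| ≤ |c x| + 1 := fun hc =>
    (hc.abs.eventually_lt continuousAt_const (by simp)).mono fun _ h => le_of_lt h
  have hO : U ∩ ({y | |cA y| ≤ |cA x| + 1} ∩ {y | |cB y| ≤ |cB x| + 1}) ∈ nhds x :=
    Filter.inter_mem (hU.mem_nhds hx) (Filter.inter_mem (hbd hcA) (hbd hcB))
  have hsm : ∀ {w : E2 → E2}, Smooth U w → ContDiffAt ℝ 1 w x := fun hw =>
    (hw.contDiffAt (hU.mem_nhds hx)).of_le (by simp)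
  obtain ⟨r, hr, H⟩ := exists_integralCurve_inter (hsm F.smoothB) (hsm F.smoothA)
    (F.symm.linearIndependent hx) hO
  obtain ⟨y, hyA, hy⟩ := (hfA.and_eventually (Metric.ball_mem_nhds x hr)).exists
  obtain ⟨z, hzB, hz⟩ := (hfB.and_eventually (Metric.ball_mem_nhds x hr)).exists
  obtain ⟨α, β, η, hα0, hβ0, hη, hα, hβ, s, hs, t, ht, hst⟩ := H y hy z hz
  have h0 : (0 : ℝ) ∈ Set.Ioo (-η) η := ⟨by linarith, hη⟩
  have hqA : lorentz (along wA Ψ (α s)) (along wA ν (α s)) ≠ 0 := fun hzero => by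
    refine hyA ?_
    rw [← hα0]
    refine eq_zero_of_hasDerivAt_mul (f := fun τ => lorentz (along wA Ψ (α τ)) (along wA ν (α τ)))
      (c := fun τ => cB (α τ)) (fun τ hτ => (hα τ hτ).1.2.2) (fun τ hτ => ?_) hs hzero 0 h0
    have hd := hasDerivAt_comp_integralCurve
      ((hA.lorentz (S.smooth_normal.along hU F.smoothA)).diffAt hU (hα τ hτ).1.1) (hα τ hτ).2
    rwa [F.symm.along_A_sff_B S (fun _ hy => mixed_symm S hκ hy) (hα τ hτ).1.1] at hd
  have hqB : lorentz (along wB Ψ (β t)) (along wB ν (β t)) ≠ 0 := fun hzero => by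
    refine hzB ?_
    rw [← hβ0]
    refine eq_zero_of_hasDerivAt_mul (f := fun τ => lorentz (along wB Ψ (β τ)) (along wB ν (β τ)))
      (c := fun τ => cA (β τ)) (fun τ hτ => (hβ τ hτ).1.2.1) (fun τ hτ => ?_) ht hzero 0 h0
    have hd := hasDerivAt_comp_integralCurve
      ((hB.lorentz (S.smooth_normal.along hU F.smoothB)).diffAt hU (hβ τ hτ).1.1) (hβ τ hτ).2
    rwa [F.along_A_sff_B S hκ (hβ τ hτ).1.1] at hd
  rw [← hst] at hqB
  exact mul_ne_zero hqA hqB (hprod _ (hα s hs).1.1)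

omit hκ in
/-- Along the integral curves of `B`, where `b(B, B) = 0`, the surface is a straight line. -/
lemma apply_integralCurve_eq (hB0 : ∀ y ∈ U, along wB Ψ y 0 = 1) {β : ℝ → E2} {η : ℝ}
    (hβ : ∀ t ∈ Set.Ioo (-η) η, (β t ∈ U ∧ lorentz (along wB Ψ (β t)) (along wB ν (β t)) = 0) ∧
      HasDerivAt β (wB (β t)) t) {u : ℝ} (hu : u ∈ Set.Ioo (-η) η) :
    Ψ (β u) = Ψ (β 0) + u • along wB Ψ (β 0) := by
  have hU := S.isOpen
  have hη : 0 < η := by linarith [hu.1, hu.2]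
  have h0 : (0 : ℝ) ∈ Set.Ioo (-η) η := ⟨by linarith, hη⟩
  have hconst : ∀ {G : ℝ → R41}, (∀ t ∈ Set.Ioo (-η) η, HasDerivAt G 0 t) →
      ∀ t ∈ Set.Ioo (-η) η, G t = G 0 := fun hG t ht =>
    (convex_Ioo (-η) η).is_const_of_fderivWithin_eq_zero (𝕜 := ℝ)
      (fun τ hτ => (hG τ hτ).differentiableAt.differentiableWithinAt)
      (fun τ hτ => by
        rw [fderivWithin_of_isOpen isOpen_Ioo hτ]
        simpa using (hG τ hτ).hasFDerivAt.fderiv) ht h0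
  have hB : ∀ t ∈ Set.Ioo (-η) η, along wB Ψ (β t) = along wB Ψ (β 0) :=
    hconst fun t ht => by
      have hd := hasDerivAt_comp_integralCurve ((F.smooth_along_B S).diffAt hU (hβ t ht).1.1)
        (hβ t ht).2
      rwa [F.along_B_B_eq_zero S hB0 (hβ t ht).1.1 (hβ t ht).1.2] at hd
  have h := hconst (G := fun t => Ψ (β t) - t • along wB Ψ (β 0)) (fun t ht => by
    have hd := (hasDerivAt_comp_integralCurve (S.smooth.diffAt hU (hβ t ht).1.1)
      (hβ t ht).2).sub ((hasDerivAt_id t).smul_const (along wB Ψ (β 0)))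
    rw [hB t ht, one_smul, sub_self] at hd
    exact hd) u hu
  simp only [zero_smul, sub_zero] at h
  rw [← h]
  abel

/-- The frame along an integral curve of `A` is a Cartan frame. -/
lemma isCartanFramedNullCurve (hε : ε = 1) {Γ : ℝ → E2} {δ : ℝ}
    (hΓ : ∀ t ∈ Set.Ioo (-δ) δ, Γ t ∈ U ∧ HasDerivAt Γ (wA (Γ t)) t) :
    IsCartanFramedNullCurve (Set.Ioo (-δ) δ) (fun s => Ψ (Γ s)) (fun s => along wA Ψ (Γ s))
      (fun s => along wB Ψ (Γ s)) (fun s => ν (Γ s)) κ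
      (fun s => lorentz (along wA Ψ (Γ s)) (along wA ν (Γ s))) := by
  have hU := S.isOpen
  have hsm : ContDiffOn ℝ ∞ Γ (Set.Ioo (-δ) δ) := contDiffOn_integralCurve F.smoothA hΓ
  have hmaps : Set.MapsTo Γ (Set.Ioo (-δ) δ) U := fun t ht => (hΓ t ht).1
  have hfr : ∀ s ∈ Set.Ioo (-δ) δ, IsAdaptedFrame (along wA Ψ (Γ s)) (along wB Ψ (Γ s))
    (ν (Γ s)) (Ψ (Γ s)) ε := fun s hs => F.adapted S (hmaps hs)
  exact {
    isOpen := isOpen_Ioo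
    ordConnected := Set.ordConnected_Ioo
    smooth_curve := S.smooth.comp hsm hmaps
    smooth_A := (F.smooth_along_A S).comp hsm hmaps
    smooth_B := (F.smooth_along_B S).comp hsm hmaps
    smooth_C := S.smooth_normal.comp hsm hmaps
    mem_deSitter := fun s hs => (hfr s hs).qq
    tangent_A := fun s hs => (hfr s hs).q₀
    tangent_B := fun s hs => (hfr s hs).q₁
    tangent_C := fun s hs => (lorentz_comm _ _).trans (hfr s hs).nq
    AA := fun s hs => F.AA _ (hmaps hs)
    BB := fun s hs => F.BB _ (hmaps hs)
    AB := fun s hs => F.AB _ (hmaps hs)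
    AC := fun s hs => (lorentz_comm _ _).trans (hfr s hs).n₀
    BC := fun s hs => (lorentz_comm _ _).trans (hfr s hs).n₁
    CC := fun s hs => (hfr s hs).nn.trans hε
    deriv_curve := fun s hs =>
      hasDerivAt_comp_integralCurve (S.smooth.diffAt hU (hmaps hs)) (hΓ s hs).2
    deriv_C := fun s hs => by
      have h := hasDerivAt_comp_integralCurve (S.smooth_normal.diffAt hU (hmaps hs)) (hΓ s hs).2
      rwa [F.along_A_normal S hκ (hmaps hs)] at h }

end IsNullFrame

/-! ### Scroll parameters -/

namespace IsNullFrame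

/-- Coordinates with respect to a null basis `A`, `B` with `⟨A, B⟩ = -1`, extended linearly. -/
def nullCoords (A B : R41) : R41 →L[ℝ] ℝ × ℝ :=
  LinearMap.toContinuousLinearMap
    { toFun := fun v => (-lorentz v B, -lorentz v A)
      map_add' := fun v w => by simp only [lorentz_add_left, neg_add, Prod.mk_add_mk]
      map_smul' := fun c v => by
        simp only [lorentz_smul_left, RingHom.id_apply, Prod.smul_mk, smul_eq_mul, mul_neg] }

lemma nullCoords_apply (A B v : R41) : nullCoords A B v = (-lorentz v B, -lorentz v A) := rfl

lemma nullCoords_combination {A B : R41} (hA : lorentz A A = 0) (hB : lorentz B B = 0)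
    (hAB : lorentz A B = -1) (q : ℝ × ℝ) : nullCoords A B (q.1 • A + q.2 • B) = q := by
  have hBA := (lorentz_comm B A).trans hAB
  rw [nullCoords_apply]
  ext <;> simp [hA, hB, hAB, hBA]

lemma hasStrictFDerivAt_scroll {γ B : ℝ → R41} (hγ : ContDiffAt ℝ 1 γ 0)
    (hB : ContDiffAt ℝ 1 B 0) {A : R41} (hA : HasDerivAt γ A 0) :
    HasStrictFDerivAt (scroll γ B) ((ContinuousLinearMap.fst ℝ ℝ ℝ).smulRight A
      + (ContinuousLinearMap.snd ℝ ℝ ℝ).smulRight (B 0)) (0 : ℝ × ℝ) := by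
  have h1 : HasStrictDerivAt γ A 0 := by
    rw [← hA.deriv]; exact hγ.hasStrictDerivAt (by simp)
  have h2 : HasStrictDerivAt B (deriv B 0) 0 := hB.hasStrictDerivAt (by simp)
  have hf : HasStrictFDerivAt (Prod.fst : ℝ × ℝ → ℝ) (ContinuousLinearMap.fst ℝ ℝ ℝ) 0 :=
    hasStrictFDerivAt_fst
  have hs : HasStrictFDerivAt (Prod.snd : ℝ × ℝ → ℝ) (ContinuousLinearMap.snd ℝ ℝ ℝ) 0 :=
    hasStrictFDerivAt_snd
  have h3 := (HasStrictFDerivAt.comp (0 : ℝ × ℝ) (g := γ) (f := Prod.fst)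
      h1.hasStrictFDerivAt hf).add
    (hs.smul (HasStrictFDerivAt.comp (0 : ℝ × ℝ) (g := B) (f := Prod.fst)
      h2.hasStrictFDerivAt hf))
  refine h3.congr_fderiv ?_
  ext <;> simp

variable {U : Set E2} {Ψ ν : E2 → R41} {ε κ : ℝ} {x : E2} {wA wB : E2 → E2}
  (F : IsNullFrame U Ψ wA wB) (S : IsParamSurface U Ψ ν ε)
include F

/-- The null coordinates of the position vector are local coordinates of the surface. -/
lemma exists_equiv_nullCoords (hx : x ∈ U) : ∃ e : E2 ≃L[ℝ] ℝ × ℝ, (e : E2 →L[ℝ] ℝ × ℝ) =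
    (nullCoords (along wA Ψ x) (along wB Ψ x)).comp (fderiv ℝ Ψ x) := by
  set L := (nullCoords (along wA Ψ x) (along wB Ψ x)).comp (fderiv ℝ Ψ x) with hL
  have hsurj : Function.Surjective (L : E2 →ₗ[ℝ] ℝ × ℝ) := fun q => by
    refine ⟨q.1 • wA x + q.2 • wB x, ?_⟩
    change nullCoords _ _ (fderiv ℝ Ψ x (q.1 • wA x + q.2 • wB x)) = q
    rw [map_add, map_smul, map_smul]
    exact nullCoords_combination (F.AA x hx) (F.BB x hx) (F.AB x hx) q
  have hinj := (LinearMap.injective_iff_surjective_of_finrank_eq_finrank (by simp)).2 hsurj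
  exact ⟨(LinearEquiv.ofBijective (L : E2 →ₗ[ℝ] ℝ × ℝ) ⟨hinj, hsurj⟩).toContinuousLinearEquiv,
    by ext <;> rfl⟩

include S

/-- Where `b(B, B) = 0`, the surface is an open part of the scroll of the integral curve of `A`
through the given point, with rulings in the direction `B`. -/
lemma exists_scroll (hκ : ∀ y ∈ U, lorentz (along wA Ψ y) (along wB ν y) = κ) (hε : ε = 1)
    (hB0 : ∀ y ∈ U, along wB Ψ y 0 = 1) (hx : x ∈ U)
    (hq : ∀ᶠ y in nhds x, lorentz (along wB Ψ y) (along wB ν y) = 0) {O : Set E2}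
    (hO : O ∈ nhds x) :
    ∃ (I : Set ℝ) (γ A B C : ℝ → R41) (k : ℝ → ℝ) (e : OpenPartialHomeomorph E2 (ℝ × ℝ)),
      IsCartanFramedNullCurve I γ A B C κ k ∧
      (∀ s ∈ I, ∃ y ∈ O, k s = lorentz (along wA Ψ y) (along wA ν y)) ∧
      x ∈ e.source ∧ e.target ⊆ I ×ˢ Set.univ ∧ ∀ y ∈ e.source, Ψ y = scroll γ B (e y) := by
  have hU := S.isOpen
  have hsm : ∀ {w : E2 → E2}, Smooth U w → ContDiffAt ℝ 1 w x := fun hw =>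
    (hw.contDiffAt (hU.mem_nhds hx)).of_le (by simp)
  set P := nullCoords (along wA Ψ x) (along wB Ψ x) with hP
  -- a chart of the plane given by two coordinates of the position vector
  obtain ⟨L, hL⟩ := F.exists_equiv_nullCoords hx
  have hG₁ : HasStrictFDerivAt (fun y => P (Ψ y)) (L : E2 →L[ℝ] ℝ × ℝ) x := by
    rw [hL]
    exact P.hasStrictFDerivAt.comp x
      ((S.smooth.contDiffAt (hU.mem_nhds hx)).hasStrictFDerivAt (by simp))
  set G₁ := hG₁.toOpenPartialHomeomorph (fun y => P (Ψ y)) with hG₁d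
  have hxG₁ : x ∈ G₁.source := hG₁.mem_toOpenPartialHomeomorph_source
  have hG₁a : ∀ y, G₁ y = P (Ψ y) := fun y => rfl
  -- the rulings and the base curve
  obtain ⟨r, hr, η, hη, hflow⟩ := exists_integralCurve (hsm F.smoothB)
    (Filter.inter_mem (Filter.inter_mem (hU.mem_nhds hx) hq) (G₁.open_source.mem_nhds hxG₁))
  choose! β hβ0 hβ using hflow
  obtain ⟨r', hr', δ, hδ, hcurve⟩ := exists_integralCurve (hsm F.smoothA)
    (Filter.inter_mem (Filter.inter_mem (hU.mem_nhds hx) hO) (Metric.ball_mem_nhds x hr))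
  obtain ⟨Γ, hΓ0, hΓ⟩ := hcurve x (Metric.mem_ball_self hr')
  have h0 : (0 : ℝ) ∈ Set.Ioo (-δ) δ := ⟨by linarith, hδ⟩
  have hC := F.isCartanFramedNullCurve S hκ hε (Γ := Γ) (δ := δ)
    fun t ht => ⟨(hΓ t ht).1.1.1, (hΓ t ht).2⟩
  set γ : ℝ → R41 := fun s => Ψ (Γ s) with hγ
  set B : ℝ → R41 := fun s => along wB Ψ (Γ s) with hB
  -- a chart of the parameters of the scroll given by the same coordinates
  have hsm' : ∀ {f : ℝ → R41}, ContDiffOn ℝ ∞ f (Set.Ioo (-δ) δ) → ContDiffAt ℝ 1 f 0 :=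
    fun hf => (hf.contDiffAt (isOpen_Ioo.mem_nhds h0)).of_le (by simp)
  have hG₂ : HasStrictFDerivAt (fun q => P (scroll γ B q))
      ((ContinuousLinearEquiv.refl ℝ (ℝ × ℝ) : (ℝ × ℝ) ≃L[ℝ] ℝ × ℝ) : (ℝ × ℝ) →L[ℝ] ℝ × ℝ) 0 := by
    have h := P.hasStrictFDerivAt.comp (0 : ℝ × ℝ)
      (hasStrictFDerivAt_scroll (hsm' hC.smooth_curve) (hsm' hC.smooth_B) (hC.deriv_curve 0 h0))
    refine h.congr_fderiv (ContinuousLinearMap.ext fun q => ?_)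
    have hq := nullCoords_combination (F.AA x hx) (F.BB x hx) (F.AB x hx) q
    rw [← hP] at hq
    simp only [hB, hΓ0]
    exact hq
  set G₂ := hG₂.toOpenPartialHomeomorph (fun q => P (scroll γ B q)) with hG₂d
  have h0G₂ : (0 : ℝ × ℝ) ∈ G₂.source := hG₂.mem_toOpenPartialHomeomorph_source
  have hG₂a : ∀ q, G₂ q = P (scroll γ B q) := fun q => rfl
  set W : Set (ℝ × ℝ) := Set.Ioo (-δ) δ ×ˢ Set.Ioo (-η) η with hW
  have hWo : IsOpen W := isOpen_Ioo.prod isOpen_Ioo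
  have hx0 : G₁ x = G₂ 0 := by
    rw [hG₁a, hG₂a, scroll, Prod.fst_zero, Prod.snd_zero, zero_smul, add_zero, hγ]
    simp only [hΓ0]
  refine ⟨_, γ, _, B, _, _, (G₁.trans G₂.symm).trans (OpenPartialHomeomorph.ofSet W hWo), hC,
    fun s hs => ⟨Γ s, (hΓ s hs).1.1.2, rfl⟩, ?_, ?_, fun y hy => ?_⟩
  · have h1 : G₂.symm (G₁ x) = 0 := by rw [hx0]; exact G₂.left_inv h0G₂
    have h2 : G₁ x ∈ G₂.target := by rw [hx0]; exact G₂.map_source h0G₂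
    simp only [OpenPartialHomeomorph.trans_source, OpenPartialHomeomorph.ofSet_source,
      OpenPartialHomeomorph.symm_source, Set.mem_inter_iff, Set.mem_preimage,
      OpenPartialHomeomorph.coe_trans, Function.comp_apply, h1]
    exact ⟨⟨hxG₁, h2⟩, h0, neg_lt_zero.2 hη, hη⟩
  · intro q hq
    rw [OpenPartialHomeomorph.trans_target] at hq
    exact ⟨hq.1.1, trivial⟩
  · simp only [OpenPartialHomeomorph.trans_source, OpenPartialHomeomorph.ofSet_source,
      OpenPartialHomeomorph.symm_source, Set.mem_inter_iff, Set.mem_preimage,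
      OpenPartialHomeomorph.coe_trans, Function.comp_apply] at hy
    obtain ⟨⟨hy1, hy2⟩, hs, hu⟩ := hy
    change Ψ y = scroll γ B (G₂.symm (G₁ y))
    set s := (G₂.symm (G₁ y)).1
    set u := (G₂.symm (G₁ y)).2
    have hball := (hΓ s hs).1.2
    have hline := F.apply_integralCurve_eq S hB0 (β := β (Γ s)) (η := η)
      (fun t ht => ⟨(hβ _ hball t ht).1.1, (hβ _ hball t ht).2⟩) hu
    rw [hβ0 _ hball] at hline
    have hline' : Ψ (β (Γ s) u) = scroll γ B (G₂.symm (G₁ y)) := hline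
    have heq : G₁ (β (Γ s) u) = G₁ y := by
      rw [hG₁a, hline', ← hG₂a, G₂.right_inv hy2]
    rw [← hline', G₁.injOn (hβ _ hball u hu).1.2 hy1 heq]

end IsNullFrame

namespace IsOrientedSurface

variable {M : Type*} [TopologicalSpace M] [ChartedSpace E2 M] [IsManifold (𝓡 2) ∞ M]
  {ψ N : M → R41} {ε : ℝ}

/-- A surface whose shape operator has a constant non-zero double eigenvalue, but is not everywhere
a multiple of the identity, is a B-scroll. -/
theorem isBScroll (hs : IsOrientedSurface ψ N ε) (hε : ε = 1) {κ : ℝ} (hκ : κ ≠ 0)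
    (ht : ∀ p, (shape ψ N p).trace = 2 * κ) (hd : ∀ p, (shape ψ N p).det = κ ^ 2)
    (hu : ∃ p, ¬ IsUmbilicAt ψ N p) : IsBScroll ψ N := by
  refine ⟨hu, κ, hκ, fun p => ?_⟩
  have S := hs.isParamSurface p
  set U := chartImage p
  set Ψ := inChart p ψ
  set ν := inChart p N
  set x := extChartAt (𝓡 2) p p with hxd
  have hx : x ∈ U := mem_extChartAt_target p
  have hF := fun σ (hσ : σ * σ = 1) => S.isNullFrame hε hσ
  have hmix : ∀ {wA wB : E2 → E2}, IsNullFrame U Ψ wA wB → ∀ y ∈ U,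
      lorentz (along wA Ψ y) (along wB ν y) = κ := fun F y hy => by
    have h1 := (F.trS_detS_eq S hy).1
    rw [hs.trS_inChart hy, ht] at h1
    linarith
  have hprod : ∀ {wA wB : E2 → E2}, IsNullFrame U Ψ wA wB → ∀ y ∈ U,
      lorentz (along wA Ψ y) (along wA ν y) * lorentz (along wB Ψ y) (along wB ν y) = 0 :=
    fun F y hy => by
      have h1 := (F.trS_detS_eq S hy).2
      rw [hs.detS_inChart hy, hd, hmix F y hy] at h1
      linarith
  -- a null frame whose second direction is asymptotic near the given point
  obtain ⟨wA, wB, F, hB0, hqB⟩ : ∃ wA wB, IsNullFrame U Ψ wA wB ∧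
      (∀ y ∈ U, along wB Ψ y 0 = 1) ∧
      ∀ᶠ y in nhds x, lorentz (along wB Ψ y) (along wB ν y) = 0 := by
    have F₁ := hF 1 (by norm_num)
    rcases F₁.eventually_eq_zero_or S (hmix F₁) (hprod F₁) hx with h | h
    · refine ⟨_, _, hF (-1) (by norm_num), fun y hy => S.along_nullB_time hε hy _, ?_⟩
      filter_upwards [h] with y hy
      simp only [IsParamSurface.along_smul, lorentz_smul_left, lorentz_smul_right] at hy ⊢
      have hy' : lorentz (along (IsParamSurface.nullDir Ψ (-1)) Ψ y)
        (along (IsParamSurface.nullDir Ψ (-1)) ν y) = 0 := by linarith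
      rw [hy', mul_zero, mul_zero]
    · exact ⟨_, _, F₁, fun y hy => S.along_nullB_time hε hy _, h⟩
  have hO : {y | ¬ IsUmbilicAt ψ N p → lorentz (along wA Ψ y) (along wA ν y) ≠ 0} ∈ nhds x := by
    by_cases hp : IsUmbilicAt ψ N p
    · exact Filter.Eventually.of_forall fun y h => absurd hp h
    · have hx0 : lorentz (along wA Ψ x) (along wA ν x) ≠ 0 := fun h => hp <|
        (hs.isUmbilicAt_iff_sff (mem_extChartAt_source p)).2
          ⟨κ, F.sff_eq_of_eq_zero S (hmix F) hx h hqB.self_of_nhds⟩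
      exact ((IsNullFrame.continuousAt_lorentz_along S hx (F.smooth_along_A S)
        (S.smooth_normal.along S.isOpen F.smoothA)).eventually_ne hx0).mono fun y h _ => h
  obtain ⟨I, γ, A, B, C, k, e, hC, hk, hxe, he, heq⟩ :=
    F.exists_scroll S (hmix F) hε hB0 hx hqB hO
  refine ⟨I, γ, A, B, C, k, (chartAt E2 p).trans e, hC, fun hp s hs' => ?_, ?_, ?_, fun q hq => ?_⟩
  · obtain ⟨y, hy, hky⟩ := hk s hs'
    rw [hky]
    exact hy hp
  · rw [OpenPartialHomeomorph.trans_source]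
    exact ⟨mem_chart_source _ p, by simpa [hxd] using hxe⟩
  · rw [OpenPartialHomeomorph.trans_target]
    exact Set.inter_subset_left.trans he
  · rw [OpenPartialHomeomorph.trans_source] at hq
    have h1 := heq (chartAt E2 p q) hq.2
    have h2 : Ψ (extChartAt (𝓡 2) p q) = ψ q :=
      inChart_extChartAt (by rw [extChartAt_source]; exact hq.1)
    simp only [mfld_simps] at h2
    rw [← h2]
    exact h1

end IsOrientedSurface

end DeSitterSurface

end

theorem theoremB {M : Type*} [TopologicalSpace M] [T2Space M] [SecondCountableTopology M]
    [ConnectedSpace M] [ChartedSpace (EuclideanSpace ℝ (Fin 2)) M] [IsManifold (𝓡 2) ∞ M]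
    (ψ N : M → Fin 4 → ℝ) (ε : ℝ)
    (hsurf : DeSitterSurface.IsOrientedSurface ψ N ε)
    (htype : DeSitterSurface.IsL1TwoType ψ N ε) :
    DeSitterSurface.IsOpenPortionOfStandardProduct ψ ∨
    DeSitterSurface.IsBScroll ψ N ∨
    ((¬ ∃ c : ℝ, ∀ p, DeSitterSurface.meanCurvature ψ N ε p = c) ∧
      (¬ ∃ c : ℝ, ∀ p, DeSitterSurface.gaussCurvature ψ p = c) ∧
      (¬ ∃ κ : ℝ, ∀ p, DeSitterSurface.IsPrincipalCurvatureAt ψ N p κ)) := by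
  obtain ⟨a, ψ₁, ψ₂, μ₁, μ₂, hμ, h₁, h₂, h⟩ := htype
  by_cases hiso : (∃ c, ∀ p, DeSitterSurface.meanCurvature ψ N ε p = c) ∨
    (∃ c, ∀ p, DeSitterSurface.gaussCurvature ψ p = c) ∨
      ∃ κ, ∀ p, DeSitterSurface.IsPrincipalCurvatureAt ψ N p κ
  swap
  · exact Or.inr (Or.inr ⟨fun hc => hiso (.inl hc), fun hc => hiso (.inr (.inl hc)),
      fun hc => hiso (.inr (.inr hc))⟩)
  obtain ⟨c, d, hc, hd⟩ := hsurf.isoparametric h₁ h₂ h hiso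
  obtain ⟨p, hp⟩ := hsurf.not_totally_umbilic h₁ h₂ h hμ hc hd
  have hd0 := hsurf.det_const_ne_zero h₁ h₂ h hμ hc hd
  by_cases hδ : c ^ 2 - 4 * d = 0
  · -- a double principal curvature: for a Riemannian metric every point would be umbilical
    right; left
    have hε : ε = 1 := hsurf.sign.resolve_right fun hε =>
      hp (hsurf.isUmbilicAt_of_discr_eq_zero hε (by rw [hc, hd, hδ]))
    have hd' : d = (c / 2) ^ 2 := by linarith
    refine hsurf.isBScroll hε (κ := c / 2) (fun h0 => hd0 ?_) (fun q => ?_) (fun q => ?_) ⟨p, hp⟩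
    · rw [hd', h0]; norm_num
    · rw [hc]; ring
    · rw [hd, hd']
  · -- the discriminant is positive, so the principal curvatures are real and distinct
    left
    have hdε := hsurf.det_eq_neg_sign hc hd hδ p
    have hδ0 : 0 < c ^ 2 - 4 * d := by
      rcases hsurf.sign with hε | hε
      · rw [hdε, hε]; nlinarith [sq_nonneg c]
      · refine lt_of_le_of_ne ?_ (Ne.symm hδ)
        rw [← hc p, ← hd p]
        exact hsurf.discr_nonneg hε p
    have hs0 := Real.sqrt_pos.2 hδ0
    have hs2 := Real.sq_sqrt hδ0.le
    refine hsurf.isOpenPortionOfStandardProduct (k := (c + √(c ^ 2 - 4 * d)) / 2)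
      (l := (c - √(c ^ 2 - 4 * d)) / 2) (by linarith) ?_ (fun q => ?_) (fun q => ?_)
    · rw [← hdε]; linear_combination (-1 / 4 : ℝ) * hs2
    · rw [hc]; ring
    · rw [hd]; linear_combination (1 / 4 : ℝ) * hs2
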